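/- **Definitions.** A *segment* in $\mathbb S^2$ is a continuous curve $\gamma:[0,1]\to\mathbb S^2$ that is injective except that possibly $\gamma(0)=\gamma(1)$ (then it is a *loop*). Segments are *non crossing* if two different ones meet at most at their end points. A *closed line* is a simple closed curve. A *regular domain* is a non-empty connected open set $D\subset\mathbb S^2$ satisfying an interior cone condition, whose boundary is a finite union of regular $C^{1,\alpha}$ segments ($\alpha>0$) that are non crossing. A *strong $4$-partition* of $\mathbb S^2$ is a family $\mathcal D=(D_1,\dots,D_4)$ of pairwise disjoint regular domains with $\mathrm{Int}(\overline{\bigcup_i D_i})=\mathbb S^2$; its boundary set is $N=N(\mathcal D)=\overline{\bigcup_i\partial D_i}$. A point $x\in N$ is *critical of valence* $\nu(x)=n\ge 3$ if near $x$ the set $N$ is the union of $n$ regular simple $C^1$ arcs with one end at $x$, pairwise disjoint away from $x$ and leaving $x$ in pairwise distinct directions; $X(N)$ is the set of critical points. $\mathcal D$ is *regular* if $X(N)$ is finite and near every other point $N$ is an open regular simple $C^1$ arc. $D_i\ne D_j$ are *neighbors* if $\mathrm{Int}(\overline{D_i\cup D_j})$ is connected, and $\mathcal D$ is *admissible* if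 the graph of neighbors is bipartite. $\mathcal D$ has *no cracks* if $\mathrm{Int}(\overline{D_i})=D_i$ for all $i$. **Proposition.** Let $\mathcal D$ be a regular, non-admissible, strong $4$-partition of $\mathbb S^2$ and $N=N(\mathcal D)$. Then exactly one of the following holds: 1. $X(N)$ consists of four points, all of valence $3$, and $N$ consists of six non crossing segments whose end points are critical points. If $\mathcal D$ has no cracks, each of them joins two distinct critical points $x_i$ and $x_j$ ($i\ne j$). 2. $X(N)$ consists of three points $x_1,x_2,x_3$ with $\nu(x_1)=\nu(x_2)=3$, $\nu(x_3)=4$, and $N$ consists of five non crossing segments whose end points are critical points. If $\mathcal D$ has no cracks, at most one of them is a loop, and such a loop starts and ends at $x_3$; the others join two distinct critical points. 3. $X(N)$ consists of two points $x_1,x_2$ with $\nu(x_1)=\nu(x_2)=3$, and $N$ consists of three non crossing segments joining $x_1$ and $x_2$ and of one closed line disjoint from them. 4. $X(N)$ consists of two points $x_1,x_2$ with $\nu(x_1)=3$, $\nu(x_2)=5$, and $N$ consists of four non crossing segments: three joining $x_1$ and $x_2$, and one loop from $x_2$ to $x_2$. -/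

import Mathlib

open Set Topology

namespace SpherePartition

/-- Euclidean three-space. -/
abbrev E3 : Type := EuclideanSpace ℝ (Fin 3)

/-- The unit sphere `S²`, with the topology induced by `E3`. -/
abbrev S2 : Type := Metric.sphere (0 : E3) 1

/-! ### Curves on the sphere

A curve is a function `ℝ → S2` of which only the restriction to `[0, 1]` (or `[-1, 1]`) matters. -/

/-- `γ` restricted to the interval `[a, b]`, seen as a curve in `E3`, is a regular `C¹` curve
(up to the end points): continuously differentiable with nowhere vanishing velocity. -/
def IsC1Regular (γ : ℝ → S2) (a b : ℝ) : Prop :=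
  ContDiffOn ℝ 1 (fun t => (γ t : E3)) (Icc a b) ∧
    ∀ t ∈ Icc a b, derivWithin (fun t => (γ t : E3)) (Icc a b) t ≠ 0

/-- `γ` is a regular curve of class `C^{1,+}` on `[0, 1]`, i.e. of class `C^{1,α}` for some
`α > 0`. -/
def IsC1PlusRegular (γ : ℝ → S2) : Prop :=
  IsC1Regular γ 0 1 ∧ ∃ C α : NNReal, 0 < α ∧
    HolderOnWith C α (derivWithin (fun t => (γ t : E3)) (Icc 0 1)) (Icc 0 1)

/-- The trace `γ([0, 1])`. -/
def trace (γ : ℝ → S2) : Set S2 := γ '' Icc 0 1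

/-- A segment: a continuous curve on `[0, 1]` without self-intersection, except that its two end
points may coincide. -/
def IsSegment (γ : ℝ → S2) : Prop :=
  ContinuousOn γ (Icc 0 1) ∧
    ∀ s ∈ Icc (0 : ℝ) 1, ∀ t ∈ Icc (0 : ℝ) 1, s < t → γ s = γ t → s = 0 ∧ t = 1

/-- A finite family of segments with no mutual nor self intersections, except possibly at their
end points. -/
def NonCrossing {n : ℕ} (γ : Fin n → ℝ → S2) : Prop :=
  (∀ i, IsSegment (γ i)) ∧
    ∀ i j, i ≠ j → ∀ s ∈ Icc (0 : ℝ) 1, ∀ t ∈ Icc (0 : ℝ) 1, γ i s = γ j t →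
      (s = 0 ∨ s = 1) ∧ (t = 0 ∨ t = 1)

/-- A closed line: a simple closed curve. -/
def IsClosedLine (c : ℝ → S2) : Prop := IsSegment c ∧ c 0 = c 1

/-- The segment `γ` starts and ends at the same point. -/
def IsLoop (γ : ℝ → S2) : Prop := γ 0 = γ 1

/-! ### Regular domains -/

/-- The spherical cone with vertex `x` and axis the unit tangent vector `v` at `x`: the points `y`
at distance `< r` from `x` such that the geodesic from `x` to `y` leaves `x` in a direction making
with `v` an angle of cosine `> c`. (The direction is that of the tangential part
`y - ⟪x, y⟫ x` of `y`; its inner product with `v` is `⟪v, y⟫`.) -/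
def cone (x : S2) (v : E3) (c r : ℝ) : Set S2 :=
  {y | dist y x < r ∧
    c * ‖(y : E3) - (inner ℝ (x : E3) (y : E3)) • (x : E3)‖ < inner ℝ v (y : E3)}

/-- Interior cone condition: every boundary point is the vertex of a cone of fixed aperture and
size contained in `D`. -/
def InteriorCone (D : Set S2) : Prop :=
  ∃ c r : ℝ, c < 1 ∧ 0 < r ∧ ∀ x ∈ frontier D,
    ∃ v : E3, ‖v‖ = 1 ∧ inner ℝ (x : E3) v = 0 ∧ cone x v c r ⊆ D

/-- A regular domain: a (non-empty) connected open set with the interior cone condition, whose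
boundary is a finite union of simple regular `C^{1,+}` arcs meeting at most at their ends. -/
def IsRegularDomain (D : Set S2) : Prop :=
  IsOpen D ∧ IsConnected D ∧ InteriorCone D ∧
    ∃ (n : ℕ) (γ : Fin n → ℝ → S2), (∀ i, IsC1PlusRegular (γ i)) ∧ NonCrossing γ ∧
      frontier D = ⋃ i, trace (γ i)

/-! ### Regular closed sets -/

/-- Near `x`, the set `N` is the union of `n` regular `C¹` arcs with one end at `x`, which are
simple, pairwise disjoint away from `x`, and leave `x` in pairwise distinct directions (each pair
makes at `x` an angle in `(0, 2π)`). -/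
def IsStar (N : Set S2) (x : S2) (n : ℕ) : Prop :=
  ∃ γ : Fin n → ℝ → S2,
    (∀ i, IsC1Regular (γ i) 0 1 ∧ InjOn (γ i) (Icc 0 1) ∧ γ i 0 = x) ∧
    (∀ i j, i ≠ j → trace (γ i) ∩ trace (γ j) ⊆ {x}) ∧
    (∀ i j, i ≠ j → ¬ SameRay ℝ (derivWithin (fun t => (γ i t : E3)) (Icc 0 1) 0)
      (derivWithin (fun t => (γ j t : E3)) (Icc 0 1) 0)) ∧
    ∃ U ∈ 𝓝 x, N ∩ U = (⋃ i, trace (γ i)) ∩ U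

/-- `x` is a critical point of `N` with valence `ν(x) = n`. -/
def HasValence (N : Set S2) (x : S2) (n : ℕ) : Prop := x ∈ N ∧ 3 ≤ n ∧ IsStar N x n

/-- The set `X(N)` of critical points of `N`. -/
def criticalSet (N : Set S2) : Set S2 := {x | ∃ n, HasValence N x n}

/-- Near `x`, the set `N` is an open regular simple `C¹` arc passing through `x`. -/
def IsSmoothPoint (N : Set S2) (x : S2) : Prop :=
  ∃ γ : ℝ → S2, IsC1Regular γ (-1) 1 ∧ InjOn γ (Icc (-1) 1) ∧ γ 0 = x ∧
    ∃ U ∈ 𝓝 x, N ∩ U = γ '' Ioo (-1) 1 ∩ U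

/-- The class `M(S²)` of regular closed sets: finitely many critical points, and near any other
point of `N` a smooth arc. (`S²` has no boundary, hence there are no boundary points to consider.) -/
def IsRegularClosedSet (N : Set S2) : Prop :=
  IsClosed N ∧ (criticalSet N).Finite ∧ ∀ x ∈ N, x ∉ criticalSet N → IsSmoothPoint N x

/-! ### Partitions -/

/-- A `k`-partition of `S²`: pairwise disjoint regular domains. -/
def IsPartition {k : ℕ} (D : Fin k → Set S2) : Prop :=
  (∀ i, IsRegularDomain (D i)) ∧ Pairwise fun i j => Disjoint (D i) (D j)

/-- Strong partitions. -/
def IsStrong {k : ℕ} (D : Fin k → Set S2) : Prop := interior (closure (⋃ i, D i)) = univ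

/-- The boundary set `N(D)`. -/
def boundarySet {k : ℕ} (D : Fin k → Set S2) : Set S2 := closure (⋃ i, frontier (D i))

/-- A partition is regular if its boundary set is a regular closed set. -/
def IsRegularPartition {k : ℕ} (D : Fin k → Set S2) : Prop :=
  IsPartition D ∧ IsRegularClosedSet (boundarySet D)

/-- The graph `G(D)`: two different domains are neighbors when the interior of the closure of
their union is connected. -/
def neighborGraph {k : ℕ} (D : Fin k → Set S2) : SimpleGraph (Fin k) where
  Adj i j := i ≠ j ∧ IsConnected (interior (closure (D i ∪ D j)))
  symm := ⟨fun i j h => ⟨h.1.symm, by rw [union_comm]; exact h.2⟩⟩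
  loopless := ⟨fun _ h => h.1 rfl⟩

/-- Admissible partitions: the graph of neighbors is bipartite. -/
def IsAdmissible {k : ℕ} (D : Fin k → Set S2) : Prop := (neighborGraph D).IsBipartite

/-- No domain of the partition has a crack, i.e. lies on both sides of a part of its boundary. -/
def NoCracks {k : ℕ} (D : Fin k → Set S2) : Prop := ∀ i, interior (closure (D i)) = D i

/-! ### The four types -/

/-- `X(N)` consists of four points of valence 3 and `N` of six non crossing segments joining
critical points; these join two distinct critical points if there are no cracks. -/
def IsType3333 {k : ℕ} (D : Fin k → Set S2) : Prop :=
  ∃ x : Fin 4 → S2, Function.Injective x ∧ criticalSet (boundarySet D) = range x ∧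
    (∀ i, HasValence (boundarySet D) (x i) 3) ∧
    ∃ γ : Fin 6 → ℝ → S2, NonCrossing γ ∧ boundarySet D = (⋃ m, trace (γ m)) ∧
      (∀ m, γ m 0 ∈ range x ∧ γ m 1 ∈ range x) ∧
      (NoCracks D → ∀ m, ¬ IsLoop (γ m))

/-- `X(N)` consists of three points, of valences 3, 3, 4, and `N` of five non crossing segments
joining critical points; if there are no cracks, at most one of them is a loop, and it is then
attached to the point of valence 4. -/
def IsType334 {k : ℕ} (D : Fin k → Set S2) : Prop :=
  ∃ x : Fin 3 → S2, Function.Injective x ∧ criticalSet (boundarySet D) = range x ∧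
    HasValence (boundarySet D) (x 0) 3 ∧ HasValence (boundarySet D) (x 1) 3 ∧
    HasValence (boundarySet D) (x 2) 4 ∧
    ∃ γ : Fin 5 → ℝ → S2, NonCrossing γ ∧ boundarySet D = (⋃ m, trace (γ m)) ∧
      (∀ m, γ m 0 ∈ range x ∧ γ m 1 ∈ range x) ∧
      (NoCracks D → (∀ m, IsLoop (γ m) → γ m 0 = x 2) ∧
        ∀ l m, IsLoop (γ l) → IsLoop (γ m) → l = m)

/-- `X(N)` consists of two points of valence 3 and `N` of three non crossing segments joining
them and of one closed line (disjoint from the segments). -/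
def IsType33 {k : ℕ} (D : Fin k → Set S2) : Prop :=
  ∃ x : Fin 2 → S2, Function.Injective x ∧ criticalSet (boundarySet D) = range x ∧
    (∀ i, HasValence (boundarySet D) (x i) 3) ∧
    ∃ (γ : Fin 3 → ℝ → S2) (c : ℝ → S2), NonCrossing γ ∧ IsClosedLine c ∧
      (∀ m, Disjoint (trace (γ m)) (trace c)) ∧
      boundarySet D = (⋃ m, trace (γ m)) ∪ trace c ∧
      ∀ m, γ m 0 = x 0 ∧ γ m 1 = x 1

/-- `X(N)` consists of two points, of valences 3 and 5, and `N` of four non crossing segments: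
three joining the two critical points, and a loop at the point of valence 5. -/
def IsType35 {k : ℕ} (D : Fin k → Set S2) : Prop :=
  ∃ x : Fin 2 → S2, Function.Injective x ∧ criticalSet (boundarySet D) = range x ∧
    HasValence (boundarySet D) (x 0) 3 ∧ HasValence (boundarySet D) (x 1) 5 ∧
    ∃ γ : Fin 4 → ℝ → S2, NonCrossing γ ∧ boundarySet D = (⋃ m, trace (γ m)) ∧
      (∀ m, m ≠ 3 → γ m 0 = x 0 ∧ γ m 1 = x 1) ∧
      γ 3 0 = x 1 ∧ γ 3 1 = x 1

/-- Names of the four types, by valences. -/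
inductive FourType : Type
  | t3333 | t334 | t33 | t35

/-- The partition `D` is of the given type. -/
def HasType {k : ℕ} (D : Fin k → Set S2) : FourType → Prop
  | .t3333 => IsType3333 D
  | .t334 => IsType334 D
  | .t33 => IsType33 D
  | .t35 => IsType35 D

end SpherePartition

namespace SpherePartition

/-! The boundary set `N` is a finite graph on the sphere, made of `m` arcs, some of which may be
closed lines free of critical points. The topology used is a duality mod 2. The jumps of a function
constant on each domain form a 1-cycle of the graph. Conversely every 1-cycle is obtained in this
way, because the first cohomology of the sphere with coefficients in `ZMod 2` vanishes
(`GermTorsor.exists_global`, by gluing over pieces with connected overlaps). Only constants have no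
jumps, since the sphere is connected. `IsTameNet.exists_facePair` collects these facts. They rest on
a local model: in a suitable chart, `N` near a point is a union of graphs `arg w = θ i ‖w‖`
(`IsArcStar.exists_polarStar`), and jumps along the branches can be prescribed exactly when their
sum is zero.

Let `p` be the number of critical points. Cycles form a space of dimension 3 (four faces, modulo
constants) and boundaries satisfy one linear relation, so `m ≤ p + 2` (`IsFacePair.le_card_add`).
Valences are at least 3, so counting ends of arcs gives `3 p ≤ 2 m`, hence `p ≤ 4`. If the chain of
all arcs were a cycle, a function jumping across each arc would colour the graph of neighbors with
two colours. So for a non-admissible partition it is not a cycle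
(`IsFacePair.exists_chainBoundary_ne_zero`): some critical point has odd valence, and `m ≥ 4`, as
cycles do not fill the space of chains. There remain `(p, m) = (2, 4), (3, 5), (4, 6)`, and counting
ends gives the valences.

For the shape of the graph, an arc on which every cycle vanishes has the same face on both sides
(`IsFacePair.eq_of_cycle`). This forbids loops at points of valence 3 in the absence of cracks and,
for `p = 2`, yields three arcs joining the critical points. The types exclude each other because
valence is intrinsic (`HasValence.unique`). -/

/-- `f` is constant near `x`, outside of `N`. -/
def ConstNear {α β : Type*} [TopologicalSpace α] (N : Set α) (f : α → β) (x : α) : Prop :=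
  ∃ c, ∀ᶠ y in 𝓝 x, y ∉ N → f y = c

/-! ### Functions locally constant off a set with dense complement -/

section ConstNear

variable {α β : Type*} [TopologicalSpace α] {N : Set α} {f g : α → β} {x : α}

theorem ConstNear.eventually (h : ConstNear N f x) : ∀ᶠ y in 𝓝 x, ConstNear N f y := by
  obtain ⟨c, hc⟩ := h
  filter_upwards [eventually_eventually_nhds.2 hc] with y hy using ⟨c, hy⟩

/-- Density supplies points off `N` in every neighbourhood; otherwise both conditions could be
vacuous. -/
theorem eventually_unique_const (hN : Dense Nᶜ) {c d : β}
    (hc : ∀ᶠ y in 𝓝 x, y ∉ N → f y = c) (hd : ∀ᶠ y in 𝓝 x, y ∉ N → f y = d) : c = d := by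
  obtain ⟨U, hU, hUo, hx⟩ := eventually_nhds_iff.1 (hc.and hd)
  obtain ⟨y, hyU, hy⟩ := hN.inter_open_nonempty U hUo ⟨x, hx⟩
  rw [← (hU y hyU).1 hy, (hU y hyU).2 hy]

/-- The set `T` may lie inside `N`. What propagates along `T` is the constant taken nearby off `N`,
which cannot change because it is unique at each point. -/
theorem exists_const_of_isPreconnected [Nonempty β] (hN : Dense Nᶜ) {T : Set α}
    (hT : IsPreconnected T) (h : ∀ x ∈ T, ConstNear N f x) :
    ∃ c, ∀ x ∈ T, ∀ᶠ y in 𝓝 x, y ∉ N → f y = c := by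
  rcases T.eq_empty_or_nonempty with rfl | ⟨x₀, hx₀⟩
  · exact ⟨Classical.arbitrary β, by simp⟩
  obtain ⟨c, hc⟩ := h x₀ hx₀
  refine ⟨c, fun x hx => (hT.induction₂ (P := fun x y => ∀ c, (∀ᶠ z in 𝓝 x, z ∉ N → f z = c) ↔
    (∀ᶠ z in 𝓝 y, z ∉ N → f z = c)) ?_ ?_ ?_ hx₀ hx c).1 hc⟩
  · intro x hx
    obtain ⟨d, hd⟩ := h x hx
    filter_upwards [mem_nhdsWithin_of_mem_nhds (eventually_eventually_nhds.2 hd)] with y hy c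
    exact ⟨fun h1 => eventually_unique_const hN h1 hd ▸ hy,
      fun h1 => eventually_unique_const hN h1 hy ▸ hd⟩
  · exact fun x y z _ _ _ h1 h2 c => (h1 c).trans (h2 c)
  · exact fun x y _ _ h1 c => (h1 c).symm

theorem eq_of_isPreconnected [Nonempty β] (hN : Dense Nᶜ) {T : Set α}
    (hT : IsPreconnected T) (h : ∀ x ∈ T, ConstNear N f x) {x y : α} (hx : x ∈ T) (hy : y ∈ T)
    (hxN : x ∉ N) (hyN : y ∉ N) : f x = f y := by
  obtain ⟨c, hc⟩ := exists_const_of_isPreconnected hN hT h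
  rw [(hc x hx).self_of_nhds hxN, (hc y hy).self_of_nhds hyN]

end ConstNear

/-! ### Vanishing of the first cohomology of the sphere -/

/-- A subset `Good f x` of germs of functions which is a torsor under the functions which are
locally constant outside of `N`. -/
structure GermTorsor {α : Type*} [TopologicalSpace α] (N : Set α)
    (Good : (α → ZMod 2) → α → Prop) : Prop where
  congr : ∀ f g x c, Good f x → (∀ᶠ y in 𝓝 x, y ∉ N → g y = f y + c) → Good g x
  unique : ∀ f g x, Good f x → Good g x → ConstNear N (fun y => f y + g y) x
  exists_near : ∀ x, ∃ f, ∀ᶠ y in 𝓝 x, Good f y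

/-- A Mayer–Vietoris step: on the connected set `A ∩ B` the two sections differ by a single constant
`c`, and adding `c` to one of them makes them agree off `N`. -/
theorem GermTorsor.glue {α : Type*} [PseudoMetricSpace α] {N : Set α}
    {Good : (α → ZMod 2) → α → Prop} (hG : GermTorsor N Good) (hN : Dense Nᶜ) {A B : Set α}
    (hA : IsClosed A) (hB : IsClosed B) (hAB : IsPreconnected (A ∩ B))
    (h1 : ∃ f, ∀ x ∈ A, Good f x) (h2 : ∃ f, ∀ x ∈ B, Good f x) :
    ∃ f, ∀ x ∈ A ∪ B, Good f x := by
  classical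
  obtain ⟨f, hf⟩ := h1
  obtain ⟨g, hg⟩ := h2
  rcases A.eq_empty_or_nonempty with rfl | hAn
  · exact ⟨g, by simpa using hg⟩
  rcases B.eq_empty_or_nonempty with rfl | hBn
  · exact ⟨f, by simpa using hf⟩
  obtain ⟨c, hc⟩ := exists_const_of_isPreconnected hN hAB
    (fun x hx => hG.unique f g x (hf x hx.1) (hg x hx.2))
  have two : ∀ a b : ZMod 2, a + b = c → b + c = a := by
    intro a b hab
    rw [← hab, add_comm a b, ← add_assoc, CharTwo.add_self_eq_zero, zero_add]
  -- Points are sorted by the nearer of the two sets. Near a point of `A` outside `B` only `f` is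
  -- used, near a point of `B` outside `A` only `g + c`, and near a common point both agree off `N`.
  refine ⟨fun y => if Metric.infDist y A ≤ Metric.infDist y B then f y else g y + c, ?_⟩
  have cA : Continuous fun y => Metric.infDist y A := Metric.continuous_infDist_pt A
  have cB : Continuous fun y => Metric.infDist y B := Metric.continuous_infDist_pt B
  intro x hx
  by_cases hxA : x ∈ A
  · refine hG.congr f _ x 0 (hf x hxA) ?_
    by_cases hxB : x ∈ B
    · filter_upwards [hc x ⟨hxA, hxB⟩] with y hy hyN
      split_ifs
      · simp
      · simp [two _ _ (hy hyN)]
    · have : Metric.infDist x A < Metric.infDist x B := by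
        rw [Metric.infDist_zero_of_mem hxA]
        exact (hB.notMem_iff_infDist_pos hBn).1 hxB
      filter_upwards [cA.continuousAt.eventually_lt cB.continuousAt this] with y hy _
      simp [hy.le]
  · have hxB : x ∈ B := hx.resolve_left hxA
    refine hG.congr g _ x c (hg x hxB) ?_
    have : Metric.infDist x B < Metric.infDist x A := by
      rw [Metric.infDist_zero_of_mem hxB]
      exact (hA.notMem_iff_infDist_pos hAn).1 hxA
    filter_upwards [cB.continuousAt.eventually_lt cA.continuousAt this] with y hy _
    simp [not_le.2 hy]

/-- Induction over intervals by subdivision. -/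
theorem Icc_subdivision_induction {Q : ℝ → ℝ → Prop} {a b : ℝ} (hab : a ≤ b)
    (hloc : ∀ x ∈ Icc a b, ∃ η > 0, ∀ s t, x - η < s → s ≤ t → t < x + η → Q s t)
    (htrans : ∀ s t u, s ≤ t → t ≤ u → Q s t → Q t u → Q s u) : Q a b := by
  choose! η hη hQ using hloc
  obtain ⟨t, ht0, hmono, ⟨m, hm⟩, hsub⟩ := exists_monotone_Icc_subset_open_cover_Icc hab
    (c := fun x : Icc a b => Subtype.val ⁻¹' Ioo (x - η x) (x + η x))
    (fun x => isOpen_Ioo.preimage continuous_subtype_val)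
    (fun x _ => mem_iUnion.2 ⟨x, by simp [hη x x.2]⟩)
  have step : ∀ n, Q (t n) (t (n + 1)) := by
    intro n
    obtain ⟨x, hx⟩ := hsub n
    have h1 := hx (left_mem_Icc.2 (hmono n.le_succ))
    have h2 := hx (right_mem_Icc.2 (hmono n.le_succ))
    exact hQ x x.2 _ _ h1.1 (hmono n.le_succ) h2.2
  have all : ∀ n, Q a (t n) := by
    intro n
    induction n with
    | zero =>
      rw [ht0]
      have := hQ a (left_mem_Icc.2 hab) a a
      have h0 := hη a (left_mem_Icc.2 hab)
      exact this (by linarith) le_rfl (by linarith)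
    | succ n ih => exact htrans _ _ _ (t n).2.1 (hmono n.le_succ) ih (step n)
  simpa [hm m le_rfl] using all m

/-- A part of a hemisphere cut out by the first two coordinates. -/
def capRect (σ a b c d : ℝ) : Set S2 :=
  {y | 0 ≤ σ * (y : E3) 2 ∧ ((y : E3) 0 ∈ Icc a b ∧ (y : E3) 1 ∈ Icc c d)}

theorem continuous_coord (i : Fin 3) : Continuous fun y : S2 => (y : E3) i := by fun_prop

theorem isClosed_capRect (σ a b c d : ℝ) : IsClosed (capRect σ a b c d) := by
  have h2 := continuous_coord 2
  exact (isClosed_le continuous_const (continuous_const.mul h2)).inter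
    ((isClosed_Icc.preimage (continuous_coord 0)).inter (isClosed_Icc.preimage (continuous_coord 1)))

theorem sq_sum_coord (y : S2) : (y : E3) 0 ^ 2 + (y : E3) 1 ^ 2 + (y : E3) 2 ^ 2 = 1 := by
  have h := y.2
  rw [mem_sphere_zero_iff_norm] at h
  have h2 := EuclideanSpace.real_norm_sq_eq (y : E3)
  rw [h, Fin.sum_univ_three] at h2
  linarith

/-- The point of the hemisphere of sign `σ` with given first two coordinates. -/
noncomputable def capPt (σ u v : ℝ) : E3 := !₂[u, v, σ * √(1 - u ^ 2 - v ^ 2)]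

theorem continuous_capPt (σ : ℝ) : Continuous fun p : ℝ × ℝ => capPt σ p.1 p.2 := by
  unfold capPt
  refine (PiLp.continuous_toLp 2 _).comp ?_
  refine continuous_pi fun i => ?_
  fin_cases i
  · exact continuous_fst
  · exact continuous_snd
  · simp only [Fin.reduceFinMk, Matrix.cons_val]
    fun_prop

theorem eq_capPt {σ : ℝ} (hσ : σ = 1 ∨ σ = -1) (y : S2) (hy : 0 ≤ σ * (y : E3) 2) :
    (y : E3) = capPt σ ((y : E3) 0) ((y : E3) 1) := by
  have h := sq_sum_coord y
  ext i
  fin_cases i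
  · simp [capPt]
  · simp [capPt]
  · simp only [capPt, Fin.reduceFinMk, PiLp.toLp_apply, Matrix.cons_val]
    have : 1 - (y : E3) 0 ^ 2 - (y : E3) 1 ^ 2 = (σ * (y : E3) 2) ^ 2 := by
      rcases hσ with rfl | rfl <;> linarith
    rw [this, Real.sqrt_sq hy]
    rcases hσ with rfl | rfl <;> ring

theorem capPt_mem {σ : ℝ} (hσ : σ = 1 ∨ σ = -1) {u v : ℝ} (h : u ^ 2 + v ^ 2 ≤ 1) :
    capPt σ u v ∈ Metric.sphere (0 : E3) 1 := by
  rw [mem_sphere_zero_iff_norm, EuclideanSpace.norm_eq, Real.sqrt_eq_one, Fin.sum_univ_three]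
  have h0 : 0 ≤ 1 - u ^ 2 - v ^ 2 := by linarith
  simp only [capPt, PiLp.toLp_apply, Matrix.cons_val, Real.norm_eq_abs, sq_abs]
  rw [mul_pow, Real.sq_sqrt h0]
  rcases hσ with rfl | rfl <;> ring

/-- With the first coordinate fixed, the piece is the image of an interval under the graph of the
hemisphere, or empty if `a ^ 2 > 1`. It serves as the overlap of two adjacent rectangles. -/
theorem isPreconnected_capRect_of_fst {σ : ℝ} (hσ : σ = 1 ∨ σ = -1) (a c d : ℝ) :
    IsPreconnected (capRect σ a a c d) := by
  have hI : IsPreconnected (Icc c d ∩ Icc (-√(1 - a ^ 2)) (√(1 - a ^ 2))) :=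
    (ordConnected_Icc.inter ordConnected_Icc).isPreconnected
  have hc : Continuous fun v => capPt σ a v :=
    (continuous_capPt σ).comp (Continuous.prodMk continuous_const continuous_id)
  rw [← Topology.IsInducing.subtypeVal.isPreconnected_image]
  by_cases ha : 0 ≤ 1 - a ^ 2
  · convert hI.image _ hc.continuousOn using 1
    ext p
    constructor
    · rintro ⟨y, ⟨h2, h0, h1⟩, rfl⟩
      have e := eq_capPt hσ y h2
      have h0' : (y : E3) 0 = a := le_antisymm h0.2 h0.1
      have hs := sq_sum_coord y
      refine ⟨(y : E3) 1, ⟨h1, ?_⟩, ?_⟩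
      · rw [mem_Icc, ← abs_le]
        apply Real.abs_le_sqrt
        rw [h0'] at hs
        nlinarith [sq_nonneg ((y : E3) 2)]
      · rw [h0'] at e
        exact e.symm
    · rintro ⟨v, ⟨hv, hv2⟩, rfl⟩
      have hv3 : v ^ 2 ≤ 1 - a ^ 2 := by
        rw [mem_Icc, ← abs_le] at hv2
        calc v ^ 2 = |v| ^ 2 := (sq_abs v).symm
          _ ≤ √(1 - a ^ 2) ^ 2 := by gcongr
          _ = _ := Real.sq_sqrt ha
      refine ⟨⟨capPt σ a v, capPt_mem hσ (by linarith)⟩, ⟨?_, ?_, ?_⟩, rfl⟩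
      · simp only [capPt, PiLp.toLp_apply, Matrix.cons_val]
        rw [← mul_assoc]
        rcases hσ with rfl | rfl <;> simp [Real.sqrt_nonneg]
      · simp [capPt]
      · simpa [capPt] using hv
  · convert isPreconnected_empty
    rw [image_eq_empty]
    ext y
    simp only [capRect, mem_ofPred_eq, mem_empty_iff_false, iff_false]
    rintro ⟨h2, h0, h1⟩
    have h0' : (y : E3) 0 = a := le_antisymm h0.2 h0.1
    have hs := sq_sum_coord y
    rw [h0'] at hs
    nlinarith [sq_nonneg ((y : E3) 2), sq_nonneg ((y : E3) 1)]

theorem isPreconnected_capRect_of_snd {σ : ℝ} (hσ : σ = 1 ∨ σ = -1) (a b c : ℝ) :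
    IsPreconnected (capRect σ a b c c) := by
  have hI : IsPreconnected (Icc a b ∩ Icc (-√(1 - c ^ 2)) (√(1 - c ^ 2))) :=
    (ordConnected_Icc.inter ordConnected_Icc).isPreconnected
  have hc : Continuous fun v => capPt σ v c :=
    (continuous_capPt σ).comp (Continuous.prodMk continuous_id continuous_const)
  rw [← Topology.IsInducing.subtypeVal.isPreconnected_image]
  by_cases ha : 0 ≤ 1 - c ^ 2
  · convert hI.image _ hc.continuousOn using 1
    ext p
    constructor
    · rintro ⟨y, ⟨h2, h0, h1⟩, rfl⟩
      have e := eq_capPt hσ y h2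
      have h1' : (y : E3) 1 = c := le_antisymm h1.2 h1.1
      have hs := sq_sum_coord y
      refine ⟨(y : E3) 0, ⟨h0, ?_⟩, ?_⟩
      · rw [mem_Icc, ← abs_le]
        apply Real.abs_le_sqrt
        rw [h1'] at hs
        nlinarith [sq_nonneg ((y : E3) 2)]
      · rw [h1'] at e
        exact e.symm
    · rintro ⟨v, ⟨hv, hv2⟩, rfl⟩
      have hv3 : v ^ 2 ≤ 1 - c ^ 2 := by
        rw [mem_Icc, ← abs_le] at hv2
        calc v ^ 2 = |v| ^ 2 := (sq_abs v).symm
          _ ≤ √(1 - c ^ 2) ^ 2 := by gcongr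
          _ = _ := Real.sq_sqrt ha
      refine ⟨⟨capPt σ v c, capPt_mem hσ (by linarith)⟩, ⟨?_, ?_, ?_⟩, rfl⟩
      · simp only [capPt, PiLp.toLp_apply, Matrix.cons_val]
        rw [← mul_assoc]
        rcases hσ with rfl | rfl <;> simp [Real.sqrt_nonneg]
      · simpa [capPt] using hv
      · simp [capPt]
  · convert isPreconnected_empty
    rw [image_eq_empty]
    ext y
    simp only [capRect, mem_ofPred_eq, mem_empty_iff_false, iff_false]
    rintro ⟨h2, h0, h1⟩
    have h1' : (y : E3) 1 = c := le_antisymm h1.2 h1.1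
    have hs := sq_sum_coord y
    rw [h1'] at hs
    nlinarith [sq_nonneg ((y : E3) 2), sq_nonneg ((y : E3) 0)]

theorem isPreconnected_equator : IsPreconnected {y : S2 | (y : E3) 2 = 0} := by
  rw [← Topology.IsInducing.subtypeVal.isPreconnected_image]
  have hc : Continuous fun t : ℝ => (!₂[Real.cos t, Real.sin t, 0] : E3) := by
    refine (PiLp.continuous_toLp 2 _).comp (continuous_pi fun i => ?_)
    fin_cases i
    · exact Real.continuous_cos
    · exact Real.continuous_sin
    · exact continuous_const
  convert isPreconnected_range hc
  ext p
  constructor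
  · rintro ⟨y, hy, rfl⟩
    have hs := sq_sum_coord y
    rw [show (y : E3) 2 = 0 from hy] at hs
    have hn : ‖(⟨(y : E3) 0, (y : E3) 1⟩ : ℂ)‖ = 1 := by
      rw [Complex.norm_eq_sqrt_sq_add_sq, Real.sqrt_eq_one]
      linarith
    have hz : (⟨(y : E3) 0, (y : E3) 1⟩ : ℂ) ≠ 0 := by
      rw [← norm_ne_zero_iff, hn]
      exact one_ne_zero
    refine ⟨Complex.arg ⟨(y : E3) 0, (y : E3) 1⟩, ?_⟩
    ext i
    fin_cases i
    · simp [Complex.cos_arg hz, hn]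
    · simp [Complex.sin_arg, hn]
    · simpa using hy.symm
  · rintro ⟨t, rfl⟩
    refine ⟨⟨!₂[Real.cos t, Real.sin t, 0], ?_⟩, ?_, rfl⟩
    · rw [mem_sphere_zero_iff_norm, EuclideanSpace.norm_eq, Real.sqrt_eq_one, Fin.sum_univ_three]
      simp
    · simp

/-- Small rectangles carry a section, since one representative is good on a whole neighbourhood.
They are glued in the second coordinate into strips, then in the first; the overlaps are connected
arcs. -/
theorem GermTorsor.exists_on_cap {N : Set S2} {Good : (S2 → ZMod 2) → S2 → Prop}
    (hG : GermTorsor N Good) (hN : Dense Nᶜ) {σ : ℝ} (hσ : σ = 1 ∨ σ = -1) :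
    ∃ f, ∀ x ∈ capRect σ (-1) 1 (-1) 1, Good f x := by
  have local_rect : ∀ u v : ℝ, ∃ η > 0, ∀ s t s' t', u - η < s → t < u + η →
      v - η < s' → t' < v + η → ∃ f, ∀ x ∈ capRect σ s t s' t', Good f x := by
    intro u v
    by_cases huv : u ^ 2 + v ^ 2 ≤ 1
    · obtain ⟨f, hf⟩ := hG.exists_near ⟨capPt σ u v, capPt_mem hσ huv⟩
      obtain ⟨W, hW, hWG⟩ := (mem_nhds_subtype _ _ _).1 hf
      have h1 := (continuous_capPt σ).continuousAt (x := (u, v)) hW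
      obtain ⟨η, hη, hball⟩ := Metric.mem_nhds_iff.1 h1
      refine ⟨η, hη, fun s t s' t' hs ht hs' ht' => ⟨f, ?_⟩⟩
      rintro y ⟨h2, h0, h1⟩
      apply hWG
      rw [mem_preimage, eq_capPt hσ y h2]
      apply hball (a := ((y : E3) 0, (y : E3) 1))
      rw [Metric.mem_ball, Prod.dist_eq, max_lt_iff, Real.dist_eq, Real.dist_eq, abs_lt, abs_lt]
      refine ⟨⟨?_, ?_⟩, ?_, ?_⟩ <;> linarith [h0.1, h0.2, h1.1, h1.2]
    -- Outside the closed unit disc, a small rectangle has no point of the sphere above it, so any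
    -- function will do.
    · have hc : Continuous fun p : ℝ × ℝ => p.1 ^ 2 + p.2 ^ 2 := by fun_prop
      have h1 := hc.continuousAt.eventually_mem (x := (u, v)) (lt_mem_nhds (not_le.1 huv))
      obtain ⟨η, hη, hball⟩ := Metric.mem_nhds_iff.1 h1
      refine ⟨η, hη, fun s t s' t' hs ht hs' ht' => ⟨fun _ => 0, ?_⟩⟩
      rintro y ⟨h2, h0, h1⟩
      exfalso
      have hs := sq_sum_coord y
      have : 1 < (y : E3) 0 ^ 2 + (y : E3) 1 ^ 2 := by
        apply hball (a := ((y : E3) 0, (y : E3) 1))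
        rw [Metric.mem_ball, Prod.dist_eq, max_lt_iff, Real.dist_eq, Real.dist_eq, abs_lt, abs_lt]
        refine ⟨⟨?_, ?_⟩, ?_, ?_⟩ <;> linarith [h0.1, h0.2, h1.1, h1.2]
      nlinarith [sq_nonneg ((y : E3) 2)]
  have strip : ∀ u : ℝ, ∃ η > 0, ∀ s t, u - η < s → t < u + η →
      ∃ f, ∀ x ∈ capRect σ s t (-1) 1, Good f x := by
    intro u
    -- The width `η` of the strip belongs to the property being propagated, because each gluing
    -- replaces two widths by their minimum.
    refine Icc_subdivision_induction (Q := fun c d => ∃ η > 0, ∀ s t, u - η < s → t < u + η →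
      ∃ f, ∀ x ∈ capRect σ s t c d, Good f x) (by norm_num) ?_ ?_
    · intro v _
      obtain ⟨η, hη, h⟩ := local_rect u v
      exact ⟨η, hη, fun s' t' hs' _ ht' => ⟨η, hη, fun s t hs ht => h s t s' t' hs ht hs' ht'⟩⟩
    · rintro c d e hcd hde ⟨η, hη, h⟩ ⟨η', hη', h'⟩
      refine ⟨min η η', lt_min hη hη', fun s t hs ht => ?_⟩
      have e1 : u - η ≤ u - min η η' := by linarith [min_le_left η η']
      have e2 : u - η' ≤ u - min η η' := by linarith [min_le_right η η']
      have hf := hG.glue hN (isClosed_capRect σ s t c d) (isClosed_capRect σ s t d e) ?_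
        (h s t (by linarith) (by linarith)) (h' s t (by linarith) (by linarith))
      · obtain ⟨f, hf⟩ := hf
        refine ⟨f, fun x hx => hf x ?_⟩
        rcases le_total ((x : E3) 1) d with h1 | h1
        · exact Or.inl ⟨hx.1, hx.2.1, hx.2.2.1, h1⟩
        · exact Or.inr ⟨hx.1, hx.2.1, h1, hx.2.2.2⟩
      · refine (congrArg IsPreconnected (Set.ext fun x => ⟨?_, ?_⟩)).mpr (isPreconnected_capRect_of_snd hσ s t d)
        · rintro ⟨⟨a1, a2, a3⟩, _, _, a4⟩
          exact ⟨a1, a2, a4.1, a3.2⟩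
        · rintro ⟨a1, a2, a3⟩
          exact ⟨⟨a1, a2, by linarith [a3.1], a3.2⟩, a1, a2, a3.1, by linarith [a3.2]⟩
  refine Icc_subdivision_induction (Q := fun s t => ∃ f, ∀ x ∈ capRect σ s t (-1) 1, Good f x)
    (by norm_num) ?_ ?_
  · intro u _
    obtain ⟨η, hη, h⟩ := strip u
    exact ⟨η, hη, fun s t hs _ ht => h s t hs ht⟩
  · intro s t u hst htu h h'
    have hf := hG.glue hN (isClosed_capRect σ s t _ _) (isClosed_capRect σ t u _ _) ?_ h h'
    · obtain ⟨f, hf⟩ := hf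
      refine ⟨f, fun x hx => hf x ?_⟩
      rcases le_total ((x : E3) 0) t with h1 | h1
      · exact Or.inl ⟨hx.1, ⟨hx.2.1.1, h1⟩, hx.2.2⟩
      · exact Or.inr ⟨hx.1, ⟨h1, hx.2.1.2⟩, hx.2.2⟩
    · refine (congrArg IsPreconnected (Set.ext fun x => ⟨?_, ?_⟩)).mpr (isPreconnected_capRect_of_fst hσ t (-1) 1)
      · rintro ⟨⟨a1, a2, a3⟩, _, a4, _⟩
        exact ⟨a1, ⟨a4.1, a2.2⟩, a3⟩
      · rintro ⟨a1, a2, a3⟩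
        exact ⟨⟨a1, ⟨by linarith [a2.1], a2.2⟩, a3⟩, a1, ⟨a2.1, by linarith [a2.2]⟩, a3⟩

/-- On the sphere, a torsor of germs has a global section. -/
theorem GermTorsor.exists_global {N : Set S2} {Good : (S2 → ZMod 2) → S2 → Prop}
    (hG : GermTorsor N Good) (hN : Dense Nᶜ) : ∃ f, ∀ x, Good f x := by
  have hmem : ∀ (y : S2) (i : Fin 3), (y : E3) i ∈ Icc (-1 : ℝ) 1 := by
    intro y i
    have hs := sq_sum_coord y
    rw [mem_Icc, ← abs_le, ← sq_le_one_iff_abs_le_one]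
    fin_cases i <;> simp only [Fin.zero_eta, Fin.mk_one, Fin.reduceFinMk] <;>
      nlinarith [sq_nonneg ((y : E3) 0), sq_nonneg ((y : E3) 1), sq_nonneg ((y : E3) 2)]
  -- The two closed hemispheres meet along the equator, which is connected.
  have hf := hG.glue hN (isClosed_capRect 1 (-1) 1 (-1) 1) (isClosed_capRect (-1) (-1) 1 (-1) 1) ?_
    (hG.exists_on_cap hN (Or.inl rfl)) (hG.exists_on_cap hN (Or.inr rfl))
  · obtain ⟨f, hf⟩ := hf
    refine ⟨f, fun x => hf x ?_⟩
    rcases le_total 0 ((x : E3) 2) with h | h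
    · exact Or.inl ⟨by linarith, hmem x 0, hmem x 1⟩
    · exact Or.inr ⟨by linarith, hmem x 0, hmem x 1⟩
  · refine (congrArg IsPreconnected (Set.ext fun x => ⟨?_, ?_⟩)).mpr (isPreconnected_equator)
    · rintro ⟨⟨h1, -⟩, h2, -⟩
      change (x : E3) 2 = 0
      linarith
    · intro h
      have h : (x : E3) 2 = 0 := h
      exact ⟨⟨by linarith, hmem x 0, hmem x 1⟩, by linarith, hmem x 0, hmem x 1⟩

/-! ### Arcs in polar coordinates -/

/-- Mean value inequality for `b t - t • w`, whose derivative is small near `0` by continuity.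
Uniformity in both `s` and `t` is what later makes the norm monotone along the arc. -/
theorem exists_norm_sub_sub_le {b : ℝ → ℂ} {δ : ℝ} (hδ : 0 < δ) (hb : ContDiffOn ℝ 1 b (Icc 0 δ))
    {ε : ℝ} (hε : 0 < ε) : ∃ η > 0, η ≤ δ ∧ ∀ s t, 0 ≤ s → s ≤ t → t ≤ η →
      ‖b t - b s - (t - s) • derivWithin b (Icc 0 δ) 0‖ ≤ ε * (t - s) := by
  set w := derivWithin b (Icc 0 δ) 0
  have hu : UniqueDiffOn ℝ (Icc 0 δ) := uniqueDiffOn_Icc hδ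
  have hc : ContinuousOn (derivWithin b (Icc 0 δ)) (Icc 0 δ) :=
    hb.continuousOn_derivWithin hu le_rfl
  have h0 := hc 0 (left_mem_Icc.2 hδ.le)
  obtain ⟨η, hη, hball⟩ := Metric.continuousWithinAt_iff.1 h0 ε hε
  refine ⟨min (η / 2) δ, by positivity, min_le_right _ _, fun s t hs hst ht => ?_⟩
  have hsub : Icc 0 (min (η / 2) δ) ⊆ Icc 0 δ := Icc_subset_Icc_right (min_le_right _ _)
  have hd : ∀ x ∈ Icc 0 (min (η / 2) δ), HasDerivWithinAt (fun t => b t - t • w)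
      (derivWithin b (Icc 0 δ) x - w) (Icc 0 (min (η / 2) δ)) x := by
    intro x hx
    have h1 := ((hb.differentiableOn one_ne_zero) x (hsub hx)).hasDerivWithinAt.mono hsub
    have h2 : HasDerivWithinAt (fun t : ℝ => t • w) ((1 : ℝ) • w) (Icc 0 (min (η / 2) δ)) x :=
      (hasDerivWithinAt_id x _).smul_const w
    rw [one_smul] at h2
    exact h1.sub h2
  have hbound : ∀ x ∈ Icc 0 (min (η / 2) δ), ‖derivWithin b (Icc 0 δ) x - w‖ ≤ ε := by
    intro x hx
    rw [← dist_eq_norm]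
    refine (hball (hsub hx) ?_).le
    rw [Real.dist_eq, sub_zero, abs_of_nonneg hx.1]
    linarith [hx.2, min_le_left (η / 2) δ]
  have := (convex_Icc 0 (min (η / 2) δ)).norm_image_sub_le_of_norm_hasDerivWithin_le hd hbound
    (x := s) (y := t) ⟨hs, hst.trans ht⟩ ⟨hs.trans hst, ht⟩
  rw [Real.norm_of_nonneg (sub_nonneg.2 hst)] at this
  refine le_trans (le_of_eq ?_) this
  congr 1
  rw [sub_smul]
  abel

/-- In `‖q‖² - ‖p‖² = ⟪q - p, q + p⟫` the main term is `(t² - s²)‖w‖²`, and the errors are at most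
`(t² - s²)(2ε‖w‖ + ε²)`, which is smaller when `4ε ≤ ‖w‖`. -/
theorem norm_lt_norm_of_near_line {w p q : ℂ} {s t ε : ℝ} (hε : 0 ≤ ε) (hεw : 4 * ε ≤ ‖w‖)
    (hw : w ≠ 0) (hs : 0 ≤ s) (hst : s < t) (hp : ‖p - s • w‖ ≤ ε * s) (hq : ‖q - t • w‖ ≤ ε * t)
    (hpq : ‖q - p - (t - s) • w‖ ≤ ε * (t - s)) : ‖p‖ < ‖q‖ := by
  have hwpos : 0 < ‖w‖ := norm_pos_iff.2 hw
  set e₁ := q - p - (t - s) • w with he₁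
  set e₂ := (q - t • w) + (p - s • w) with he₂
  have h2 : ‖e₂‖ ≤ ε * (t + s) := by
    refine (norm_add_le _ _).trans ?_
    linarith
  have hq' : q - p = (t - s) • w + e₁ := by simp [he₁]
  have hp' : q + p = (t + s) • w + e₂ := by rw [he₂, add_smul]; abel
  clear_value e₁ e₂
  have key : ‖q‖ ^ 2 - ‖p‖ ^ 2 = inner ℝ (q - p) (q + p) := by
    rw [inner_sub_left, inner_add_right, inner_add_right, real_inner_self_eq_norm_sq,
      real_inner_self_eq_norm_sq, real_inner_comm p q]
    ring
  rw [hq', hp', inner_add_left, inner_add_right, inner_add_right, inner_smul_left, inner_smul_right,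
    inner_smul_left, inner_smul_right, real_inner_self_eq_norm_sq] at key
  simp only [conj_trivial] at key
  have a1 := abs_le.1 (abs_real_inner_le_norm w e₂)
  have a2 := abs_le.1 (abs_real_inner_le_norm e₁ w)
  have a3 := abs_le.1 (abs_real_inner_le_norm e₁ e₂)
  have ht : 0 < t - s := by linarith
  have hts : 0 < t + s := by linarith
  have b1 : ‖w‖ * ‖e₂‖ ≤ ‖w‖ * (ε * (t + s)) := by gcongr
  have b2 : ‖e₁‖ * ‖w‖ ≤ (ε * (t - s)) * ‖w‖ := by gcongr
  have b3 : ‖e₁‖ * ‖e₂‖ ≤ (ε * (t - s)) * (ε * (t + s)) := by gcongr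
  have hpos : 0 < ‖q‖ ^ 2 - ‖p‖ ^ 2 := by
    have c1 : (t - s) * -(‖w‖ * (ε * (t + s))) ≤ (t - s) * inner ℝ w e₂ :=
      mul_le_mul_of_nonneg_left (by linarith [a1.1]) ht.le
    have c2 : (t + s) * -((ε * (t - s)) * ‖w‖) ≤ (t + s) * inner ℝ e₁ w :=
      mul_le_mul_of_nonneg_left (by linarith [a2.1]) hts.le
    have c4 : 0 < (t - s) * (t + s) * (‖w‖ ^ 2 - 2 * ε * ‖w‖ - ε ^ 2) := by
      have : 0 < ‖w‖ ^ 2 - 2 * ε * ‖w‖ - ε ^ 2 := by nlinarith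
      positivity
    nlinarith [a3.1]
  exact lt_of_pow_lt_pow_left₀ 2 (norm_nonneg _) (by linarith)

/-- A `C¹` arc leaving the origin in a direction of the slit plane is, near the origin, a graph
`arg w = θ ‖w‖` in polar coordinates. -/
theorem exists_polar_graph {b : ℝ → ℂ} {δ : ℝ} (hδ : 0 < δ) (hb : ContDiffOn ℝ 1 b (Icc 0 δ))
    (hb0 : b 0 = 0) (hw : derivWithin b (Icc 0 δ) 0 ∈ Complex.slitPlane) {η : ℝ} (hη : 0 < η) :
    ∃ ρ > 0, ∃ θ : ℝ → ℝ, ContinuousOn θ (Ioo 0 ρ) ∧ (∀ r ∈ Ioo 0 ρ, θ r ∈ Ioo (-Real.pi) Real.pi) ∧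
      (∀ r ∈ Ioo 0 ρ, ∃ t ∈ Ioo 0 (min η δ), b t = r * Complex.exp (θ r * Complex.I)) ∧
      ∃ δ' > 0, δ' ≤ δ ∧ ∀ t ∈ Ioc 0 δ', ‖b t‖ < ρ → (b t).arg = θ ‖b t‖ := by
  set w := derivWithin b (Icc 0 δ) 0 with hwdef
  have hw0 : w ≠ 0 := Complex.slitPlane_ne_zero hw
  obtain ⟨ε₁, hε₁, hball⟩ := Metric.isOpen_iff.1 Complex.isOpen_slitPlane w hw
  -- The first bound keeps `t⁻¹ • b t` in a ball around `w` inside the slit plane; the second makes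
  -- `t ↦ ‖b t‖` strictly increasing.
  set ε := min (ε₁ / 2) (‖w‖ / 4) with hεdef
  have hwpos : 0 < ‖w‖ := norm_pos_iff.2 hw0
  have hε : 0 < ε := by positivity
  obtain ⟨η₁, hη₁, hη₁δ, hest⟩ := exists_norm_sub_sub_le hδ hb hε
  set κ := min η₁ (η / 2) with hκ
  have hκpos : 0 < κ := by positivity
  have hκδ : κ ≤ δ := (min_le_left _ _).trans hη₁δ
  have hest0 : ∀ t ∈ Icc 0 κ, ‖b t - t • w‖ ≤ ε * t := by
    intro t ht
    simpa [hb0] using hest 0 t le_rfl ht.1 (ht.2.trans (min_le_left _ _))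
  have hmono : StrictMonoOn (fun t => ‖b t‖) (Icc 0 κ) := by
    intro s hs t ht hst
    refine norm_lt_norm_of_near_line hε.le ?_ hw0 hs.1 hst (hest0 s hs) (hest0 t ht)
      (hest s t hs.1 hst.le (ht.2.trans (min_le_left _ _)))
    linarith [min_le_right (ε₁ / 2) (‖w‖ / 4)]
  have hslit : ∀ t ∈ Ioc 0 κ, b t ∈ Complex.slitPlane := by
    intro t ht
    have h1 := hest0 t ⟨ht.1.le, ht.2⟩
    have h2 : t⁻¹ • b t ∈ Complex.slitPlane := by
      apply hball
      rw [Metric.mem_ball, dist_eq_norm]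
      have : t⁻¹ • b t - w = t⁻¹ • (b t - t • w) := by
        rw [smul_sub, smul_smul, inv_mul_cancel₀ ht.1.ne', one_smul]
      rw [this, norm_smul, Real.norm_of_nonneg (inv_nonneg.2 ht.1.le)]
      calc t⁻¹ * ‖b t - t • w‖ ≤ t⁻¹ * (ε * t) :=
            mul_le_mul_of_nonneg_left h1 (inv_nonneg.2 ht.1.le)
        _ = ε := by field_simp [ht.1.ne']
        _ < ε₁ := by linarith [min_le_left (ε₁ / 2) (‖w‖ / 4)]
    rw [Complex.mem_slitPlane_iff] at h2 ⊢
    have hi : 0 < t⁻¹ := inv_pos.2 ht.1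
    simpa [hi, hi.ne', ht.1, ht.1.ne'] using h2
  have hbc : ContinuousOn b (Icc 0 κ) := hb.continuousOn.mono (Icc_subset_Icc_right hκδ)
  have hnc : ContinuousOn (fun t => ‖b t‖) (Icc 0 κ) := hbc.norm
  set ρ := ‖b κ‖ with hρ
  have hρpos : 0 < ρ := norm_pos_iff.2 (Complex.slitPlane_ne_zero (hslit κ ⟨hκpos, le_rfl⟩))
  have hex : ∀ r ∈ Ioo 0 ρ, ∃ t ∈ Ioo 0 κ, ‖b t‖ = r := by
    intro r hr
    have := intermediate_value_Ioo hκpos.le hnc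
    simp only [hb0, norm_zero] at this
    exact this hr
  choose! τ hτ hτr using hex
  have hτmono : MonotoneOn τ (Ioo 0 ρ) := by
    intro r hr r' hr' hrr'
    by_contra hlt
    have h1 : ‖b (τ r')‖ < ‖b (τ r)‖ :=
      hmono (Ioo_subset_Icc_self (hτ r' hr')) (Ioo_subset_Icc_self (hτ r hr)) (not_le.1 hlt)
    rw [hτr r hr, hτr r' hr'] at h1
    linarith
  have hτnorm : ∀ t ∈ Ioo 0 κ, ‖b t‖ ∈ Ioo 0 ρ ∧ τ ‖b t‖ = t := by
    intro t ht
    have h1 : ‖b t‖ ∈ Ioo 0 ρ :=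
      ⟨norm_pos_iff.2 (Complex.slitPlane_ne_zero (hslit t ⟨ht.1, ht.2.le⟩)),
        hmono (Ioo_subset_Icc_self ht) (right_mem_Icc.2 hκpos.le) ht.2⟩
    exact ⟨h1, hmono.injOn (Ioo_subset_Icc_self (hτ _ h1)) (Ioo_subset_Icc_self ht) (hτr _ h1)⟩
  -- The inverse of the norm along the arc is monotone and its image is a neighbourhood of `τ r`,
  -- which suffices for continuity.
  have hτc : ∀ r ∈ Ioo 0 ρ, ContinuousAt τ r := by
    intro r hr
    refine continuousAt_of_monotoneOn_of_image_mem_nhds hτmono (isOpen_Ioo.mem_nhds hr) ?_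
    refine Filter.mem_of_superset (isOpen_Ioo.mem_nhds (hτ r hr)) ?_
    intro t ht
    exact ⟨_, (hτnorm t ht).1, (hτnorm t ht).2⟩
  have hτslit : ∀ r ∈ Ioo 0 ρ, b (τ r) ∈ Complex.slitPlane :=
    fun r hr => hslit _ ⟨(hτ r hr).1, (hτ r hr).2.le⟩
  refine ⟨ρ, hρpos, fun r => (b (τ r)).arg, ?_, ?_, ?_, κ / 2, by positivity, by linarith, ?_⟩
  · intro r hr
    have h1 : ContinuousAt b (τ r) :=
      hbc.continuousAt (Icc_mem_nhds (hτ r hr).1 (hτ r hr).2)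
    exact ((Complex.continuousAt_arg (hτslit r hr)).comp
      (f := fun r => b (τ r)) (h1.comp (hτc r hr))).continuousWithinAt
  · intro r hr
    have h1 := Complex.mem_slitPlane_iff_arg.1 (hτslit r hr)
    exact ⟨Complex.neg_pi_lt_arg _, lt_of_le_of_ne (Complex.arg_le_pi _) h1.1⟩
  · intro r hr
    refine ⟨τ r, ⟨(hτ r hr).1, lt_min ?_ ((hτ r hr).2.trans_le hκδ)⟩, ?_⟩
    · linarith [(hτ r hr).2, min_le_right η₁ (η / 2)]
    · conv_lhs => rw [← Complex.norm_mul_exp_arg_mul_I (b (τ r)), hτr r hr]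
  · intro t ht _
    simp only [(hτnorm t ⟨ht.1, by linarith [ht.2]⟩).2]

/-! ### Stars in polar coordinates -/

/-- In the punctured disc of radius `ρ`, the set `M` is the disjoint union of the `n` graphs
`arg w = θ i ‖w‖`, which avoid the negative half axis. -/
structure IsPolarStar {n : ℕ} (M : Set ℂ) (ρ : ℝ) (θ : Fin n → ℝ → ℝ) : Prop where
  pos : 0 < ρ
  cont : ∀ i, ContinuousOn (θ i) (Ioo 0 ρ)
  mem : ∀ i, ∀ r ∈ Ioo 0 ρ, θ i r ∈ Ioo (-Real.pi) Real.pi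
  inj : ∀ i j, i ≠ j → ∀ r ∈ Ioo 0 ρ, θ i r ≠ θ j r
  mem_iff : ∀ w : ℂ, 0 < ‖w‖ → ‖w‖ < ρ → (w ∈ M ↔ ∃ i, w.arg = θ i ‖w‖)

/-- For `u = s + i`, the imaginary part of `u * w` is `s * im w + re w`, which for `w ≠ 0` vanishes
for at most one `s`. All but finitely many `s` thus bring every product off the real axis. -/
theorem exists_rotation_slitPlane {n : ℕ} (w : Fin n → ℂ) (hw : ∀ i, w i ≠ 0) :
    ∃ u : ℂ, u ≠ 0 ∧ ∀ i, u * w i ∈ Complex.slitPlane := by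
  obtain ⟨s, hs⟩ := (Set.finite_range fun i => -(w i).re / (w i).im).exists_notMem
  refine ⟨⟨s, 1⟩, fun h => by simpa using congrArg Complex.im h, fun i => ?_⟩
  rw [Complex.mem_slitPlane_iff]
  by_contra! hcon
  obtain ⟨-, h2⟩ := hcon
  simp only [Complex.mul_im, one_mul] at h2
  by_cases him : (w i).im = 0
  · rw [him, mul_zero, zero_add] at h2
    exact hw i (Complex.ext h2 him)
  · exact hs ⟨i, by field_simp; linarith⟩

/-- Stereographic projection from `-x`. The inverse projection is differentiable, so a zero initial
velocity in the chart would force a zero initial velocity in space. -/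
theorem exists_plane_chart (x : S2) : ∃ φ : OpenPartialHomeomorph S2 ℂ,
    x ∈ φ.source ∧ φ.target = univ ∧ φ x = 0 ∧
    (∀ β : ℝ → S2, ∀ δ : ℝ, 0 < δ → (∀ t ∈ Icc 0 δ, β t ∈ φ.source) →
      IsC1Regular β 0 δ → ContDiffOn ℝ 1 (fun t => φ (β t)) (Icc 0 δ) ∧
        derivWithin (fun t => φ (β t)) (Icc 0 δ) 0 ≠ 0) := by
  have hv : ‖(-x : E3)‖ = 1 := by rw [norm_neg]; exact mem_sphere_zero_iff_norm.1 x.2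
  have : Fact (Module.finrank ℝ E3 = 2 + 1) := ⟨by simp⟩
  have hfr : Module.finrank ℝ (ℝ ∙ (-x : E3))ᗮ = Module.finrank ℝ ℂ := by
    rw [Submodule.finrank_orthogonal_span_singleton (n := 2) (by rw [← norm_ne_zero_iff, hv]; exact one_ne_zero),
      Complex.finrank_real_complex]
  let L : (ℝ ∙ (-x : E3))ᗮ ≃L[ℝ] ℂ := ContinuousLinearEquiv.ofFinrankEq hfr
  refine ⟨(stereographic hv).transHomeomorph L.toHomeomorph, ?_, ?_, ?_, ?_⟩
  · simp only [OpenPartialHomeomorph.transHomeomorph_source, stereographic_source, mem_compl_iff,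
      mem_singleton_iff]
    intro h
    have h1 : (x : E3) = -x := congrArg Subtype.val h
    have h2 : (x : E3) = 0 := by
      have h3 : (2 : ℝ) • (x : E3) = 0 := by
        rw [two_smul]
        nth_rewrite 1 [h1]
        exact neg_add_cancel _
      simpa using h3
    have := mem_sphere_zero_iff_norm.1 x.2
    simp [h2] at this
  · simp [OpenPartialHomeomorph.transHomeomorph]
  · have h : stereographic hv x = 0 := stereographic_neg_apply x
    change L (stereographic hv x) = 0
    rw [h, map_zero]
  · intro β δ hδ hsrc hβ
    have hc : ContDiffOn ℝ 1 (fun t => L (stereoToFun (-x : E3) (β t))) (Icc 0 δ) := by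
      refine L.contDiff.comp_contDiffOn ?_
      refine (contDiffOn_stereoToFun (n := 1)).comp hβ.1 ?_
      intro t ht
      have h := hsrc t ht
      simp only [OpenPartialHomeomorph.transHomeomorph_source, stereographic_source, mem_compl_iff,
        mem_singleton_iff] at h
      intro h'
      apply h
      apply Subtype.ext
      exact ((inner_eq_one_iff_of_norm_eq_one hv (mem_sphere_zero_iff_norm.1 (β t).2)).1 h').symm
    refine ⟨hc, fun h0 => ?_⟩
    have h0m : (0 : ℝ) ∈ Icc 0 δ := left_mem_Icc.2 hδ.le
    refine hβ.2 0 h0m ?_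
    have hd := ((hc.differentiableOn one_ne_zero) 0 h0m).hasDerivWithinAt
    change derivWithin (fun t => L (stereoToFun (-x : E3) (β t))) (Icc 0 δ) 0 = 0 at h0
    rw [h0] at hd
    let g : ℂ → E3 := fun w => stereoInvFunAux (-x : E3) (L.symm w : (ℝ ∙ (-x : E3))ᗮ)
    have hg : Differentiable ℝ g := by
      refine ((contDiff_stereoInvFunAux (m := 1)).differentiable one_ne_zero).comp ?_
      exact ((ℝ ∙ (-x : E3))ᗮ.subtypeL.differentiable).comp L.symm.differentiable
    have hcomp := (hg (L (stereoToFun (-x : E3) (β 0)))).hasFDerivAt.comp_hasDerivWithinAt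
      (0 : ℝ) hd
    rw [map_zero] at hcomp
    have heq : ∀ t ∈ Icc 0 δ, (β t : E3) = (g ∘ fun t => L (stereoToFun (-x : E3) (β t))) t := by
      intro t ht
      have h := hsrc t ht
      have h3 := ((stereographic hv).transHomeomorph L.toHomeomorph).left_inv h
      exact (congrArg Subtype.val h3).symm
    exact (hcomp.congr heq (heq 0 h0m)).derivWithin (uniqueDiffOn_Icc hδ 0 h0m)

theorem IsC1Regular.mono {γ : ℝ → S2} {a b c d : ℝ} (h : IsC1Regular γ a b)
    (hsub : Icc c d ⊆ Icc a b) (hcd : c < d) : IsC1Regular γ c d := by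
  refine ⟨h.1.mono hsub, fun t ht => ?_⟩
  have h1 := (h.1.differentiableOn one_ne_zero t (hsub ht)).hasDerivWithinAt.mono hsub
  rw [h1.derivWithin (uniqueDiffOn_Icc hcd t ht)]
  exact h.2 t (hsub ht)

theorem IsC1Regular.continuousOn {γ : ℝ → S2} {a b : ℝ} (h : IsC1Regular γ a b) :
    ContinuousOn γ (Icc a b) :=
  Topology.IsInducing.subtypeVal.continuousOn_iff.2 h.1.continuousOn

/-- `n` regular `C¹` arcs starting at `x`, disjoint elsewhere, whose union is `N` near `x`. -/
structure IsArcStar {n : ℕ} (N : Set S2) (x : S2) (β : Fin n → ℝ → S2) : Prop where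
  regular : ∀ i, IsC1Regular (β i) 0 1
  injOn : ∀ i, InjOn (β i) (Icc 0 1)
  zero : ∀ i, β i 0 = x
  inter : ∀ i j, i ≠ j → trace (β i) ∩ trace (β j) ⊆ {x}
  nhds : ∃ U ∈ 𝓝 x, N ∩ U = (⋃ i, trace (β i)) ∩ U

/-- A rotation of the chart brings all initial directions into the slit plane, where `arg` is
continuous, so each branch is a polar graph near its start. The graphs are disjoint because the arcs
meet only at `x`. -/
theorem IsArcStar.exists_polarStar {n : ℕ} {N : Set S2} {x : S2} {β : Fin n → ℝ → S2}
    (h : IsArcStar N x β) {η : ℝ} (hη : 0 < η) {W : Set S2} (hW : W ∈ 𝓝 x) :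
    ∃ (φ : OpenPartialHomeomorph S2 ℂ) (ρ : ℝ) (θ : Fin n → ℝ → ℝ), x ∈ φ.source ∧
      φ.target = univ ∧ φ x = 0 ∧ IsPolarStar (φ.symm ⁻¹' N) ρ θ ∧
      (∀ w, ‖w‖ < ρ → φ.symm w ∈ W) ∧
      ∀ i, ∀ r ∈ Ioo 0 ρ, ∃ t ∈ Ioo 0 η, φ.symm (r * Complex.exp (θ i r * Complex.I)) = β i t := by
  obtain ⟨φ₀, hxs, htgt, hφx, hφ⟩ := exists_plane_chart x
  obtain ⟨U, hU, hNU⟩ := h.nhds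
  -- a common interval on which the arcs stay in the chart
  have hδ : ∃ δ > 0, δ ≤ 1 ∧ ∀ i, ∀ t ∈ Icc 0 δ, β i t ∈ φ₀.source := by
    have h1 : ∀ i, ∀ᶠ t in 𝓝[Icc 0 1] (0 : ℝ), β i t ∈ φ₀.source := by
      intro i
      have hc := (h.regular i).continuousOn 0 (left_mem_Icc.2 zero_le_one)
      refine hc.eventually_mem (φ₀.open_source.mem_nhds ?_)
      rw [h.zero i]
      exact hxs
    obtain ⟨δ, hδ, hball⟩ := Metric.mem_nhdsWithin_iff.1 (Filter.eventually_all.2 h1)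
    refine ⟨min (δ / 2) 1, by positivity, min_le_right _ _, fun i t ht => ?_⟩
    refine hball ⟨?_, ht.1, ht.2.trans (min_le_right _ _)⟩ i
    rw [Metric.mem_ball, Real.dist_eq, sub_zero, abs_of_nonneg ht.1]
    linarith [ht.2, min_le_left (δ / 2) 1]
  obtain ⟨δ, hδ, hδ1, hsrc⟩ := hδ
  have hsub : Icc 0 δ ⊆ Icc (0 : ℝ) 1 := Icc_subset_Icc_right hδ1
  have hreg : ∀ i, IsC1Regular (β i) 0 δ := fun i => (h.regular i).mono hsub hδ
  obtain ⟨u, hu, hslit⟩ := exists_rotation_slitPlane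
    (fun i => derivWithin (fun t => φ₀ (β i t)) (Icc 0 δ) 0)
    (fun i => (hφ (β i) δ hδ (hsrc i) (hreg i)).2)
  let φ : OpenPartialHomeomorph S2 ℂ := φ₀.transHomeomorph (Homeomorph.mulLeft₀ u hu)
  have hφapp : ∀ y, φ y = u * φ₀ y := fun y => rfl
  have hsrc' : φ.source = φ₀.source := rfl
  have htgt' : φ.target = univ := by simp [φ, OpenPartialHomeomorph.transHomeomorph, htgt]
  have hφ0 : φ x = 0 := by rw [hφapp, hφx, mul_zero]
  have hsymm0 : φ.symm 0 = x := by rw [← hφ0]; exact φ.left_inv hxs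
  have hpol : ∀ i, ∃ ρ > 0, ∃ θ : ℝ → ℝ, ContinuousOn θ (Ioo 0 ρ) ∧
      (∀ r ∈ Ioo 0 ρ, θ r ∈ Ioo (-Real.pi) Real.pi) ∧
      (∀ r ∈ Ioo 0 ρ, ∃ t ∈ Ioo 0 (min η δ),
        φ (β i t) = r * Complex.exp (θ r * Complex.I)) ∧
      ∃ δ' > 0, δ' ≤ δ ∧ ∀ t ∈ Ioc 0 δ', ‖φ (β i t)‖ < ρ →
        (φ (β i t)).arg = θ ‖φ (β i t)‖ := by
    intro i
    obtain ⟨hc, -⟩ := hφ (β i) δ hδ (hsrc i) (hreg i)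
    have hc' : ContDiffOn ℝ 1 (fun t => φ (β i t)) (Icc 0 δ) := by
      simp only [hφapp]
      exact contDiffOn_const.mul hc
    refine exists_polar_graph hδ hc' ?_ ?_ hη
    · rw [h.zero i, hφ0]
    · have h0m : (0 : ℝ) ∈ Icc 0 δ := left_mem_Icc.2 hδ.le
      have hd := ((hc.differentiableOn one_ne_zero) 0 h0m).hasDerivWithinAt
      have hd' := hd.const_mul u
      have e : derivWithin (fun t => φ (β i t)) (Icc 0 δ) 0 =
        u * derivWithin (fun t => φ₀ (β i t)) (Icc 0 δ) 0 :=
        hd'.derivWithin (uniqueDiffOn_Icc hδ 0 h0m)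
      rw [e]
      exact hslit i
  choose ρ hρ θ hθc hθm hθb δ' hδ' hδ'δ hθa using hpol
  -- a small disc
  have hfar : ∀ i, (β i '' Icc (δ' i) 1)ᶜ ∈ 𝓝 x := by
    intro i
    have hsub' : Icc (δ' i) 1 ⊆ Icc (0 : ℝ) 1 := Icc_subset_Icc_left (hδ' i).le
    refine IsClosed.compl_mem_nhds ?_ ?_
    · exact (isCompact_Icc.image_of_continuousOn
        ((h.regular i).continuousOn.mono hsub')).isClosed
    · rintro ⟨t, ht, htx⟩
      have := h.injOn i (hsub' ht) (left_mem_Icc.2 zero_le_one) (htx.trans (h.zero i).symm)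
      linarith [ht.1, hδ' i]
  -- The later part of an arc need not be a polar graph, but it is a closed set missing `x`, so a
  -- small disc avoids it.
  have hnear : U ∩ W ∩ ⋂ i, (β i '' Icc (δ' i) 1)ᶜ ∈ 𝓝 x :=
    Filter.inter_mem (Filter.inter_mem hU hW) (Filter.iInter_mem.2 hfar)
  have hcs : ContinuousAt φ.symm 0 := φ.symm.continuousAt (by simp [htgt'])
  obtain ⟨ρ₀, hρ₀, hball⟩ := Metric.mem_nhds_iff.1 (hcs (by rw [hsymm0]; exact hnear))
  have hρmin : ∃ ρ' > 0, ρ' ≤ ρ₀ ∧ ∀ i, ρ' ≤ ρ i := by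
    have h1 : ∀ᶠ r in 𝓝[>] (0 : ℝ), r ≤ ρ₀ ∧ ∀ i, r ≤ ρ i := by
      refine Filter.Eventually.and ?_ (Filter.eventually_all.2 fun i => ?_)
      · exact mem_nhdsWithin_of_mem_nhds (Iic_mem_nhds hρ₀)
      · exact mem_nhdsWithin_of_mem_nhds (Iic_mem_nhds (hρ i))
    obtain ⟨r, h2, h3⟩ := (h1.and self_mem_nhdsWithin).exists
    exact ⟨r, h3, h2⟩
  obtain ⟨ρ', hρ', hρ'0, hρ'i⟩ := hρmin
  have hIoo : ∀ i, Ioo 0 ρ' ⊆ Ioo 0 (ρ i) := fun i => Ioo_subset_Ioo_right (hρ'i i)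
  have hin : ∀ w : ℂ, ‖w‖ < ρ' → φ.symm w ∈ U ∩ W ∩ ⋂ i, (β i '' Icc (δ' i) 1)ᶜ := by
    intro w hw
    apply hball
    rw [mem_ball_zero_iff]
    linarith
  have hright : ∀ w : ℂ, φ (φ.symm w) = w := fun w => φ.right_inv (by simp [htgt'])
  have hbranch : ∀ i, ∀ r ∈ Ioo 0 ρ', ∃ t ∈ Ioo 0 (min η δ),
      φ.symm (r * Complex.exp (θ i r * Complex.I)) = β i t := by
    intro i r hr
    obtain ⟨t, ht, e⟩ := hθb i r (hIoo i hr)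
    refine ⟨t, ht, ?_⟩
    rw [← e]
    exact φ.left_inv (hsrc i t ⟨ht.1.le, ht.2.le.trans (min_le_right _ _)⟩)
  refine ⟨φ, ρ', θ, hxs, htgt', hφ0, ⟨hρ', fun i => (hθc i).mono (hIoo i),
    fun i r hr => hθm i r (hIoo i hr), ?_, ?_⟩, fun w hw => (hin w hw).1.2, ?_⟩
  · intro i j hij r hr heq
    obtain ⟨t, ht, e⟩ := hbranch i r hr
    obtain ⟨t', ht', e'⟩ := hbranch j r hr
    rw [← heq, e] at e'
    have h01 : ∀ s ∈ Ioo 0 (min η δ), s ∈ Icc (0 : ℝ) 1 :=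
      fun s hs => hsub ⟨hs.1.le, hs.2.le.trans (min_le_right _ _)⟩
    have hmem := h.inter i j hij ⟨⟨t, h01 t ht, rfl⟩, ⟨t', h01 t' ht', e'.symm⟩⟩
    have := h.injOn i (h01 t ht) (left_mem_Icc.2 zero_le_one)
      ((mem_singleton_iff.1 hmem).trans (h.zero i).symm)
    exact ht.1.ne' this
  · intro w hw0 hw
    constructor
    · intro hwN
      have h1 : φ.symm w ∈ (⋃ i, trace (β i)) ∩ U := hNU ▸ ⟨hwN, (hin w hw).1.1⟩
      obtain ⟨i, t, ht, e⟩ := mem_iUnion.1 h1.1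
      have ht0 : t ≠ 0 := by
        rintro rfl
        have := hright w
        rw [← e, h.zero i, hφ0] at this
        simp [← this] at hw0
      have htδ : t < δ' i := by
        by_contra hcon
        exact mem_iInter.1 (hin w hw).2 i ⟨t, ⟨not_lt.1 hcon, ht.2⟩, e⟩
      have e2 : φ (β i t) = w := by rw [e, hright]
      have := hθa i t ⟨lt_of_le_of_ne ht.1 (Ne.symm ht0), htδ.le⟩ (by rw [e2]; exact hw.trans_le (hρ'i i))
      rw [e2] at this
      exact ⟨i, this⟩
    · rintro ⟨i, hi⟩
      obtain ⟨t, ht, e⟩ := hbranch i ‖w‖ ⟨hw0, hw⟩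
      rw [← hi, Complex.norm_mul_exp_arg_mul_I] at e
      have h1 : φ.symm w ∈ (⋃ i, trace (β i)) ∩ U :=
        ⟨mem_iUnion.2 ⟨i, t, hsub ⟨ht.1.le, ht.2.le.trans (min_le_right _ _)⟩, e.symm⟩,
          (hin w hw).1.1⟩
      rw [← hNU] at h1
      exact h1.1
  · intro i r hr
    obtain ⟨t, ht, e⟩ := hbranch i r hr
    exact ⟨t, ⟨ht.1, ht.2.trans_le (min_le_left _ _)⟩, e⟩

/-! ### The points of a regular closed set are stars -/

theorem IsStar.exists_isArcStar {N : Set S2} {x : S2} {n : ℕ} (h : IsStar N x n) :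
    ∃ β : Fin n → ℝ → S2, IsArcStar N x β := by
  obtain ⟨γ, h1, h2, -, h3⟩ := h
  exact ⟨γ, fun i => (h1 i).1, fun i => (h1 i).2.1, fun i => (h1 i).2.2, h2, h3⟩

theorem IsC1Regular.comp_neg {γ : ℝ → S2} (h : IsC1Regular γ (-1) 0) :
    IsC1Regular (fun t => γ (-t)) 0 1 := by
  have hm : MapsTo (fun t : ℝ => -t) (Icc 0 1) (Icc (-1) 0) :=
    fun t ht => ⟨by linarith [ht.2], by linarith [ht.1]⟩
  refine ⟨h.1.comp contDiff_neg.contDiffOn hm, fun t ht => ?_⟩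
  have h1 := (h.1.differentiableOn one_ne_zero (-t) (hm ht)).hasDerivWithinAt
  have h2 := h1.scomp t (hasDerivWithinAt_neg t (Icc 0 1)) hm
  have h3 := h2.derivWithin (uniqueDiffOn_Icc zero_lt_one t ht)
  change derivWithin ((fun t => (γ t : E3)) ∘ Neg.neg) (Icc 0 1) t ≠ 0
  rw [h3]
  simpa using h.2 (-t) (hm ht)

/-- A smooth point is a star with two branches: the two halves of the arc, one of them run
backwards. -/
theorem IsSmoothPoint.exists_isArcStar {N : Set S2} {x : S2} (h : IsSmoothPoint N x) :
    ∃ β : Fin 2 → ℝ → S2, IsArcStar N x β := by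
  obtain ⟨γ, hr, hi, hx, U, hU, hN⟩ := h
  have hsub : Icc (0 : ℝ) 1 ⊆ Icc (-1) 1 := Icc_subset_Icc_left (by norm_num)
  have hsub' : Icc (-1 : ℝ) 0 ⊆ Icc (-1) 1 := Icc_subset_Icc_right (by norm_num)
  have hm : MapsTo (fun t : ℝ => -t) (Icc 0 1) (Icc (-1) 1) :=
    fun t ht => ⟨by linarith [ht.2], by linarith [ht.1]⟩
  have hinter : trace γ ∩ trace (fun t => γ (-t)) ⊆ {x} := by
    rintro y ⟨⟨s, hs, rfl⟩, ⟨t, ht, e⟩⟩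
    have := hi (hm ht) (hsub hs) e
    have h0 : s = 0 := by linarith [hs.1, ht.1]
    rw [h0, hx]
    rfl
  refine ⟨![γ, fun t => γ (-t)], ?_, ?_, ?_, ?_, ?_⟩
  · intro i
    fin_cases i
    · exact hr.mono hsub zero_lt_one
    · exact (hr.mono hsub' (by norm_num)).comp_neg
  · intro i
    fin_cases i
    · exact hi.mono hsub
    · intro s hs t ht e
      exact neg_injective (hi (hm hs) (hm ht) e)
  · intro i
    fin_cases i
    · exact hx
    · simpa using hx
  · intro i j hij
    fin_cases i <;> fin_cases j
    · exact absurd rfl hij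
    · exact hinter
    · intro y hy
      exact hinter ⟨hy.2, hy.1⟩
    · exact absurd rfl hij
  · have hne : ∀ s, s ∈ Icc (-1 : ℝ) 1 → s ≠ 0 → γ s ≠ x := by
      intro s hs h0 e
      exact h0 (hi hs ⟨by norm_num, by norm_num⟩ (e.trans hx.symm))
    -- The smooth arc is taken on an open interval and the branches on closed ones, hence the
    -- removal of the two extreme points.
    refine ⟨U ∩ {γ 1, γ (-1)}ᶜ, Filter.inter_mem hU ?_, ?_⟩
    · refine (Set.toFinite _).isClosed.compl_mem_nhds ?_
      rintro (e | e)
      · exact hne 1 ⟨by norm_num, le_rfl⟩ one_ne_zero e.symm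
      · exact hne (-1) ⟨le_rfl, by norm_num⟩ (by norm_num) e.symm
    · rw [← inter_assoc, hN]
      ext y
      simp only [mem_inter_iff, mem_iUnion, Fin.exists_fin_two, Matrix.cons_val_zero,
        Matrix.cons_val_one]
      constructor
      · rintro ⟨⟨⟨t, ht, rfl⟩, hyU⟩, hy⟩
        refine ⟨?_, hyU, hy⟩
        rcases le_total 0 t with h0 | h0
        · exact Or.inl ⟨t, ⟨h0, ht.2.le⟩, rfl⟩
        · exact Or.inr ⟨-t, ⟨by linarith, by linarith [ht.1]⟩, by simp⟩
      · rintro ⟨hy | hy, hyU, hy'⟩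
        · obtain ⟨t, ht, rfl⟩ := hy
          refine ⟨⟨⟨t, ⟨by linarith [ht.1], lt_of_le_of_ne ht.2 ?_⟩, rfl⟩, hyU⟩, hy'⟩
          rintro rfl
          exact hy' (Or.inl rfl)
        · obtain ⟨t, ht, rfl⟩ := hy
          refine ⟨⟨⟨-t, ⟨lt_of_le_of_ne (by linarith [ht.2]) ?_, by linarith [ht.1]⟩, rfl⟩, hyU⟩, hy'⟩
          intro e
          exact hy' (Or.inr (by simp [← e]))

/-! ### Locally constant functions near a star in the plane -/

/-- The function on the plane, constant off the graphs `arg w = θ i ‖w‖` and the negative half axis,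
which jumps by `z i` across the `i`-th graph. -/
noncomputable def polarStep {n : ℕ} (θ : Fin n → ℝ → ℝ) (z : Fin n → ZMod 2) (w : ℂ) : ZMod 2 :=
  open Classical in ∑ i, if θ i ‖w‖ < w.arg then z i else 0

theorem arg_polar {r t : ℝ} (hr : 0 < r) (ht : t ∈ Ioc (-Real.pi) Real.pi) :
    (r * Complex.exp (t * Complex.I)).arg = t := by
  rw [Complex.exp_mul_I, Complex.arg_mul_cos_add_sin_mul_I hr ht]

theorem norm_polar {r : ℝ} (hr : 0 < r) (t : ℝ) : ‖(r * Complex.exp (t * Complex.I) : ℂ)‖ = r := by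
  rw [norm_mul, Complex.norm_exp_ofReal_mul_I, mul_one, Complex.norm_of_nonneg hr.le]

theorem polar_mem_slitPlane {r t : ℝ} (hr : 0 < r) (ht : t ∈ Ioo (-Real.pi) Real.pi) :
    (r * Complex.exp (t * Complex.I) : ℂ) ∈ Complex.slitPlane := by
  rw [Complex.mem_slitPlane_iff_arg, arg_polar hr ⟨ht.1, ht.2.le⟩]
  exact ⟨ht.2.ne, by rw [← norm_ne_zero_iff, norm_polar hr]; exact hr.ne'⟩

section PolarStar

variable {n : ℕ} {M : Set ℂ} {ρ : ℝ} {θ : Fin n → ℝ → ℝ}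

theorem IsPolarStar.continuousAt (h : IsPolarStar M ρ θ) (i : Fin n) {w : ℂ} (h0 : 0 < ‖w‖)
    (hw : ‖w‖ < ρ) : ContinuousAt (fun w : ℂ => θ i ‖w‖) w :=
  ((h.cont i).continuousAt (Ioo_mem_nhds h0 hw)).comp (f := fun w : ℂ => ‖w‖)
    continuous_norm.continuousAt

/-- Along the circle through `w`, only the `i`-th summand changes when the `i`-th graph is crossed,
so the jump is `z i`. Summands whose graph does not pass through `w` are locally constant, as `arg`
is continuous on the slit plane. -/
theorem IsPolarStar.constNear_polarStep_iff (h : IsPolarStar M ρ θ) (z : Fin n → ZMod 2) {w : ℂ}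
    (h0 : 0 < ‖w‖) (hw : ‖w‖ < ρ) (hs : w ∈ Complex.slitPlane) :
    ConstNear M (polarStep θ z) w ↔ ∀ i, w.arg = θ i ‖w‖ → z i = 0 := by
  classical
  constructor
  · rintro ⟨c, hc⟩ i hi
    set r := ‖w‖ with hr
    set p : ℝ → ℂ := fun s => r * Complex.exp (s * Complex.I) with hp
    have hpc : Continuous p := by fun_prop
    have hpw : p w.arg = w := Complex.norm_mul_exp_arg_mul_I w
    have harg := Complex.mem_slitPlane_iff_arg.1 hs
    have hIoo : w.arg ∈ Ioo (-Real.pi) Real.pi :=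
      ⟨Complex.neg_pi_lt_arg _, lt_of_le_of_ne (Complex.arg_le_pi _) harg.1⟩
    have hc' : ∀ᶠ s in 𝓝 w.arg, p s ∉ M → polarStep θ z (p s) = c :=
      hpc.continuousAt.eventually (by rw [hpw]; exact hc)
    have hne : ∀ j, j ≠ i → θ j r ≠ w.arg := by
      intro j hj
      rw [hi]
      exact h.inj j i hj r ⟨h0, hw⟩
    have hsep : ∀ᶠ s in 𝓝 w.arg, s ∈ Ioo (-Real.pi) Real.pi ∧ ∀ j, j ≠ i →
        (θ j r < s ↔ θ j r < w.arg) ∧ s ≠ θ j r := by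
      refine Filter.Eventually.and (isOpen_Ioo.mem_nhds hIoo) (Filter.eventually_all.2 fun j => ?_)
      by_cases hj : j = i
      · exact Filter.Eventually.of_forall fun s hcon => absurd hj hcon
      · rcases lt_or_gt_of_ne (hne j hj) with hlt | hlt
        · filter_upwards [lt_mem_nhds hlt] with s hs' _
          exact ⟨iff_of_true hs' hlt, hs'.ne'⟩
        · filter_upwards [gt_mem_nhds hlt] with s hs' _
          exact ⟨iff_of_false hs'.le.not_gt hlt.le.not_gt, hs'.ne⟩
    have heval : ∀ s, s ∈ Ioo (-Real.pi) Real.pi → polarStep θ z (p s) =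
        ∑ j, if θ j r < s then z j else 0 := by
      intro s hs'
      simp only [polarStep, hp]
      rw [norm_polar h0, arg_polar h0 ⟨hs'.1, hs'.2.le⟩]
    have hnot : ∀ s, s ∈ Ioo (-Real.pi) Real.pi → (∀ j, s ≠ θ j r) → p s ∉ M := by
      intro s hs' hj hM
      have hn : ‖p s‖ = r := norm_polar h0 s
      rw [h.mem_iff _ (by rw [hn]; exact h0) (by rw [hn]; exact hw)] at hM
      obtain ⟨j, e⟩ := hM
      rw [hn, hp, arg_polar h0 ⟨hs'.1, hs'.2.le⟩] at e
      exact hj j e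
    obtain ⟨s, ⟨hs1, hs2, hs3⟩, hsgt⟩ :=
      (((hc'.and hsep).filter_mono (nhdsWithin_le_nhds (s := Ioi w.arg))).and
        self_mem_nhdsWithin).exists
    obtain ⟨t, ⟨ht1, ht2, ht3⟩, htlt⟩ :=
      (((hc'.and hsep).filter_mono (nhdsWithin_le_nhds (s := Iio w.arg))).and
        self_mem_nhdsWithin).exists
    have hsgt : w.arg < s := hsgt
    have htlt : t < w.arg := htlt
    have e1 := hs1 (hnot s hs2 fun j => by
      by_cases hj : j = i
      · rw [hj, ← hi]; exact hsgt.ne'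
      · exact (hs3 j hj).2)
    have e2 := ht1 (hnot t ht2 fun j => by
      by_cases hj : j = i
      · rw [hj, ← hi]; exact htlt.ne
      · exact (ht3 j hj).2)
    rw [heval s hs2, Fintype.sum_eq_add_sum_compl i] at e1
    rw [heval t ht2, Fintype.sum_eq_add_sum_compl i] at e2
    rw [if_pos (by rw [← hi]; exact hsgt)] at e1
    rw [if_neg (by rw [← hi]; exact htlt.le.not_gt), zero_add] at e2
    have e3 : (∑ j ∈ {i}ᶜ, if θ j r < s then z j else 0) = ∑ j ∈ {i}ᶜ, if θ j r < t then z j else 0 := by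
      refine Finset.sum_congr rfl fun j hj => ?_
      have hj : j ≠ i := by simpa using hj
      simp only [(hs3 j hj).1, (ht3 j hj).1]
    rw [e3, e2] at e1
    simpa using e1
  · intro hz
    refine ⟨polarStep θ z w, ?_⟩
    have hterm : ∀ i, ∀ᶠ w' in 𝓝 w, (if θ i ‖w'‖ < w'.arg then z i else 0) =
        (if θ i ‖w‖ < w.arg then z i else 0) := by
      intro i
      have c1 := h.continuousAt i h0 hw
      have c2 := Complex.continuousAt_arg hs
      by_cases hi : w.arg = θ i ‖w‖
      · simp [hz i hi]
      · rcases lt_or_gt_of_ne hi with hlt | hlt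
        · filter_upwards [c2.eventually_lt c1 hlt] with w' hw'
          rw [if_neg hw'.le.not_gt, if_neg hlt.le.not_gt]
        · filter_upwards [c1.eventually_lt c2 hlt] with w' hw'
          rw [if_pos hw', if_pos hlt]
    filter_upwards [Filter.eventually_all.2 hterm] with w' hw' _
    exact Finset.sum_congr rfl fun i _ => hw' i

/-- On and above the negative half axis `arg` is near `π` and exceeds every `θ i`; just below it is
near `-π` and is less than all of them. The jump across this cut is the sum of the `z i`. -/
theorem IsPolarStar.polarStep_near_slit (h : IsPolarStar M ρ θ) (z : Fin n → ZMod 2) {w : ℂ}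
    (hw : ‖w‖ < ρ) (hre : w.re < 0) (him : w.im = 0) :
    ∀ᶠ w' in 𝓝 w, polarStep θ z w' = if 0 ≤ w'.im then ∑ i, z i else 0 := by
  classical
  have h0 : 0 < ‖w‖ := norm_pos_iff.2 fun e => by simp [e] at hre
  have hm := fun i => h.mem i ‖w‖ ⟨h0, hw⟩
  have hup : ∀ i, ∀ᶠ w' in 𝓝 w, 0 ≤ w'.im → θ i ‖w'‖ < w'.arg := by
    intro i
    have c1 := h.continuousAt i h0 hw
    have c2 := Complex.continuousWithinAt_arg_of_re_neg_of_im_zero hre him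
    refine eventually_nhdsWithin_iff.1 (c1.continuousWithinAt.eventually_lt c2 ?_)
    rw [Complex.arg_eq_pi_iff.2 ⟨hre, him⟩]
    exact (hm i).2
  have hdown : ∀ i, ∀ᶠ w' in 𝓝 w, w'.im < 0 → w'.arg < θ i ‖w'‖ := by
    intro i
    have c1 := (h.continuousAt i h0 hw).tendsto.mono_left
      (nhdsWithin_le_nhds (s := {z : ℂ | z.im < 0}))
    have c2 := Complex.tendsto_arg_nhdsWithin_im_neg_of_re_neg_of_im_zero hre him
    exact eventually_nhdsWithin_iff.1 (c2.eventually_lt c1 (hm i).1)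
  filter_upwards [Filter.eventually_all.2 hup, Filter.eventually_all.2 hdown] with w' h1 h2
  split_ifs with hi
  · exact Finset.sum_congr rfl fun i _ => if_pos (h1 i hi)
  · exact Finset.sum_eq_zero fun i _ => if_neg (h2 i (not_le.1 hi)).le.not_gt

theorem isPreconnected_polar_image {I J : Set ℝ} (hI : IsPreconnected I) (hJ : IsPreconnected J)
    {g : ℝ → ℝ → ℝ} (hg : ContinuousOn (fun p : ℝ × ℝ => g p.1 p.2) (I ×ˢ J)) :
    IsPreconnected ((fun p : ℝ × ℝ => (p.1 * Complex.exp (g p.1 p.2 * Complex.I) : ℂ)) '' I ×ˢ J) := by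
  refine (hI.prod hJ).image _ ?_
  have h1 : ContinuousOn (fun p : ℝ × ℝ => ((g p.1 p.2 : ℝ) : ℂ)) (I ×ˢ J) :=
    Complex.continuous_ofReal.comp_continuousOn hg
  have h2 : ContinuousOn (fun p : ℝ × ℝ => (p.1 : ℂ)) (I ×ˢ J) :=
    (Complex.continuous_ofReal.comp continuous_fst).continuousOn
  exact h2.mul (Complex.continuous_exp.comp_continuousOn (h1.mul continuousOn_const))

theorem isPreconnected_punctured_ball (ρ : ℝ) : IsPreconnected {w : ℂ | 0 < ‖w‖ ∧ ‖w‖ < ρ} := by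
  convert isPreconnected_polar_image (I := Ioo 0 ρ) (J := univ) (g := fun _ t => t)
    isPreconnected_Ioo isPreconnected_univ continuous_snd.continuousOn
  ext w
  constructor
  · rintro ⟨h0, hw⟩
    exact ⟨(‖w‖, w.arg), ⟨⟨h0, hw⟩, mem_univ _⟩, Complex.norm_mul_exp_arg_mul_I w⟩
  · rintro ⟨⟨r, t⟩, ⟨hr, -⟩, rfl⟩
    have : ‖(r * Complex.exp (t * Complex.I) : ℂ)‖ = r := norm_polar hr.1 t
    exact ⟨this.symm ▸ hr.1, this.symm ▸ hr.2⟩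

theorem isPreconnected_slit_ball (ρ : ℝ) :
    IsPreconnected {w : ℂ | ‖w‖ < ρ ∧ w ∈ Complex.slitPlane} := by
  convert isPreconnected_polar_image (I := Ioo 0 ρ) (J := Ioo (-Real.pi) Real.pi)
    (g := fun _ t => t) isPreconnected_Ioo isPreconnected_Ioo continuous_snd.continuousOn
  ext w
  constructor
  · rintro ⟨hw, hs⟩
    have h1 := Complex.mem_slitPlane_iff_arg.1 hs
    exact ⟨(‖w‖, w.arg), ⟨⟨norm_pos_iff.2 h1.2, hw⟩, ⟨Complex.neg_pi_lt_arg _,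
      lt_of_le_of_ne (Complex.arg_le_pi _) h1.1⟩⟩, Complex.norm_mul_exp_arg_mul_I w⟩
  · rintro ⟨⟨r, t⟩, ⟨hr, ht⟩, rfl⟩
    have : ‖(r * Complex.exp (t * Complex.I) : ℂ)‖ = r := norm_polar hr.1 t
    exact ⟨this.symm ▸ hr.2, polar_mem_slitPlane hr.1 ht⟩

/-- The sector between two angles. -/
def sector (ρ : ℝ) (lo hi : ℝ → ℝ) : Set ℂ :=
  (fun p : ℝ × ℝ => (p.1 * Complex.exp (((1 - p.2) * lo p.1 + p.2 * hi p.1 : ℝ) * Complex.I) : ℂ)) ''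
    Ioo 0 ρ ×ˢ Ioo 0 1

theorem isPreconnected_sector {lo hi : ℝ → ℝ} (hlo : ContinuousOn lo (Ioo 0 ρ))
    (hhi : ContinuousOn hi (Ioo 0 ρ)) : IsPreconnected (sector ρ lo hi) := by
  refine isPreconnected_polar_image (g := fun r s => (1 - s) * lo r + s * hi r)
    isPreconnected_Ioo isPreconnected_Ioo ?_
  have h1 : ContinuousOn (fun p : ℝ × ℝ => lo p.1) (Ioo 0 ρ ×ˢ Ioo 0 1) :=
    hlo.comp continuousOn_fst fun p hp => hp.1
  have h2 : ContinuousOn (fun p : ℝ × ℝ => hi p.1) (Ioo 0 ρ ×ˢ Ioo 0 1) :=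
    hhi.comp continuousOn_fst fun p hp => hp.1
  exact ((continuousOn_const.sub continuousOn_snd).mul h1).add (continuousOn_snd.mul h2)

theorem mem_sector {lo hi : ℝ → ℝ} {r t : ℝ} (hr : r ∈ Ioo 0 ρ) (ht : t ∈ Ioo (lo r) (hi r)) :
    (r * Complex.exp (t * Complex.I) : ℂ) ∈ sector ρ lo hi := by
  have h0 : 0 < hi r - lo r := by linarith [ht.1, ht.2]
  refine ⟨(r, (t - lo r) / (hi r - lo r)), ⟨hr, div_pos (by linarith [ht.1]) h0,
    (div_lt_one h0).2 (by linarith [ht.2])⟩, ?_⟩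
  simp only
  congr 4
  field_simp
  ring

theorem exists_of_mem_sector {lo hi : ℝ → ℝ} (hlt : ∀ r ∈ Ioo 0 ρ, lo r < hi r) {w : ℂ}
    (hw : w ∈ sector ρ lo hi) : ∃ r ∈ Ioo 0 ρ, ∃ t ∈ Ioo (lo r) (hi r),
      w = r * Complex.exp (t * Complex.I) := by
  obtain ⟨⟨r, s⟩, ⟨hr, hs⟩, rfl⟩ := hw
  have := hlt r hr
  exact ⟨r, hr, (1 - s) * lo r + s * hi r, ⟨by nlinarith [hs.1], by nlinarith [hs.2]⟩, rfl⟩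

theorem mem_closure_sector {lo hi : ℝ → ℝ} {r : ℝ} (hr : r ∈ Ioo 0 ρ) :
    (r * Complex.exp (lo r * Complex.I) : ℂ) ∈ closure (sector ρ lo hi) ∧
      (r * Complex.exp (hi r * Complex.I) : ℂ) ∈ closure (sector ρ lo hi) := by
  let g : ℝ → ℂ := fun s => r * Complex.exp (((1 - s) * lo r + s * hi r : ℝ) * Complex.I)
  have hg : Continuous g := by fun_prop
  have hsub : g '' Ioo 0 1 ⊆ sector ρ lo hi := by
    rintro _ ⟨s, hs, rfl⟩
    exact ⟨(r, s), ⟨hr, hs⟩, rfl⟩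
  have hcl : ∀ s ∈ Icc (0 : ℝ) 1, g s ∈ closure (sector ρ lo hi) := by
    intro s hs
    refine closure_mono hsub (image_closure_subset_closure_image hg ⟨s, ?_, rfl⟩)
    rwa [closure_Ioo zero_ne_one]
  refine ⟨?_, ?_⟩
  · have := hcl 0 (by simp)
    simpa [g] using this
  · have := hcl 1 (by simp)
    simpa [g] using this

theorem zero_mem_closure_sector {lo hi : ℝ → ℝ} (hρ : 0 < ρ) : 0 ∈ closure (sector ρ lo hi) := by
  rw [Metric.mem_closure_iff]
  intro ε hε
  have hr : 0 < min (ε / 2) (ρ / 2) := by positivity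
  refine ⟨_, ⟨(min (ε / 2) (ρ / 2), 1 / 2), ⟨⟨hr, ?_⟩, by norm_num, by norm_num⟩, rfl⟩, ?_⟩
  · linarith [min_le_right (ε / 2) (ρ / 2)]
  · rw [dist_zero_left, norm_polar hr]
    linarith [min_le_left (ε / 2) (ρ / 2)]

/-- The sides are the sector from the lower graph to the upper one and the complementary sector,
which crosses the negative half axis and so uses angles up to `lo + 2π`. -/
theorem IsPolarStar.exists_sides {θ : Fin 2 → ℝ → ℝ} (h : IsPolarStar M ρ θ) :
    ∃ S T : Set ℂ, IsPreconnected S ∧ IsPreconnected T ∧ S ⊆ Metric.ball 0 ρ \ M ∧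
      T ⊆ Metric.ball 0 ρ \ M ∧ (∀ w, 0 < ‖w‖ → ‖w‖ < ρ → w ∈ S ∪ T ∪ M) ∧
      (∀ w, ‖w‖ < ρ → w = 0 ∨ w ∈ M → w ∈ closure S ∧ w ∈ closure T) := by
  set lo : ℝ → ℝ := fun r => min (θ 0 r) (θ 1 r) with hlo
  set hi : ℝ → ℝ := fun r => max (θ 0 r) (θ 1 r) with hhi
  have clo : ContinuousOn lo (Ioo 0 ρ) := ContinuousOn.inf (h.cont 0) (h.cont 1)
  have chi : ContinuousOn hi (Ioo 0 ρ) := ContinuousOn.sup (h.cont 0) (h.cont 1)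
  have hlt : ∀ r ∈ Ioo 0 ρ, lo r < hi r := fun r hr => min_lt_max.2 (h.inj 0 1 (by simp) r hr)
  have hlom : ∀ r ∈ Ioo 0 ρ, -Real.pi < lo r := fun r hr => lt_min (h.mem 0 r hr).1 (h.mem 1 r hr).1
  have hhim : ∀ r ∈ Ioo 0 ρ, hi r < Real.pi := fun r hr => max_lt (h.mem 0 r hr).2 (h.mem 1 r hr).2
  have hlt' : ∀ r ∈ Ioo 0 ρ, hi r < lo r + 2 * Real.pi := fun r hr => by
    linarith [hlom r hr, hhim r hr]
  have hθ : ∀ r ∈ Ioo 0 ρ, ∀ j, θ j r = lo r ∨ θ j r = hi r := by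
    intro r _ j
    simp only [hlo, hhi]
    rcases le_total (θ 0 r) (θ 1 r) with h1 | h1 <;> fin_cases j <;> simp [h1]
  have hM : ∀ w : ℂ, 0 < ‖w‖ → ‖w‖ < ρ → (w ∈ M ↔ w.arg = lo ‖w‖ ∨ w.arg = hi ‖w‖) := by
    intro w h0 hw
    rw [h.mem_iff w h0 hw, Fin.exists_fin_two]
    simp only [hlo, hhi]
    rcases le_total (θ 0 ‖w‖) (θ 1 ‖w‖) with h1 | h1
    · simp [h1]
    · simp [h1, or_comm]
  have hnot : ∀ r ∈ Ioo 0 ρ, ∀ t, lo r < t → t < lo r + 2 * Real.pi → t ≠ hi r →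
      (r * Complex.exp (t * Complex.I) : ℂ) ∉ M := by
    intro r hr t h1 h2 h3 hmem
    set w : ℂ := r * Complex.exp (t * Complex.I) with hw
    have hn : ‖w‖ = r := norm_polar hr.1 t
    rw [hM w (hn.symm ▸ hr.1) (hn.symm ▸ hr.2), hn] at hmem
    -- The principal argument differs from `t` by `k` turns. The bounds on `t` leave no integer `k`
    -- when it equals `lo r`, and only `k = 0` when it equals `hi r`.
    have e1 : Complex.exp (w.arg * Complex.I) = Complex.exp (t * Complex.I) := by
      have := Complex.norm_mul_exp_arg_mul_I w
      rw [hn] at this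
      exact mul_left_cancel₀ (Complex.ofReal_ne_zero.2 hr.1.ne') this
    obtain ⟨k, hk⟩ := Complex.exp_eq_exp_iff_exists_int.1 e1
    have hk' : w.arg = t + k * (2 * Real.pi) := by
      have := congrArg Complex.im hk
      simpa using this
    have hpi := Real.pi_pos
    have hb := hlt r hr
    have hb' := hlt' r hr
    rcases hmem with e | e
    · have k1 : (k : ℝ) < 0 := by
        by_contra hcon
        nlinarith [not_lt.1 hcon]
      have k2 : (-1 : ℝ) < k := by nlinarith
      have : k < 0 := by exact_mod_cast k1
      have : -1 < k := by exact_mod_cast k2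
      omega
    · have k1 : (k : ℝ) < 1 := by nlinarith
      have k2 : (-1 : ℝ) < k := by nlinarith
      have : k < 1 := by exact_mod_cast k1
      have : -1 < k := by exact_mod_cast k2
      have : k = 0 := by omega
      rw [this] at hk'
      apply h3
      rw [← e, hk']
      simp
  refine ⟨sector ρ lo hi, sector ρ hi (fun r => lo r + 2 * Real.pi), isPreconnected_sector clo chi,
    isPreconnected_sector chi (clo.add continuousOn_const), ?_, ?_, ?_, ?_⟩
  · intro w hw
    obtain ⟨r, hr, t, ht, rfl⟩ := exists_of_mem_sector hlt hw
    refine ⟨?_, hnot r hr t ht.1 (ht.2.trans (hlt' r hr)) ht.2.ne⟩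
    rw [mem_ball_zero_iff, norm_polar hr.1]
    exact hr.2
  · intro w hw
    obtain ⟨r, hr, t, ht, rfl⟩ := exists_of_mem_sector hlt' hw
    refine ⟨?_, hnot r hr t ((hlt r hr).trans ht.1) ht.2 ht.1.ne'⟩
    rw [mem_ball_zero_iff, norm_polar hr.1]
    exact hr.2
  · intro w h0 hw
    have hr : ‖w‖ ∈ Ioo 0 ρ := ⟨h0, hw⟩
    have e := Complex.norm_mul_exp_arg_mul_I w
    have a1 := Complex.neg_pi_lt_arg w
    have a2 := Complex.arg_le_pi w
    rcases lt_trichotomy w.arg (lo ‖w‖) with h1 | h1 | h1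
    · refine Or.inl (Or.inr ?_)
      have e2 : (‖w‖ * Complex.exp ((w.arg + 2 * Real.pi : ℝ) * Complex.I) : ℂ) = w := by
        rw [Complex.ofReal_add, add_mul, Complex.exp_add]
        push_cast
        rw [Complex.exp_two_pi_mul_I, mul_one, e]
      have := mem_sector (lo := hi) (hi := fun r => lo r + 2 * Real.pi) (t := w.arg + 2 * Real.pi) hr
        ⟨by linarith [hhim _ hr], by linarith⟩
      rwa [e2] at this
    · exact Or.inr ((hM w h0 hw).2 (Or.inl h1))
    · rcases lt_trichotomy w.arg (hi ‖w‖) with h2 | h2 | h2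
      · refine Or.inl (Or.inl ?_)
        have := mem_sector (t := w.arg) hr ⟨h1, h2⟩
        rwa [e] at this
      · exact Or.inr ((hM w h0 hw).2 (Or.inr h2))
      · refine Or.inl (Or.inr ?_)
        have := mem_sector (lo := hi) (hi := fun r => lo r + 2 * Real.pi) (t := w.arg) hr
          ⟨h2, by linarith [hlom _ hr]⟩
        rwa [e] at this
  · intro w hw hwM
    rcases eq_or_ne w 0 with rfl | hne
    · exact ⟨zero_mem_closure_sector h.pos, zero_mem_closure_sector h.pos⟩
    · have h0 : 0 < ‖w‖ := norm_pos_iff.2 hne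
      have hr : ‖w‖ ∈ Ioo 0 ρ := ⟨h0, hw⟩
      have e := Complex.norm_mul_exp_arg_mul_I w
      have c1 := mem_closure_sector (lo := lo) (hi := hi) hr
      have c2 := mem_closure_sector (lo := hi) (hi := fun r => lo r + 2 * Real.pi) hr
      have e2 : (‖w‖ * Complex.exp ((lo ‖w‖ + 2 * Real.pi : ℝ) * Complex.I) : ℂ) =
          ‖w‖ * Complex.exp (lo ‖w‖ * Complex.I) := by
        rw [Complex.ofReal_add, add_mul, Complex.exp_add]
        push_cast
        rw [Complex.exp_two_pi_mul_I, mul_one]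
      rw [e2] at c2
      rcases (hM w h0 hw).1 (hwM.resolve_left hne) with h1 | h1
      · rw [← h1, e] at c1 c2
        exact ⟨c1.1, c2.2⟩
      · rw [← h1, e] at c1 c2
        exact ⟨c1.2, c2.1⟩

end PolarStar
/-! ### Locally constant functions near a star on the sphere -/

section Local

variable {N : Set S2} {x : S2}

theorem constNear_symm_iff {β : Type*} {φ : OpenPartialHomeomorph S2 ℂ} (ht : φ.target = univ)
    (f : S2 → β) (w : ℂ) :
    ConstNear N f (φ.symm w) ↔ ConstNear (φ.symm ⁻¹' N) (f ∘ φ.symm) w := by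
  unfold ConstNear
  rw [← φ.symm.map_nhds_eq (by simp [ht])]
  rfl

theorem eventually_eq_symm {φ : OpenPartialHomeomorph S2 ℂ} (hx : x ∈ φ.source) (h0 : φ x = 0)
    {ρ : ℝ} (hρ : 0 < ρ) : ∀ᶠ y in 𝓝 x, ∃ w, ‖w‖ < ρ ∧ y = φ.symm w ∧ φ y = w := by
  have h1 : ∀ᶠ y in 𝓝 x, ‖φ y‖ < ρ :=
    (φ.continuousAt hx).norm.eventually_lt continuousAt_const (by simpa [h0] using hρ)
  filter_upwards [h1, φ.open_source.mem_nhds hx] with y hy hys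
  exact ⟨φ y, hy, (φ.left_inv hys).symm, rfl⟩

theorem IsArcStar.mem {n : ℕ} {β : Fin n → ℝ → S2} (h : IsArcStar N x β) (i : Fin n) : x ∈ N := by
  obtain ⟨U, hU, e⟩ := h.nhds
  have : x ∈ (⋃ i, trace (β i)) ∩ U :=
    ⟨mem_iUnion.2 ⟨i, 0, left_mem_Icc.2 zero_le_one, h.zero i⟩, mem_of_mem_nhds hU⟩
  rw [← e] at this
  exact this.1

/-- Near a smooth point, the complement of `N` has two sides. -/
theorem IsArcStar.exists_sides {β : Fin 2 → ℝ → S2} (h : IsArcStar N x β) {W : Set S2}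
    (hW : W ∈ 𝓝 x) : ∃ S T : Set S2, IsPreconnected S ∧ IsPreconnected T ∧ S ⊆ W \ N ∧ T ⊆ W \ N ∧
      S ∪ T ∪ N ∈ 𝓝 x ∧ x ∈ closure S ∧ x ∈ closure T ∧
      ∀ᶠ y in 𝓝 x, y ∈ N → y ∈ closure S ∧ y ∈ closure T := by
  obtain ⟨φ, ρ, θ, hxs, ht, h0, hp, hWρ, -⟩ := h.exists_polarStar one_pos hW
  obtain ⟨S, T, hS, hT, hSM, hTM, hST, hcl⟩ := hp.exists_sides
  have hc : Continuous φ.symm := by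
    have := φ.symm.continuousOn
    rwa [φ.symm_source, ht, continuousOn_univ] at this
  have hsymm0 : φ.symm 0 = x := by rw [← h0]; exact φ.left_inv hxs
  have hev := eventually_eq_symm hxs h0 hp.pos
  have hcl' : ∀ w, ‖w‖ < ρ → w = 0 ∨ φ.symm w ∈ N →
      φ.symm w ∈ closure (φ.symm '' S) ∧ φ.symm w ∈ closure (φ.symm '' T) := by
    intro w hw hwN
    obtain ⟨h1, h2⟩ := hcl w hw hwN
    exact ⟨image_closure_subset_closure_image hc ⟨w, h1, rfl⟩,
      image_closure_subset_closure_image hc ⟨w, h2, rfl⟩⟩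
  have hx0 := hcl' 0 (by simpa using hp.pos) (Or.inl rfl)
  rw [hsymm0] at hx0
  refine ⟨φ.symm '' S, φ.symm '' T, hS.image _ hc.continuousOn, hT.image _ hc.continuousOn, ?_, ?_,
    ?_, hx0.1, hx0.2, ?_⟩
  · rintro _ ⟨w, hw, rfl⟩
    exact ⟨hWρ w (mem_ball_zero_iff.1 (hSM hw).1), (hSM hw).2⟩
  · rintro _ ⟨w, hw, rfl⟩
    exact ⟨hWρ w (mem_ball_zero_iff.1 (hTM hw).1), (hTM hw).2⟩
  · filter_upwards [hev] with y hy
    obtain ⟨w, hw, e, -⟩ := hy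
    rcases eq_or_ne w 0 with rfl | hne
    · right
      rw [e, hsymm0]
      exact h.mem 0
    · rw [e]
      rcases hST w (norm_pos_iff.2 hne) hw with (h1 | h1) | h1
      · exact Or.inl (Or.inl ⟨w, h1, rfl⟩)
      · exact Or.inl (Or.inr ⟨w, h1, rfl⟩)
      · exact Or.inr h1
  · filter_upwards [hev] with y hy hyN
    obtain ⟨w, hw, e, -⟩ := hy
    rw [e] at hyN ⊢
    exact hcl' w hw (Or.inr hyN)

theorem constNear_iff_of_sides {β : Type*} {f : S2 → β} {S T : Set S2} {a b : β} (hSN : S ⊆ Nᶜ)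
    (hTN : T ⊆ Nᶜ) (hST : S ∪ T ∪ N ∈ 𝓝 x) (hxS : x ∈ closure S) (hxT : x ∈ closure T)
    (hS : ∀ y ∈ S, f y = a) (hT : ∀ y ∈ T, f y = b) : ConstNear N f x ↔ a = b := by
  constructor
  · rintro ⟨c, hc⟩
    obtain ⟨y, hy, hyS⟩ := mem_closure_iff_nhds.1 hxS _ hc
    obtain ⟨y', hy', hyT⟩ := mem_closure_iff_nhds.1 hxT _ hc
    rw [← hS y hyS, ← hT y' hyT]
    exact (hy (hSN hyS)).trans (hy' (hTN hyT)).symm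
  · rintro rfl
    refine ⟨a, ?_⟩
    filter_upwards [hST] with y hy hyN
    rcases hy with (h1 | h1) | h1
    · exact hS y h1
    · exact hT y h1
    · exact absurd h1 hyN

theorem exists_value_of_side {f : S2 → ZMod 2} (hN : Dense Nᶜ) {S : Set S2} (hS : IsPreconnected S)
    (hSN : S ⊆ Nᶜ) (hf : ∀ y ∈ S, ConstNear N f y) : ∃ a, ∀ y ∈ S, f y = a := by
  obtain ⟨c, hc⟩ := exists_const_of_isPreconnected hN hS hf
  exact ⟨c, fun y hy => (hc y hy).self_of_nhds (hSN hy)⟩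

/-- Near a smooth point, jumps are additive. -/
theorem IsArcStar.constNear_add_iff {β : Fin 2 → ℝ → S2} (h : IsArcStar N x β) (hN : Dense Nᶜ)
    {f g : S2 → ZMod 2} (hf : ∀ᶠ y in 𝓝 x, y ∉ N → ConstNear N f y)
    (hg : ∀ᶠ y in 𝓝 x, y ∉ N → ConstNear N g y) :
    ConstNear N (fun y => f y + g y) x ↔ (ConstNear N f x ↔ ConstNear N g x) := by
  obtain ⟨S, T, hS, hT, hSW, hTW, hST, hxS, hxT, -⟩ := h.exists_sides (hf.and hg)
  have hSN : S ⊆ Nᶜ := fun y hy => (hSW hy).2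
  have hTN : T ⊆ Nᶜ := fun y hy => (hTW hy).2
  obtain ⟨a, ha⟩ := exists_value_of_side hN hS hSN fun y hy => (hSW hy).1.1 (hSN hy)
  obtain ⟨b, hb⟩ := exists_value_of_side hN hT hTN fun y hy => (hTW hy).1.1 (hTN hy)
  obtain ⟨a', ha'⟩ := exists_value_of_side hN hS hSN fun y hy => (hSW hy).1.2 (hSN hy)
  obtain ⟨b', hb'⟩ := exists_value_of_side hN hT hTN fun y hy => (hTW hy).1.2 (hTN hy)
  rw [constNear_iff_of_sides hSN hTN hST hxS hxT ha hb,
    constNear_iff_of_sides hSN hTN hST hxS hxT ha' hb',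
    constNear_iff_of_sides (f := fun y => f y + g y) (a := a + a') (b := b + b') hSN hTN hST hxS hxT
      (fun y hy => by rw [ha y hy, ha' y hy]) (fun y hy => by rw [hb y hy, hb' y hy])]
  -- What remains is a finite check; it holds because `ZMod 2` has a single nonzero value for a
  -- jump.
  clear ha hb ha' hb'
  revert a b a' b'
  decide

/-- Jumps are locally constant along smooth arcs. -/
theorem IsArcStar.eventually_constNear_iff {β : Fin 2 → ℝ → S2} (h : IsArcStar N x β)
    (hN : Dense Nᶜ) {f : S2 → ZMod 2} (hf : ∀ᶠ y in 𝓝 x, y ∉ N → ConstNear N f y) :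
    ∀ᶠ y in 𝓝 x, y ∈ N → (ConstNear N f y ↔ ConstNear N f x) := by
  obtain ⟨S, T, hS, hT, hSW, hTW, hST, hxS, hxT, hcl⟩ := h.exists_sides hf
  have hSN : S ⊆ Nᶜ := fun y hy => (hSW hy).2
  have hTN : T ⊆ Nᶜ := fun y hy => (hTW hy).2
  obtain ⟨a, ha⟩ := exists_value_of_side hN hS hSN fun y hy => (hSW hy).1 (hSN hy)
  obtain ⟨b, hb⟩ := exists_value_of_side hN hT hTN fun y hy => (hTW hy).1 (hTN hy)
  filter_upwards [hcl, eventually_mem_nhds_iff.2 hST] with y hy hyST hyN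
  rw [constNear_iff_of_sides hSN hTN hST hxS hxT ha hb,
    constNear_iff_of_sides hSN hTN hyST (hy hyN).1 (hy hyN).2 ha hb]

/-- A punctured disc is connected, so a single point is removable; as it lies in `N`, the value at
it is irrelevant. -/
theorem constNear_of_punctured (hN : Dense Nᶜ) (hxN : x ∈ N) {f : S2 → ZMod 2}
    (h : ∀ᶠ y in 𝓝[≠] x, ConstNear N f y) : ConstNear N f x := by
  obtain ⟨φ, hxs, ht, h0, -⟩ := exists_plane_chart x
  have hsymm0 : φ.symm 0 = x := by rw [← h0]; exact φ.left_inv hxs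
  have hc : Continuous φ.symm := by
    have := φ.symm.continuousOn
    rwa [φ.symm_source, ht, continuousOn_univ] at this
  have hcx : ∀ᶠ w in 𝓝 (0 : ℂ), φ.symm w ≠ x → ConstNear N f (φ.symm w) :=
    hc.continuousAt.eventually (by rw [hsymm0]; exact eventually_nhdsWithin_iff.1 h)
  obtain ⟨ρ, hρ, hball⟩ := Metric.mem_nhds_iff.1 hcx
  have hpre := (isPreconnected_punctured_ball ρ).image _ hc.continuousOn
  have hinj : ∀ w, φ (φ.symm w) = w := fun w => φ.right_inv (by simp [ht])
  obtain ⟨c, hcc⟩ := exists_const_of_isPreconnected hN (f := f) hpre (by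
    rintro _ ⟨w, ⟨hw0, hw⟩, rfl⟩
    refine hball (mem_ball_zero_iff.2 hw) fun e => ?_
    have := hinj w
    rw [e, h0] at this
    simp [← this] at hw0)
  have hmemc : ∀ᶠ y in 𝓝 x, y ≠ x → y ∉ N → f y = c := by
    filter_upwards [eventually_eq_symm hxs h0 hρ] with y hy hyx hyN
    obtain ⟨w, hw, e, e'⟩ := hy
    refine (hcc y ⟨w, ⟨norm_pos_iff.2 ?_, hw⟩, e.symm⟩).self_of_nhds hyN
    rintro rfl
    exact hyx (e.trans hsymm0)
  refine ⟨c, ?_⟩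
  filter_upwards [hmemc] with y hy hyN
  exact hy (fun e => hyN (e ▸ hxN)) hyN

theorem exists_common_radius {n : ℕ} {p : Fin n → ℝ → Prop}
    (h : ∀ i, ∀ᶠ t in 𝓝[>] (0 : ℝ), p i t) : ∃ η > 0, ∀ i, ∀ t ∈ Ioo 0 η, p i t := by
  obtain ⟨η, hη, hsub⟩ := mem_nhdsGT_iff_exists_Ioo_subset.1 (Filter.eventually_all.2 h)
  exact ⟨η, hη, fun i t ht => hsub ht i⟩

/-- Near a star, there is a function with prescribed jumps, provided their sum vanishes. -/
theorem IsArcStar.exists_jumps {n : ℕ} {β : Fin n → ℝ → S2} (h : IsArcStar N x β)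
    {z : S2 → ZMod 2} (hz : ∀ y, y ∉ N → z y = 0) (ζ : Fin n → ZMod 2)
    (hζ : ∀ i, ∀ᶠ t in 𝓝[>] (0 : ℝ), z (β i t) = ζ i) (hsum : ∑ i, ζ i = 0) :
    ∃ f : S2 → ZMod 2, ∀ᶠ y in 𝓝[≠] x, (ConstNear N f y ↔ z y = 0) := by
  obtain ⟨η, hη, hζη⟩ := exists_common_radius hζ
  obtain ⟨φ, ρ, θ, hxs, ht, h0, hp, -, hbr⟩ := h.exists_polarStar hη Filter.univ_mem
  have hsymm0 : φ.symm 0 = x := by rw [← h0]; exact φ.left_inv hxs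
  have hinj : ∀ w, φ (φ.symm w) = w := fun w => φ.right_inv (by simp [ht])
  refine ⟨polarStep θ ζ ∘ φ, ?_⟩
  rw [eventually_nhdsWithin_iff]
  filter_upwards [eventually_eq_symm hxs h0 hp.pos] with y hy hyx
  obtain ⟨w, hw, e, e'⟩ := hy
  have hw0 : 0 < ‖w‖ := by
    rw [norm_pos_iff]
    rintro rfl
    exact hyx (e.trans hsymm0)
  have hcomp : (polarStep θ ζ ∘ φ) ∘ φ.symm = polarStep θ ζ := by
    ext w
    simp [hinj]
  rw [e, constNear_symm_iff ht, hcomp]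
  by_cases hs : w ∈ Complex.slitPlane
  · rw [hp.constNear_polarStep_iff ζ hw0 hw hs]
    by_cases hyN : φ.symm w ∈ N
    · obtain ⟨i, hi⟩ := (hp.mem_iff w hw0 hw).1 hyN
      obtain ⟨t, ht', e2⟩ := hbr i ‖w‖ ⟨hw0, hw⟩
      rw [← hi, Complex.norm_mul_exp_arg_mul_I] at e2
      rw [e2, hζη i t ht']
      refine ⟨fun h1 => h1 i hi, fun h1 j hj => ?_⟩
      by_cases hij : i = j
      · rw [← hij, h1]
      · exact absurd (hi.symm.trans hj) (hp.inj i j hij _ ⟨hw0, hw⟩)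
    · refine iff_of_true (fun i hi => ?_) (hz _ hyN)
      exact absurd ((hp.mem_iff w hw0 hw).2 ⟨i, hi⟩) hyN
  · have hpi : w.arg = Real.pi := by
      by_contra hcon
      exact hs (Complex.mem_slitPlane_iff_arg.2 ⟨hcon, norm_pos_iff.1 hw0⟩)
    have hyN : φ.symm w ∉ N := by
      intro hN
      obtain ⟨i, hi⟩ := (hp.mem_iff w hw0 hw).1 hN
      exact (hp.mem i _ ⟨hw0, hw⟩).2.ne (hi.symm.trans hpi)
    obtain ⟨hre, him⟩ := Complex.arg_eq_pi_iff.1 hpi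
    -- The cut of `arg` creates no jump because the `ζ i` add up to zero.
    refine iff_of_true ⟨0, ?_⟩ (hz _ hyN)
    filter_upwards [hp.polarStep_near_slit ζ hw hre him] with w' hw' _
    rw [hw', hsum]
    simp

/-- The jumps of a function at a vertex add up to zero. -/
theorem IsArcStar.sum_jumps_eq_zero {n : ℕ} {β : Fin n → ℝ → S2} (h : IsArcStar N x β)
    (hN : Dense Nᶜ) (hsm : ∀ᶠ y in 𝓝[≠] x, y ∈ N → ∃ β' : Fin 2 → ℝ → S2, IsArcStar N y β')
    {f : S2 → ZMod 2} (hf : ∀ y, y ∉ N → ConstNear N f y) (ζ : Fin n → ZMod 2)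
    (hζ : ∀ i, ∀ᶠ t in 𝓝[>] (0 : ℝ), (ConstNear N f (β i t) ↔ ζ i = 0)) : ∑ i, ζ i = 0 := by
  obtain ⟨η, hη, hζη⟩ := exists_common_radius hζ
  obtain ⟨φ, ρ, θ, hxs, ht, h0, hp, hW, hbr⟩ :=
    h.exists_polarStar hη (eventually_nhdsWithin_iff.1 hsm)
  have hsymm0 : φ.symm 0 = x := by rw [← h0]; exact φ.left_inv hxs
  have hinj : ∀ w, φ (φ.symm w) = w := fun w => φ.right_inv (by simp [ht])
  have hc : Continuous φ.symm := by
    have := φ.symm.continuousOn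
    rwa [φ.symm_source, ht, continuousOn_univ] at this
  -- The model `F` has the same jumps as `f`, so `F + f` is constant off `N` on the slit disc.
  -- Across the slit `f` has no jump while `F` jumps by the sum of the `ζ i`, which must therefore
  -- vanish.
  set F : S2 → ZMod 2 := polarStep θ ζ ∘ φ with hF
  have hcomp : F ∘ φ.symm = polarStep θ ζ := by
    ext w
    simp [hF, hinj]
  have hopen : IsOpen {w : ℂ | ‖w‖ < ρ ∧ w ∈ Complex.slitPlane} :=
    (isOpen_lt continuous_norm continuous_const).inter Complex.isOpen_slitPlane
  -- the sum has no jump in the slit disc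
  have hFoff : ∀ w, ‖w‖ < ρ → w ∈ Complex.slitPlane → φ.symm w ∉ N → ConstNear N F (φ.symm w) := by
    intro w hw hs hwN
    have hw0 : 0 < ‖w‖ := norm_pos_iff.2 (Complex.slitPlane_ne_zero hs)
    rw [constNear_symm_iff ht, hcomp, hp.constNear_polarStep_iff ζ hw0 hw hs]
    exact fun i hi => absurd ((hp.mem_iff w hw0 hw).2 ⟨i, hi⟩) hwN
  have hslit : ∀ y ∈ φ.symm '' {w : ℂ | ‖w‖ < ρ ∧ w ∈ Complex.slitPlane},
      ConstNear N (fun y => F y + f y) y := by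
    rintro _ ⟨w, ⟨hw, hs⟩, rfl⟩
    have hw0 : 0 < ‖w‖ := norm_pos_iff.2 (Complex.slitPlane_ne_zero hs)
    by_cases hwN : φ.symm w ∈ N
    · obtain ⟨i, hi⟩ := (hp.mem_iff w hw0 hw).1 hwN
      obtain ⟨t, ht', e2⟩ := hbr i ‖w‖ ⟨hw0, hw⟩
      rw [← hi, Complex.norm_mul_exp_arg_mul_I] at e2
      have hne : φ.symm w ≠ x := by
        intro e
        have := hinj w
        rw [e, h0] at this
        simp [← this] at hw0
      obtain ⟨β', hβ'⟩ := hW w hw hne hwN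
      rw [hβ'.constNear_add_iff hN ?_ (Filter.Eventually.of_forall hf), constNear_symm_iff ht F,
        hcomp, hp.constNear_polarStep_iff ζ hw0 hw hs, e2, hζη i t ht']
      · refine ⟨fun h1 => h1 i hi, fun h1 j hj => ?_⟩
        by_cases hij : i = j
        · rw [← hij, h1]
        · exact absurd (hi.symm.trans hj) (hp.inj i j hij _ ⟨hw0, hw⟩)
      · rw [← φ.symm.map_nhds_eq (by simp [ht]), Filter.eventually_map]
        filter_upwards [hopen.mem_nhds ⟨hw, hs⟩] with w' hw' hN'
        exact hFoff w' hw'.1 hw'.2 hN'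
    · obtain ⟨c, hc⟩ := hFoff w hw hs hwN
      obtain ⟨d, hd⟩ := hf _ hwN
      refine ⟨c + d, ?_⟩
      filter_upwards [hc, hd] with y h1 h2 hyN
      rw [h1 hyN, h2 hyN]
  obtain ⟨c, hcc⟩ := exists_const_of_isPreconnected hN
    ((isPreconnected_slit_ball ρ).image _ hc.continuousOn) hslit
  -- compare the two sides of the slit
  have hρ := hp.pos
  set w₀ : ℂ := ((-(ρ / 2) : ℝ) : ℂ) with hw₀
  have hre : w₀.re < 0 := by simp [hw₀, hρ]
  have him : w₀.im = 0 := by simp [hw₀]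
  have hnw : ‖w₀‖ < ρ := by
    rw [hw₀, Complex.norm_real, Real.norm_eq_abs, abs_neg, abs_of_pos (by positivity)]
    linarith
  have hw₀N : φ.symm w₀ ∉ N := by
    intro hN
    have hw0 : 0 < ‖w₀‖ := norm_pos_iff.2 fun e => by simp [e] at hre
    obtain ⟨i, hi⟩ := (hp.mem_iff w₀ hw0 hnw).1 hN
    exact (hp.mem i _ ⟨hw0, hnw⟩).2.ne (hi.symm.trans (Complex.arg_eq_pi_iff.2 ⟨hre, him⟩))
  obtain ⟨d, hd⟩ := hf _ hw₀N
  have key : ∀ᶠ w in 𝓝 w₀, w.im ≠ 0 → φ.symm w ∉ N →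
      (if 0 ≤ w.im then ∑ i, ζ i else 0) + d = c := by
    have h1 : ∀ᶠ w in 𝓝 w₀, ‖w‖ < ρ := continuous_norm.continuousAt.eventually_lt
      continuousAt_const hnw
    have h2 : ∀ᶠ w in 𝓝 w₀, φ.symm w ∉ N → f (φ.symm w) = d := hc.continuousAt.eventually hd
    filter_upwards [hp.polarStep_near_slit ζ hnw hre him, h1, h2] with w h3 h4 h5 h6 h7
    have h8 := (hcc (φ.symm w) ⟨w, ⟨h4, Complex.mem_slitPlane_iff.2 (Or.inr h6)⟩, rfl⟩).self_of_nhds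
      h7
    rw [← h8, ← h5 h7, ← h3, ← hcomp]
    rfl
  -- Density of the complement provides points off `N` close to `w₀` on either side of the slit.
  have hline : ∀ s : ℝ, s ≠ 0 → ∃ᶠ w in 𝓝 w₀, 0 < s * w.im ∧ φ.symm w ∉ N := by
    intro s hs
    rw [Filter.frequently_iff]
    intro U hU
    obtain ⟨V, hVU, hVo, hwV⟩ := mem_nhds_iff.1 hU
    have hO : IsOpen (V ∩ {w : ℂ | 0 < s * w.im}) :=
      hVo.inter (isOpen_lt continuous_const (continuous_const.mul Complex.continuous_im))
    have hne : (V ∩ {w : ℂ | 0 < s * w.im}).Nonempty := by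
      have hcl : Filter.Tendsto (fun t : ℝ => w₀ + ((t * s : ℝ) : ℂ) * Complex.I) (𝓝[>] 0) (𝓝 w₀) := by
        have : Continuous fun t : ℝ => w₀ + ((t * s : ℝ) : ℂ) * Complex.I := by fun_prop
        have h2 := this.tendsto 0
        simp only [zero_mul, Complex.ofReal_zero, add_zero] at h2
        exact h2.mono_left nhdsWithin_le_nhds
      obtain ⟨t, ht1, ht2⟩ := ((hcl.eventually (hVo.mem_nhds hwV)).and self_mem_nhdsWithin).exists
      refine ⟨_, ht1, ?_⟩
      have ht2 : 0 < t := ht2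
      change 0 < s * _
      simp only [Complex.add_im, him, Complex.mul_im, Complex.ofReal_re, Complex.I_im, mul_one,
        Complex.ofReal_im, Complex.I_re, mul_zero, add_zero, zero_add]
      have : s * (t * s) = t * s ^ 2 := by ring
      rw [this]
      positivity
    have hO' : IsOpen (φ.symm '' (V ∩ {w : ℂ | 0 < s * w.im})) :=
      φ.symm.isOpen_image_of_subset_source hO (by simp [ht])
    obtain ⟨_, ⟨w, hw, rfl⟩, hwN⟩ := hN.inter_open_nonempty _ hO' (hne.image _)
    exact ⟨w, hVU hw.1, hw.2, hwN⟩
  obtain ⟨w₁, ⟨h1, h2⟩, h3⟩ := ((hline 1 one_ne_zero).and_eventually key).exists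
  obtain ⟨w₂, ⟨h4, h5⟩, h6⟩ := ((hline (-1) (by norm_num)).and_eventually key).exists
  have e1 := h3 (by intro e; simp [e] at h1) h2
  have e2 := h6 (by intro e; simp [e] at h4) h5
  rw [if_pos (by linarith)] at e1
  rw [if_neg (by linarith), zero_add] at e2
  rw [← e2] at e1
  simpa using e1

end Local

/-! ### Topological stars -/

/-- A family of arcs starting at `x` and disjoint elsewhere. -/
structure IsPathStar {ι : Type*} (x : S2) (α : ι → ℝ → S2) : Prop where
  cont : ∀ i, ContinuousOn (α i) (Icc 0 1)
  injOn : ∀ i, InjOn (α i) (Icc 0 1)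
  zero : ∀ i, α i 0 = x
  inter : ∀ i j, i ≠ j → trace (α i) ∩ trace (α j) ⊆ {x}

/-- A family of arcs starting at `x`, disjoint elsewhere, whose union is `N` near `x`. -/
structure IsTopStar {ι : Type*} (N : Set S2) (x : S2) (α : ι → ℝ → S2) : Prop
    extends IsPathStar x α where
  nhds : ∀ᶠ y in 𝓝 x, y ∈ N ↔ ∃ i, y ∈ trace (α i)

section Star

variable {ι κ : Type*} {N : Set S2} {x : S2} {α : ι → ℝ → S2} {β : κ → ℝ → S2}

theorem IsArcStar.isTopStar {n : ℕ} {β : Fin n → ℝ → S2} (h : IsArcStar N x β) :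
    IsTopStar N x β := by
  refine ⟨⟨fun i => (h.regular i).continuousOn, h.injOn, h.zero, h.inter⟩, ?_⟩
  obtain ⟨U, hU, e⟩ := h.nhds
  filter_upwards [hU] with y hy
  have := congrArg (y ∈ ·) e
  simpa [hy] using this

theorem isClosed_trace_of_continuousOn {γ : ℝ → S2} (h : ContinuousOn γ (Icc 0 1)) :
    IsClosed (trace γ) :=
  (isCompact_Icc.image_of_continuousOn h).isClosed

theorem IsPathStar.ne (h : IsPathStar x α) (i : ι) {t : ℝ} (ht : t ∈ Ioc (0 : ℝ) 1) : α i t ≠ x := by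
  intro e
  have := h.injOn i ⟨ht.1.le, ht.2⟩ (left_mem_Icc.2 zero_le_one) (e.trans (h.zero i).symm)
  exact ht.1.ne' this

theorem IsPathStar.tendsto (h : IsPathStar x α) (i : ι) :
    Filter.Tendsto (α i) (𝓝[>] 0) (𝓝 x) := by
  have h1 := h.cont i 0 (left_mem_Icc.2 zero_le_one)
  rw [ContinuousWithinAt, h.zero i] at h1
  refine h1.mono_left (nhdsWithin_le_of_mem ?_)
  filter_upwards [Ioo_mem_nhdsGT one_pos] with t ht using ⟨ht.1.le, ht.2.le⟩

theorem IsPathStar.eq_of_mem (h : IsPathStar x α) {i j : ι} {y : S2} (hy : y ≠ x)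
    (hi : y ∈ trace (α i)) (hj : y ∈ trace (α j)) : i = j := by
  by_contra hij
  exact hy (h.inter i j hij ⟨hi, hj⟩)

/-- Away from `x` the traces of the `β k` are closed and pairwise disjoint, so the index `k` is
locally constant along a connected initial piece of `α i`. -/
theorem IsPathStar.exists_branch [Finite κ] (hα : IsPathStar x α) (hβ : IsPathStar x β) (i : ι)
    (h : ∀ᶠ t in 𝓝[>] (0 : ℝ), ∃ k, α i t ∈ trace (β k)) :
    ∃ k, ∀ᶠ t in 𝓝[>] (0 : ℝ), α i t ∈ trace (β k) := by
  obtain ⟨δ, hδ, hsub⟩ := mem_nhdsGT_iff_exists_Ioo_subset.1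
    (h.and (Ioo_mem_nhdsGT one_pos))
  have hδ : 0 < δ := hδ
  have hIcc : ∀ t ∈ Ioo 0 δ, t ∈ Icc (0 : ℝ) 1 := fun t ht =>
    ⟨(hsub ht).2.1.le, (hsub ht).2.2.le⟩
  have hT : IsPreconnected (α i '' Ioo 0 δ) :=
    isPreconnected_Ioo.image _ ((hα.cont i).mono hIcc)
  have hne : ∀ y ∈ α i '' Ioo 0 δ, y ≠ x := by
    rintro _ ⟨t, ht, rfl⟩
    exact hα.ne i ⟨ht.1, (hIcc t ht).2⟩
  have key : ∀ y ∈ α i '' Ioo 0 δ, ∀ y' ∈ α i '' Ioo 0 δ, ∀ k, y ∈ trace (β k) ↔ y' ∈ trace (β k) := by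
    intro y hy y' hy'
    refine hT.induction₂ (P := fun y y' => ∀ k, y ∈ trace (β k) ↔ y' ∈ trace (β k)) ?_ ?_ ?_ hy hy'
    · rintro y hy
      obtain ⟨t, ht, e⟩ := hy
      obtain ⟨k, hk⟩ := (hsub ht).1
      rw [e] at hk
      have hfar : ∀ᶠ z in 𝓝 y, ∀ l, l ≠ k → z ∉ trace (β l) := by
        refine Filter.eventually_all.2 fun l => ?_
        by_cases hl : l = k
        · exact Filter.Eventually.of_forall fun z hz => absurd hl hz
        · filter_upwards [(isClosed_trace_of_continuousOn (hβ.cont l)).compl_mem_nhds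
            fun hyl => hl (hβ.eq_of_mem (hne y ⟨t, ht, e⟩) hyl hk)] with z hz _ using hz
      filter_upwards [nhdsWithin_le_nhds hfar, self_mem_nhdsWithin] with z hz hzT l
      obtain ⟨t', ht', rfl⟩ := hzT
      obtain ⟨k', hk'⟩ := (hsub ht').1
      have hk'' : k' = k := by
        by_contra hcon
        exact hz k' hcon hk'
      by_cases hl : l = k
      · rw [hl]
        exact iff_of_true hk (hk'' ▸ hk')
      · refine iff_of_false (fun hyl => hl (hβ.eq_of_mem (hne y ⟨t, ht, e⟩) hyl hk)) (hz l hl)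
    · exact fun a b c _ _ _ h1 h2 k => (h1 k).trans (h2 k)
    · exact fun a b _ _ h1 k => (h1 k).symm
  have hmid : δ / 2 ∈ Ioo 0 δ := ⟨by linarith, by linarith⟩
  obtain ⟨k, hk⟩ := (hsub hmid).1
  refine ⟨k, ?_⟩
  filter_upwards [Ioo_mem_nhdsGT hδ] with t ht
  exact (key _ ⟨_, hmid, rfl⟩ _ ⟨t, ht, rfl⟩ k).1 hk

theorem IsPathStar.eventually_mem_image_Ioo (hα : IsPathStar x α) (hβ : IsPathStar x β) {i : ι} {k : κ}
    (h : ∀ᶠ t in 𝓝[>] (0 : ℝ), α i t ∈ trace (β k)) {η : ℝ} (hη : 0 < η) :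
    ∀ᶠ t in 𝓝[>] (0 : ℝ), α i t ∈ β k '' Ioo 0 η := by
  have hcl : IsClosed (β k '' Icc η 1) :=
    (isCompact_Icc.image_of_continuousOn ((hβ.cont k).mono (Icc_subset_Icc_left hη.le))).isClosed
  have hx : x ∉ β k '' Icc η 1 := by
    rintro ⟨s, hs, e⟩
    exact hβ.ne k ⟨hη.trans_le hs.1, hs.2⟩ e
  filter_upwards [h, (hα.tendsto i).eventually (hcl.compl_mem_nhds hx), Ioo_mem_nhdsGT one_pos]
    with t ht hfar ht1
  obtain ⟨s, hs, e⟩ := ht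
  refine ⟨s, ⟨lt_of_le_of_ne hs.1 ?_, ?_⟩, e⟩
  · rintro rfl
    exact hα.ne i ⟨ht1.1, ht1.2.le⟩ (e.symm.trans (hβ.zero k))
  · by_contra hcon
    exact hfar ⟨s, ⟨not_lt.1 hcon, hs.2⟩, e⟩

theorem IsTopStar.eventually_exists (hα : IsPathStar x α) (hβ : IsTopStar N x β) (i : ι)
    (hN : ∀ᶠ t in 𝓝[>] (0 : ℝ), α i t ∈ N) : ∀ᶠ t in 𝓝[>] (0 : ℝ), ∃ k, α i t ∈ trace (β k) := by
  filter_upwards [(hα.tendsto i).eventually hβ.nhds, hN] with t h1 h2 using h1.1 h2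

theorem IsTopStar.eventually_mem (hα : IsTopStar N x α) (i : ι) :
    ∀ᶠ t in 𝓝[>] (0 : ℝ), α i t ∈ N := by
  filter_upwards [(hα.tendsto i).eventually hα.nhds, Ioo_mem_nhdsGT one_pos] with t h1 h2
  exact h1.2 ⟨i, t, ⟨h2.1.le, h2.2.le⟩, rfl⟩

/-- The branches of two stars correspond to each other. -/
theorem IsTopStar.exists_equiv [Finite ι] [Finite κ] (hα : IsTopStar N x α) (hβ : IsTopStar N x β) :
    ∃ e : ι ≃ κ, ∀ i, ∀ᶠ t in 𝓝[>] (0 : ℝ), β (e i) t ∈ trace (α i) := by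
  have h1 : ∀ i, ∃ k, ∀ᶠ t in 𝓝[>] (0 : ℝ), α i t ∈ trace (β k) := fun i =>
    hα.exists_branch hβ.toIsPathStar i (IsTopStar.eventually_exists hα.toIsPathStar hβ i
      (hα.eventually_mem i))
  have h2 : ∀ k, ∃ i, ∀ᶠ t in 𝓝[>] (0 : ℝ), β k t ∈ trace (α i) := fun k =>
    hβ.exists_branch hα.toIsPathStar k (IsTopStar.eventually_exists hβ.toIsPathStar hα k
      (hβ.eventually_mem k))
  choose p hp using h1
  choose q hq using h2
  -- A point of `α i` close to `x` lies on `β (p i)` at a small parameter, hence on `α (q (p i))`;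
  -- distinct branches share only `x`.
  have hqp : ∀ i, q (p i) = i := by
    intro i
    obtain ⟨η, hη, hsub⟩ := mem_nhdsGT_iff_exists_Ioo_subset.1 (hq (p i))
    obtain ⟨t, ⟨s, hs, e⟩, ht⟩ := ((hα.eventually_mem_image_Ioo hβ.toIsPathStar (hp i) hη).and
      (Ioo_mem_nhdsGT one_pos)).exists
    have h3 : β (p i) s ∈ trace (α (q (p i))) := hsub hs
    rw [e] at h3
    exact hα.eq_of_mem (hα.ne i ⟨ht.1, ht.2.le⟩) h3 ⟨t, ⟨ht.1.le, ht.2.le⟩, rfl⟩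
  have hpq : ∀ k, p (q k) = k := by
    intro k
    obtain ⟨η, hη, hsub⟩ := mem_nhdsGT_iff_exists_Ioo_subset.1 (hp (q k))
    obtain ⟨t, ⟨s, hs, e⟩, ht⟩ := ((hβ.eventually_mem_image_Ioo hα.toIsPathStar (hq k) hη).and
      (Ioo_mem_nhdsGT one_pos)).exists
    have h3 : α (q k) s ∈ trace (β (p (q k))) := hsub hs
    rw [e] at h3
    exact hβ.eq_of_mem (hβ.ne k ⟨ht.1, ht.2.le⟩) h3 ⟨t, ⟨ht.1.le, ht.2.le⟩, rfl⟩
  refine ⟨⟨p, q, hqp, hpq⟩, fun i => ?_⟩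
  have := hq (p i)
  rwa [hqp i] at this

/-- The closed pieces of the arc before and after `s` cover `K` and both meet it. Connectedness
gives a common point in `K`, which injectivity identifies with `b s`. -/
theorem mem_of_isPreconnected_subset_trace {b : ℝ → S2} (hc : ContinuousOn b (Icc 0 1))
    (hi : InjOn b (Icc 0 1)) {K : Set S2} (hK : IsPreconnected K) (hKb : K ⊆ trace b) (h0 : b 0 ∈ K)
    {s t : ℝ} (hs : 0 ≤ s) (hst : s ≤ t) (ht : t ≤ 1) (htK : b t ∈ K) : b s ∈ K := by
  have c1 : IsClosed (b '' Icc 0 s) := (isCompact_Icc.image_of_continuousOn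
    (hc.mono (Icc_subset_Icc_right (hst.trans ht)))).isClosed
  have c2 : IsClosed (b '' Icc s 1) := (isCompact_Icc.image_of_continuousOn
    (hc.mono (Icc_subset_Icc_left hs))).isClosed
  obtain ⟨y, hyK, ⟨u, hu, rfl⟩, ⟨v, hv, e⟩⟩ := isPreconnected_closed_iff.1 hK _ _ c1 c2 (by
    intro y hy
    obtain ⟨u, hu, rfl⟩ := hKb hy
    rcases le_total u s with h | h
    · exact Or.inl ⟨u, ⟨hu.1, h⟩, rfl⟩
    · exact Or.inr ⟨u, ⟨h, hu.2⟩, rfl⟩)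
    ⟨b 0, h0, 0, ⟨le_rfl, hs⟩, rfl⟩ ⟨b t, htK, t, ⟨hst, ht⟩, rfl⟩
  have huv := hi ⟨hs.trans hv.1, hv.2⟩ ⟨hu.1, hu.2.trans (hst.trans ht)⟩ e
  have : u = s := le_antisymm hu.2 (huv ▸ hv.1)
  rwa [this] at hyK

/-- An initial piece of `α i` is a connected subset of the arc `β k` containing its origin and
another point, so it contains an initial piece of `β k`. -/
theorem IsPathStar.eventually_mem_trace (hα : IsPathStar x α) (hβ : IsPathStar x β) {i : ι} {k : κ}
    (h : ∀ᶠ t in 𝓝[>] (0 : ℝ), α i t ∈ trace (β k)) :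
    ∀ᶠ s in 𝓝[>] (0 : ℝ), β k s ∈ trace (α i) := by
  obtain ⟨δ, hδ, hsub⟩ := mem_nhdsGT_iff_exists_Ioo_subset.1 (h.and (Ioo_mem_nhdsGT one_pos))
  have hδ : 0 < δ := hδ
  have hmid : δ / 2 ∈ Ioo 0 δ := ⟨by linarith, by linarith⟩
  have hIcc : Icc 0 (δ / 2) ⊆ Icc 0 1 := Icc_subset_Icc_right (hsub hmid).2.2.le
  have hK : IsPreconnected (α i '' Icc 0 (δ / 2)) :=
    isPreconnected_Icc.image _ ((hα.cont i).mono hIcc)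
  have h0 : β k 0 ∈ α i '' Icc 0 (δ / 2) :=
    ⟨0, ⟨le_rfl, by linarith⟩, (hα.zero i).trans (hβ.zero k).symm⟩
  have hKb : α i '' Icc 0 (δ / 2) ⊆ trace (β k) := by
    rintro _ ⟨t, ht, rfl⟩
    rcases ht.1.eq_or_lt with rfl | hlt
    · exact ⟨0, left_mem_Icc.2 zero_le_one, (hβ.zero k).trans (hα.zero i).symm⟩
    · exact (hsub ⟨hlt, by linarith [ht.2]⟩).1
  obtain ⟨s₁, hs₁, e⟩ := (hsub hmid).1
  have hs₁0 : 0 < s₁ := by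
    refine lt_of_le_of_ne hs₁.1 ?_
    rintro rfl
    exact hα.ne i ⟨hmid.1, (hsub hmid).2.2.le⟩ (e.symm.trans (hβ.zero k))
  filter_upwards [Ioo_mem_nhdsGT hs₁0] with s hs
  have := mem_of_isPreconnected_subset_trace (hβ.cont k) (hβ.injOn k) hK hKb h0 hs.1.le hs.2.le hs₁.2
    (e ▸ ⟨δ / 2, ⟨by linarith, le_rfl⟩, rfl⟩)
  exact image_mono hIcc this

/-- A star with sufficiently many branches inside `N` covers `N` near the vertex. -/
theorem IsTopStar.eventually_covered [Fintype ι] [Fintype κ] (hβ : IsTopStar N x β)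
    (hα : IsPathStar x α) (hαN : ∀ i, trace (α i) ⊆ N)
    (hcard : Fintype.card κ ≤ Fintype.card ι) : ∀ᶠ y in 𝓝 x, y ∈ N → ∃ i, y ∈ trace (α i) := by
  have h1 : ∀ i, ∃ k, ∀ᶠ t in 𝓝[>] (0 : ℝ), α i t ∈ trace (β k) := by
    refine fun i => hα.exists_branch hβ.toIsPathStar i (IsTopStar.eventually_exists hα hβ i ?_)
    filter_upwards [Ioo_mem_nhdsGT one_pos] with t ht
    exact hαN i ⟨t, ⟨ht.1.le, ht.2.le⟩, rfl⟩
  choose p hp using h1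
  have h2 := fun i => hα.eventually_mem_trace hβ.toIsPathStar (hp i)
  have hinj : Function.Injective p := by
    intro i j hij
    have h3 := h2 j
    rw [← hij] at h3
    obtain ⟨t, ⟨a, b⟩, ht⟩ := (((h2 i).and h3).and (Ioo_mem_nhdsGT one_pos)).exists
    exact hα.eq_of_mem (hβ.ne (p i) ⟨ht.1, ht.2.le⟩) a b
  have hsurj : Function.Surjective p :=
    ((Fintype.bijective_iff_injective_and_card p).2
      ⟨hinj, le_antisymm (Fintype.card_le_of_injective p hinj) hcard⟩).2
  have h3 : ∀ k, ∀ᶠ y in 𝓝 x, y ∈ trace (β k) → ∃ i, y ∈ trace (α i) := by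
    intro k
    obtain ⟨i, rfl⟩ := hsurj k
    obtain ⟨η, hη, hsub⟩ := mem_nhdsGT_iff_exists_Ioo_subset.1 (h2 i)
    have hη : 0 < η := hη
    have hcl : IsClosed (β (p i) '' Icc η 1) := (isCompact_Icc.image_of_continuousOn
      ((hβ.cont _).mono (Icc_subset_Icc_left hη.le))).isClosed
    have hx : x ∉ β (p i) '' Icc η 1 := by
      rintro ⟨s, hs, e⟩
      exact hβ.ne _ ⟨hη.trans_le hs.1, hs.2⟩ e
    filter_upwards [hcl.compl_mem_nhds hx] with y hy hyt
    obtain ⟨s, hs, rfl⟩ := hyt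
    refine ⟨i, ?_⟩
    rcases hs.1.eq_or_lt with rfl | hlt
    · exact ⟨0, left_mem_Icc.2 zero_le_one, (hα.zero i).trans (hβ.zero _).symm⟩
    · refine hsub ⟨hlt, ?_⟩
      by_contra hcon
      exact hy ⟨s, ⟨not_lt.1 hcon, hs.2⟩, rfl⟩
  filter_upwards [hβ.nhds, Filter.eventually_all.2 h3] with y h4 h5 hyN
  obtain ⟨k, hk⟩ := h4.1 hyN
  exact h5 k hk

end Star

/-! ### Segments -/

theorem IsSegment.injOn_Ico {γ : ℝ → S2} (h : IsSegment γ) : InjOn γ (Ico 0 1) := by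
  intro s hs t ht e
  by_contra hne
  rcases lt_or_gt_of_ne hne with hlt | hlt
  · have := h.2 s ⟨hs.1, hs.2.le⟩ t ⟨ht.1, ht.2.le⟩ hlt e
    linarith [ht.2, this.2]
  · have := h.2 t ⟨ht.1, ht.2.le⟩ s ⟨hs.1, hs.2.le⟩ hlt e.symm
    linarith [hs.2, this.2]

theorem IsSegment.isClosed_trace {γ : ℝ → S2} (h : IsSegment γ) : IsClosed (trace γ) :=
  isClosed_trace_of_continuousOn h.1

/-- Precomposition of a segment with an affine injection of `[0, 1]` into itself. -/
theorem IsSegment.injOn_affine {γ : ℝ → S2} (h : IsSegment γ) {a b : ℝ} (hb : b ≠ 0)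
    (hm : ∀ t ∈ Icc (0 : ℝ) 1, a + b * t ∈ Ico (0 : ℝ) 1 ∨ a + b * t ∈ Ioc (0 : ℝ) 1)
    (hne : ¬ (0 ∈ (fun t => a + b * t) '' Icc (0 : ℝ) 1 ∧ 1 ∈ (fun t => a + b * t) '' Icc (0 : ℝ) 1)) :
    InjOn (fun t => γ (a + b * t)) (Icc 0 1) := by
  have hm' : ∀ t ∈ Icc (0 : ℝ) 1, a + b * t ∈ Icc (0 : ℝ) 1 := by
    intro t ht
    rcases hm t ht with h1 | h1
    · exact ⟨h1.1, h1.2.le⟩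
    · exact ⟨h1.1.le, h1.2⟩
  intro s hs t ht e
  have key : a + b * s = a + b * t := by
    by_contra hcon
    rcases lt_or_gt_of_ne hcon with hlt | hlt
    · obtain ⟨e1, e2⟩ := h.2 _ (hm' s hs) _ (hm' t ht) hlt e
      exact hne ⟨⟨s, hs, e1⟩, ⟨t, ht, e2⟩⟩
    · obtain ⟨e1, e2⟩ := h.2 _ (hm' t ht) _ (hm' s hs) hlt e.symm
      exact hne ⟨⟨t, ht, e1⟩, ⟨s, hs, e2⟩⟩
  exact mul_left_cancel₀ hb (by linarith)

/-- Near an inner smooth point of a segment contained in `N`, the set `N` is the segment. -/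
theorem IsSegment.eventually_mem_of_smooth {N : Set S2} {γ : ℝ → S2} (h : IsSegment γ)
    (hN : trace γ ⊆ N) {t : ℝ} (ht : t ∈ Ioo (0 : ℝ) 1)
    (hs : ∃ β : Fin 2 → ℝ → S2, IsArcStar N (γ t) β) :
    ∀ᶠ y in 𝓝 (γ t), y ∈ N → y ∈ γ '' Ioo 0 1 := by
  obtain ⟨β, hβ⟩ := hs
  have ht0 := ht.1
  have ht1 := ht.2
  -- Half of the parameter length available on each side of `t`, so that both branches stay in the
  -- open interval. Two branches suffice to cover `N` near `γ t`.
  let c : Fin 2 → ℝ := ![(1 - t) / 2, -(t / 2)]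
  have hc : ∀ i, c i ≠ 0 ∧ -(t / 2) ≤ c i ∧ c i ≤ (1 - t) / 2 := by
    intro i
    fin_cases i
    · exact ⟨by simp only [c, Fin.zero_eta, Matrix.cons_val_zero]; linarith,
        by simp only [c, Fin.zero_eta, Matrix.cons_val_zero]; linarith,
        by simp only [c, Fin.zero_eta, Matrix.cons_val_zero]; linarith⟩
    · exact ⟨by simp only [c, Fin.mk_one, Matrix.cons_val_one, Matrix.cons_val_fin_one]; linarith,
        by simp only [c, Fin.mk_one, Matrix.cons_val_one, Matrix.cons_val_fin_one]; linarith,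
        by simp only [c, Fin.mk_one, Matrix.cons_val_one, Matrix.cons_val_fin_one]; linarith⟩
  have hmem : ∀ i, ∀ s ∈ Icc (0 : ℝ) 1, t + c i * s ∈ Ioo (0 : ℝ) 1 := by
    intro i s hs
    obtain ⟨-, h1, h2⟩ := hc i
    have h3 := mul_le_mul_of_nonneg_right h1 hs.1
    have h4 := mul_le_mul_of_nonneg_right h2 hs.1
    constructor
    · nlinarith [hs.2]
    · nlinarith [hs.2]
  have hsub : Ioo (0 : ℝ) 1 ⊆ Icc 0 1 := Ioo_subset_Icc_self
  have hα : IsPathStar (γ t) (fun i s => γ (t + c i * s)) := by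
    refine ⟨fun i => ?_, fun i => ?_, fun i => by simp, fun i j hij => ?_⟩
    · refine h.1.comp (by fun_prop) fun s hs => hsub (hmem i s hs)
    · refine h.injOn_affine (hc i).1 (fun s hs => Or.inl ⟨(hmem i s hs).1.le, (hmem i s hs).2⟩) ?_
      rintro ⟨⟨s, hs, e⟩, -⟩
      exact (hmem i s hs).1.ne' e
    · rintro _ ⟨⟨s, hs, rfl⟩, ⟨s', hs', e⟩⟩
      have e1 := h.injOn_Ico ⟨(hmem j s' hs').1.le, (hmem j s' hs').2⟩
        ⟨(hmem i s hs).1.le, (hmem i s hs).2⟩ e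
      have e2 : c j * s' = c i * s := by linarith
      have e3 : s = 0 := by
        have h1 : 0 < (1 - t) / 2 := by linarith
        have h2 : 0 < t / 2 := by linarith
        fin_cases i <;> fin_cases j
        · exact absurd rfl hij
        · simp only [c, Fin.mk_one, Matrix.cons_val_one, Matrix.cons_val_fin_one, Fin.zero_eta,
            Matrix.cons_val_zero] at e2
          nlinarith [hs.1, hs'.1, mul_nonneg h2.le hs'.1]
        · simp only [c, Fin.mk_one, Matrix.cons_val_one, Matrix.cons_val_fin_one, Fin.zero_eta,
            Matrix.cons_val_zero] at e2
          nlinarith [hs.1, hs'.1, mul_nonneg h1.le hs'.1]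
        · exact absurd rfl hij
      simp [e3]
  have hcov := hβ.isTopStar.eventually_covered hα (by
    rintro i _ ⟨s, hs, rfl⟩
    exact hN ⟨_, hsub (hmem i s hs), rfl⟩) le_rfl
  filter_upwards [hcov] with y hy hyN
  obtain ⟨i, s, hs, e⟩ := hy hyN
  exact ⟨_, hmem i s hs, e⟩

/-! ### Nets -/

/-- The end points of a family of segments: `(j, false)` stands for the initial point of the `j`-th
one, and `(j, true)` for its final point. -/
def endPt {m : ℕ} (γ : Fin m → ℝ → S2) (e : Fin m × Bool) : S2 := γ e.1 (if e.2 then 1 else 0)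

/-- A description of `N` as a union of non crossing segments, with `X` among the end points. -/
structure IsNet {m : ℕ} (N X : Set S2) (γ : Fin m → ℝ → S2) : Prop where
  nonCrossing : NonCrossing γ
  eq_iUnion : N = ⋃ i, trace (γ i)
  exists_endPt : ∀ x ∈ X, ∃ e, endPt γ e = x

/-! ### Cutting finitely many segments into a net -/

section Existence

theorem exists_gap {F : Set ℝ} (hF : F.Finite) (h0 : (0 : ℝ) ∈ F) (h1 : (1 : ℝ) ∈ F) {s : ℝ}
    (hs : s ∈ Icc (0 : ℝ) 1) :
    ∃ a ∈ F, ∃ b ∈ F, a < b ∧ s ∈ Icc a b ∧ ∀ u ∈ Ioo a b, u ∉ F := by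
  have hb : ∃ b ∈ F, s ≤ b ∧ 0 < b ∧ ∀ u ∈ F, u < b → u ≤ s := by
    rcases hs.2.lt_or_eq with hlt | rfl
    · obtain ⟨b, ⟨hbF, hsb⟩, hmin⟩ := exists_min_image {u ∈ F | s < u} id
        (hF.subset (sep_subset _ _)) ⟨1, h1, hlt⟩
      refine ⟨b, hbF, hsb.le, hs.1.trans_lt hsb, fun u hu hub => ?_⟩
      by_contra hcon
      have : b ≤ u := hmin u ⟨hu, not_le.1 hcon⟩
      linarith
    -- At `s = 1` no point of `F` is available beyond `s`, so `s` itself is the right end of the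
    -- gap.
    · exact ⟨1, h1, le_rfl, one_pos, fun u _ hu => hu.le⟩
  obtain ⟨b, hbF, hsb, hb0, hb⟩ := hb
  obtain ⟨a, ⟨haF, hab⟩, hmax⟩ := exists_max_image {u ∈ F | u < b} id
    (hF.subset (sep_subset _ _)) ⟨0, h0, hb0⟩
  refine ⟨a, haF, b, hbF, hab, ⟨hb a haF hab, hsb⟩, fun u hu huF => ?_⟩
  have : u ≤ a := hmax u ⟨huF, hu.2⟩
  linarith [hu.1]

/-- The restriction of a curve to `[a, b]`, parametrised by `[0, 1]`. -/
def subArc (γ : ℝ → S2) (a b t : ℝ) : S2 := γ (a + (b - a) * t)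

theorem affine_image_Ioo {a b : ℝ} (hab : a < b) :
    (fun t => a + (b - a) * t) '' Ioo 0 1 = Ioo a b := by
  have h := sub_pos.2 hab
  ext u
  constructor
  · rintro ⟨t, ht, rfl⟩
    constructor <;> nlinarith [ht.1, ht.2]
  · intro hu
    refine ⟨(u - a) / (b - a), ⟨div_pos (by linarith [hu.1]) h, (div_lt_one h).2 (by linarith [hu.2])⟩,
      ?_⟩
    field_simp
    ring

theorem affine_image_Icc {a b : ℝ} (hab : a < b) :
    (fun t => a + (b - a) * t) '' Icc 0 1 = Icc a b := by
  have h := sub_pos.2 hab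
  ext u
  constructor
  · rintro ⟨t, ht, rfl⟩
    constructor <;> nlinarith [ht.1, ht.2]
  · intro hu
    refine ⟨(u - a) / (b - a), ⟨div_nonneg (by linarith [hu.1]) h.le,
      (div_le_one h).2 (by linarith [hu.2])⟩, ?_⟩
    field_simp
    ring

theorem subArc_image_Ioo (γ : ℝ → S2) {a b : ℝ} (hab : a < b) :
    subArc γ a b '' Ioo 0 1 = γ '' Ioo a b := by
  rw [← affine_image_Ioo hab, image_image]
  rfl

theorem trace_subArc (γ : ℝ → S2) {a b : ℝ} (hab : a < b) :
    trace (subArc γ a b) = γ '' Icc a b := by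
  rw [← affine_image_Icc hab, image_image]
  rfl

theorem IsSegment.subArc {γ : ℝ → S2} (h : IsSegment γ) {a b : ℝ} (hab : a < b) (ha : 0 ≤ a)
    (hb : b ≤ 1) : IsSegment (subArc γ a b) := by
  have hm : MapsTo (fun t => a + (b - a) * t) (Icc 0 1) (Icc 0 1) := by
    intro t ht
    have : a + (b - a) * t ∈ Icc a b := affine_image_Icc hab ▸ ⟨t, ht, rfl⟩
    exact ⟨ha.trans this.1, this.2.trans hb⟩
  have h' := sub_pos.2 hab
  refine ⟨h.1.comp (by fun_prop) hm, fun s hs t ht hst e => ?_⟩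
  have hlt : a + (b - a) * s < a + (b - a) * t := by nlinarith
  obtain ⟨e1, e2⟩ := h.2 _ (hm hs) _ (hm ht) hlt e
  constructor
  · nlinarith [hs.1]
  · nlinarith [ht.2]

theorem trace_eq_union (γ : ℝ → S2) : trace γ = γ '' Ioo 0 1 ∪ {γ 0, γ 1} := by
  rw [trace, ← Ioo_union_both zero_le_one, image_union, image_pair]

/-- Open edges with ends in `P` are equal or disjoint. -/
theorem IsSegment.image_Ioo_subset {N P : Set S2} {γ γ' : ℝ → S2} (h : IsSegment γ)
    (h' : IsSegment γ') (hN : trace γ ⊆ N) (hN' : trace γ' ⊆ N) (h0 : γ 0 ∈ P) (h1 : γ 1 ∈ P)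
    (hP : Disjoint (γ '' Ioo 0 1) P) (hP' : Disjoint (γ' '' Ioo 0 1) P)
    (hsm : ∀ x ∈ N, x ∉ P → ∃ β : Fin 2 → ℝ → S2, IsArcStar N x β)
    (hne : ¬ Disjoint (γ '' Ioo 0 1) (γ' '' Ioo 0 1)) : γ' '' Ioo 0 1 ⊆ γ '' Ioo 0 1 := by
  obtain ⟨y₀, hy, hy'⟩ := not_disjoint_iff.1 hne
  have hsub : γ' '' Ioo 0 1 ⊆ N := (image_mono Ioo_subset_Icc_self).trans hN'
  have hpre : IsPreconnected (γ' '' Ioo 0 1) :=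
    isPreconnected_Ioo.image _ (h'.1.mono Ioo_subset_Icc_self)
  intro y hyE
  -- Lying on the open arc of `γ` is locally constant along `γ'`. It is an open condition because
  -- `N` is that arc near its inner points; it is a closed one because the ends of `γ` lie in `P`,
  -- which `γ'` avoids.
  refine (hpre.induction₂ (P := fun y y' => y ∈ γ '' Ioo 0 1 ↔ y' ∈ γ '' Ioo 0 1) ?_ ?_ ?_
    hy' hyE).1 hy
  · intro y hyE
    by_cases hyγ : y ∈ γ '' Ioo 0 1
    · have hyP : y ∉ P := fun hp => disjoint_left.1 hP hyγ hp
      have hyN := hsub hyE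
      obtain ⟨t, ht, rfl⟩ := hyγ
      filter_upwards [nhdsWithin_le_nhds (h.eventually_mem_of_smooth hN ht (hsm _ hyN hyP)),
        self_mem_nhdsWithin] with z hz hzE
      exact iff_of_true ⟨t, ht, rfl⟩ (hz (hsub hzE))
    · have hyt : y ∉ trace γ := by
        rw [trace_eq_union]
        rintro (h2 | rfl | rfl)
        · exact hyγ h2
        · exact disjoint_left.1 hP' hyE h0
        · exact disjoint_left.1 hP' hyE h1
      filter_upwards [nhdsWithin_le_nhds (h.isClosed_trace.compl_mem_nhds hyt)] with z hz
      exact iff_of_false hyγ fun h2 => hz (image_mono Ioo_subset_Icc_self h2)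
  · exact fun a b c _ _ _ h1 h2 => h1.trans h2
  · exact fun a b _ _ h1 => h1.symm

/-- The given segments may overlap, as different domains share parts of their boundaries. They are
cut at the finite set `P` of points of `X` and of all ends; since `N` is a smooth curve off `P`, the
open pieces coincide or are disjoint. -/
theorem exists_net {N X : Set S2} (hX : X.Finite) (hXN : X ⊆ N) {ι : Type*} [Finite ι]
    {g : ι → ℝ → S2} (hg : ∀ a, IsSegment (g a)) (hN : N = ⋃ a, trace (g a))
    (hsm : ∀ x ∈ N, x ∉ X → ∃ β : Fin 2 → ℝ → S2, IsArcStar N x β) :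
    ∃ (m : ℕ) (γ : Fin m → ℝ → S2), IsNet N X γ := by
  classical
  set P : Set S2 := X ∪ ((range fun a => g a 0) ∪ range fun a => g a 1) with hP
  have hPfin : P.Finite := hX.union ((finite_range _).union (finite_range _))
  have hgN : ∀ a, trace (g a) ⊆ N := fun a => hN ▸ subset_iUnion (fun a => trace (g a)) a
  set F : ι → Set ℝ := fun a => {s ∈ Icc 0 1 | g a s ∈ P} with hFdef
  have hF : ∀ a, (F a).Finite := by
    intro a
    have h1 : ({s ∈ Ico 0 1 | g a s ∈ P}).Finite := by
      refine Set.Finite.of_finite_image (hPfin.subset ?_) ((hg a).injOn_Ico.mono (sep_subset _ _))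
      rintro _ ⟨s, hs, rfl⟩
      exact hs.2
    refine (h1.union (finite_singleton 1)).subset ?_
    rintro s ⟨hs, hsP⟩
    rcases hs.2.lt_or_eq with h | h
    · exact Or.inl ⟨⟨hs.1, h⟩, hsP⟩
    · exact Or.inr h
  have h0F : ∀ a, (0 : ℝ) ∈ F a := fun a =>
    ⟨left_mem_Icc.2 zero_le_one, Or.inr (Or.inl ⟨a, rfl⟩)⟩
  have h1F : ∀ a, (1 : ℝ) ∈ F a := fun a =>
    ⟨right_mem_Icc.2 zero_le_one, Or.inr (Or.inr ⟨a, rfl⟩)⟩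
  -- Pieces are recorded as subsets of the sphere, so that a piece lying on several segments is
  -- counted once.
  set Edges : Set (Set S2) := {E | ∃ i, ∃ a ∈ F i, ∃ b ∈ F i, a < b ∧ (∀ u ∈ Ioo a b, u ∉ F i) ∧
    E = g i '' Ioo a b} with hEdges
  have hEfin : Edges.Finite := by
    refine (finite_iUnion fun i => ((hF i).prod (hF i)).image
      fun p => g i '' Ioo p.1 p.2).subset ?_
    rintro E ⟨i, a, ha, b, hb, -, -, rfl⟩
    exact mem_iUnion.2 ⟨i, (a, b), ⟨ha, hb⟩, rfl⟩
  have harc : ∀ E : Edges, ∃ γ : ℝ → S2, IsSegment γ ∧ γ '' Ioo 0 1 = E ∧ γ 0 ∈ P ∧ γ 1 ∈ P ∧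
      Disjoint (γ '' Ioo 0 1) P ∧ trace γ ⊆ N := by
    rintro ⟨E, i, a, ha, b, hb, hab, hgap, rfl⟩
    refine ⟨subArc (g i) a b, (hg i).subArc hab ha.1.1 hb.1.2, subArc_image_Ioo _ hab, ?_, ?_, ?_, ?_⟩
    · simpa [subArc] using ha.2
    · simpa [subArc] using hb.2
    · rw [subArc_image_Ioo _ hab, disjoint_left]
      rintro _ ⟨u, hu, rfl⟩ huP
      exact hgap u hu ⟨⟨ha.1.1.trans hu.1.le, hu.2.le.trans hb.1.2⟩, huP⟩
    · rw [trace_subArc _ hab]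
      exact (image_mono (Icc_subset_Icc ha.1.1 hb.1.2)).trans (hgN i)
  choose c hcs hcE hc0 hc1 hcP hcN using harc
  have hsmP : ∀ x ∈ N, x ∉ P → ∃ β : Fin 2 → ℝ → S2, IsArcStar N x β :=
    fun x hx hxP => hsm x hx fun h => hxP (Or.inl h)
  have hdisj : ∀ E E' : Edges, E ≠ E' → Disjoint (c E '' Ioo 0 1) (c E' '' Ioo 0 1) := by
    intro E E' hne
    by_contra hcon
    have h1 := (hcs E).image_Ioo_subset (hcs E') (hcN E) (hcN E') (hc0 E) (hc1 E) (hcP E) (hcP E')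
      hsmP hcon
    have h2 := (hcs E').image_Ioo_subset (hcs E) (hcN E') (hcN E) (hc0 E') (hc1 E') (hcP E') (hcP E)
      hsmP (fun h => hcon h.symm)
    rw [hcE, hcE] at h1 h2
    exact hne (Subtype.ext (h2.antisymm h1))
  have hend : ∀ E : Edges, ∀ s ∈ Icc (0 : ℝ) 1, ¬ (s = 0 ∨ s = 1) → c E s ∈ c E '' Ioo 0 1 := by
    intro E s hs hne
    push Not at hne
    exact ⟨s, ⟨lt_of_le_of_ne hs.1 (Ne.symm hne.1), lt_of_le_of_ne hs.2 hne.2⟩, rfl⟩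
  have hendP : ∀ E : Edges, ∀ s, (s = 0 ∨ s = 1) → c E s ∈ P := by
    rintro E s (rfl | rfl)
    · exact hc0 E
    · exact hc1 E
  have hone : ∀ E E' : Edges, E ≠ E' → ∀ s ∈ Icc (0 : ℝ) 1, ∀ t ∈ Icc (0 : ℝ) 1, c E s = c E' t →
      s = 0 ∨ s = 1 := by
    intro E E' hne s hs t ht e
    by_contra hcon
    have h1 := hend E s hs hcon
    by_cases htt : t = 0 ∨ t = 1
    · exact disjoint_left.1 (hcP E) h1 (e ▸ hendP E' t htt)
    · exact disjoint_left.1 (hdisj E E' hne) h1 (e ▸ hend E' t ht htt)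
  have hcover : ∀ y ∈ N, ∃ E : Edges, y ∈ trace (c E) := by
    intro y hy
    rw [hN] at hy
    obtain ⟨i, s, hs, rfl⟩ := mem_iUnion.1 hy
    obtain ⟨a, ha, b, hb, hab, hsab, hgap⟩ := exists_gap (hF i) (h0F i) (h1F i) hs
    let E : Edges := ⟨g i '' Ioo a b, i, a, ha, b, hb, hab, hgap, rfl⟩
    refine ⟨E, ?_⟩
    have hsub : g i '' Ioo a b ⊆ trace (c E) := by
      have : (E : Set S2) ⊆ trace (c E) := by
        rw [← hcE]
        exact image_mono Ioo_subset_Icc_self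
      exact this
    have hcont : ContinuousOn (g i) (closure (Ioo a b)) := by
      rw [closure_Ioo hab.ne]
      exact (hg i).1.mono (Icc_subset_Icc ha.1.1 hb.1.2)
    have h2 : g i s ∈ closure (g i '' Ioo a b) := by
      apply hcont.image_closure
      exact ⟨s, by rwa [closure_Ioo hab.ne], rfl⟩
    exact closure_minimal hsub (hcs E).isClosed_trace h2
  have : Fintype Edges := hEfin.fintype
  let e := Fintype.equivFin Edges
  refine ⟨_, fun k => c (e.symm k), ⟨fun k => hcs _, ?_⟩, ?_, ?_⟩
  · intro k l hkl s hs t ht h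
    have hne : e.symm k ≠ e.symm l := fun h => hkl (e.symm.injective h)
    exact ⟨hone _ _ hne s hs t ht h, hone _ _ hne.symm t ht s hs h.symm⟩
  · refine Subset.antisymm (fun y hy => ?_) (iUnion_subset fun k => hcN _)
    obtain ⟨E, hE⟩ := hcover y hy
    exact mem_iUnion.2 ⟨e E, by simpa using hE⟩
  · intro x hx
    obtain ⟨E, s, hs, h⟩ := hcover x (hXN hx)
    have hs' : s = 0 ∨ s = 1 := by
      by_contra hcon
      exact disjoint_left.1 (hcP E) (hend E s hs hcon) (h ▸ Or.inl hx)
    rcases hs' with rfl | rfl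
    · exact ⟨(e E, false), by simpa [endPt] using h⟩
    · exact ⟨(e E, true), by simpa [endPt] using h⟩

end Existence

/-! ### The star of arcs at an end point -/

section Ends

variable {m : ℕ} {N X : Set S2} {γ : Fin m → ℝ → S2}

/-- The part of an arc near one of its ends. -/
noncomputable def endArc (γ : Fin m → ℝ → S2) (e : Fin m × Bool) (t : ℝ) : S2 :=
  γ e.1 ((if e.2 then 1 else 0) + (if e.2 then -(1 / 3) else 1 / 3) * t)

theorem NonCrossing.ne_endPt (h : NonCrossing γ) {j : Fin m} {t : ℝ} (ht : t ∈ Ioo (0 : ℝ) 1)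
    (e : Fin m × Bool) : γ j t ≠ endPt γ e := by
  obtain ⟨k, b⟩ := e
  intro he
  have hb : (if b then (1 : ℝ) else 0) ∈ Icc (0 : ℝ) 1 := by cases b <;> simp
  by_cases hjk : j = k
  · subst hjk
    cases b
    · have := (h.1 j).2 0 (by simp) t ⟨ht.1.le, ht.2.le⟩ ht.1 (by simpa [endPt] using he.symm)
      linarith [ht.2, this.2]
    · have := (h.1 j).2 t ⟨ht.1.le, ht.2.le⟩ 1 (by simp) ht.2 (by simpa [endPt] using he)
      linarith [ht.1, this.1]
  · rcases (h.2 j k hjk t ⟨ht.1.le, ht.2.le⟩ _ hb he).1 with h1 | h1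
    · linarith [ht.1]
    · linarith [ht.2]

theorem IsNet.trace_subset (h : IsNet N X γ) (j : Fin m) : trace (γ j) ⊆ N := by
  rw [h.eq_iUnion]
  exact subset_iUnion (fun i => trace (γ i)) j

theorem IsNet.endPt_mem (h : IsNet N X γ) (e : Fin m × Bool) : endPt γ e ∈ N :=
  h.trace_subset e.1 ⟨_, by cases e.2 <;> simp, rfl⟩

theorem endParam_mem (b : Bool) {t : ℝ} (ht : t ∈ Icc (0 : ℝ) 1) :
    (if b then 1 else 0) + (if b then -(1 / 3) else 1 / 3) * t ∈
      (if b then Icc (2 / 3 : ℝ) 1 else Icc 0 (1 / 3)) := by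
  cases b
  · simp only [Bool.false_eq_true, if_false]
    exact ⟨by linarith [ht.1], by linarith [ht.2]⟩
  · simp only [if_true]
    exact ⟨by linarith [ht.2], by linarith [ht.1]⟩

theorem endParam_mem_Icc (b : Bool) {t : ℝ} (ht : t ∈ Icc (0 : ℝ) 1) :
    (if b then (1 : ℝ) else 0) + (if b then -(1 / 3) else 1 / 3) * t ∈ Icc (0 : ℝ) 1 := by
  have := endParam_mem b ht
  cases b
  · simp only [Bool.false_eq_true, if_false] at this ⊢
    exact ⟨this.1, this.2.trans (by norm_num)⟩
  · simp only [if_true] at this ⊢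
    exact ⟨le_trans (by norm_num) this.1, this.2⟩

theorem endArc_mem_interior (e : Fin m × Bool) {t : ℝ} (ht : t ∈ Ioc (0 : ℝ) 1) :
    endArc γ e t ∈ γ e.1 '' Ioo 0 1 := by
  refine ⟨_, ?_, rfl⟩
  cases e.2
  · simp only [Bool.false_eq_true, if_false]
    exact ⟨by linarith [ht.1], by linarith [ht.2]⟩
  · simp only [if_true]
    exact ⟨by linarith [ht.2], by linarith [ht.1]⟩

theorem endArc_zero (e : Fin m × Bool) : endArc γ e 0 = endPt γ e := by simp [endArc, endPt]

theorem trace_endArc_subset (e : Fin m × Bool) : trace (endArc γ e) ⊆ trace (γ e.1) := by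
  rintro _ ⟨t, ht, rfl⟩
  exact ⟨_, endParam_mem_Icc e.2 ht, rfl⟩

/-- Each end at `v` contributes a third of its arc; thirds rather than halves keep the two ends of a
loop apart away from `v`. Middle thirds, and end arcs based elsewhere, are closed sets missing `v`.
-/
theorem IsNet.isTopStar (h : IsNet N X γ) {v : S2} (hv : ∃ e, endPt γ e = v) :
    IsTopStar N v (fun e : {e // endPt γ e = v} => endArc γ e) := by
  have hseg := h.nonCrossing.1
  have hcont : ∀ e : Fin m × Bool, ContinuousOn (endArc γ e) (Icc 0 1) := fun e =>
    (hseg e.1).1.comp (by fun_prop) fun t ht => endParam_mem_Icc e.2 ht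
  have hpath : IsPathStar v (fun e : {e // endPt γ e = v} => endArc γ e) := by
    refine ⟨fun e => hcont e, ?_, fun e => (endArc_zero _).trans e.2, ?_⟩
    · rintro ⟨⟨j, b⟩, -⟩
      refine (hseg j).injOn_affine (by cases b <;> norm_num) (fun t ht => ?_) ?_
      · have := endParam_mem b ht
        cases b
        · simp only [Bool.false_eq_true, if_false] at this ⊢
          exact Or.inl ⟨this.1, by linarith [this.2]⟩
        · simp only [if_true] at this ⊢
          exact Or.inr ⟨by linarith [this.1], this.2⟩
      · rintro ⟨⟨t, ht, e1⟩, ⟨s, hs, e2⟩⟩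
        have h1 := endParam_mem b ht
        have h2 := endParam_mem b hs
        simp only at e1 e2
        rw [e1] at h1
        rw [e2] at h2
        cases b
        · simp only [Bool.false_eq_true, if_false] at h2
          norm_num at h2
        · simp only [if_true] at h1
          norm_num at h1
    · rintro ⟨⟨j, b⟩, hj⟩ ⟨⟨k, c⟩, hk⟩ hne y ⟨hyj, hyk⟩
      by_contra hyv
      obtain ⟨t, ht, rfl⟩ := hyj
      obtain ⟨s, hs, e⟩ := hyk
      have ht0 : 0 < t := by
        refine lt_of_le_of_ne ht.1 ?_
        rintro rfl
        exact hyv ((endArc_zero _).trans hj)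
      have hs0 : 0 < s := by
        refine lt_of_le_of_ne hs.1 ?_
        rintro rfl
        exact hyv (e.symm.trans ((endArc_zero _).trans hk))
      obtain ⟨u, hu, hu'⟩ := endArc_mem_interior (γ := γ) (j, b) ⟨ht0, ht.2⟩
      by_cases hjk : j = k
      · subst hjk
        have hbc : b ≠ c := by
          rintro rfl
          exact hne rfl
        have h1 := endParam_mem b ht
        have h2 := endParam_mem c hs
        have h3 := endParam_mem_Icc b ht
        have h4 := endParam_mem_Icc c hs
        simp only [endArc] at e
        cases b <;> cases c
        · exact hbc rfl
        · simp only [if_true, Bool.false_eq_true, if_false] at h1 h2 h3 h4 e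
          have := (hseg j).2 _ h3 _ h4 (by linarith [h1.2, h2.1]) e.symm
          linarith [this.1]
        · simp only [if_true, Bool.false_eq_true, if_false] at h1 h2 h3 h4 e
          have := (hseg j).2 _ h4 _ h3 (by linarith [h1.1, h2.2]) e
          linarith [this.1]
        · exact hbc rfl
      · obtain ⟨u', hu1, hu2⟩ := endArc_mem_interior (γ := γ) (k, c) ⟨hs0, hs.2⟩
        have := h.nonCrossing.2 j k hjk u ⟨hu.1.le, hu.2.le⟩ u' ⟨hu1.1.le, hu1.2.le⟩
          (hu'.trans (e.symm.trans hu2.symm))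
        rcases this.1 with h1 | h1
        · linarith [hu.1]
        · linarith [hu.2]
  refine ⟨hpath, ?_⟩
  have hmid : ∀ j, ∀ᶠ y in 𝓝 v, y ∉ γ j '' Icc (1 / 3) (2 / 3) := by
    intro j
    have hcl : IsClosed (γ j '' Icc (1 / 3) (2 / 3)) := (isCompact_Icc.image_of_continuousOn
      ((hseg j).1.mono (Icc_subset_Icc (by norm_num) (by norm_num)))).isClosed
    refine hcl.compl_mem_nhds ?_
    rintro ⟨t, ht, e⟩
    obtain ⟨e', he'⟩ := hv
    exact h.nonCrossing.ne_endPt (j := j) ⟨by linarith [ht.1], by linarith [ht.2]⟩ e' (e.trans he'.symm)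
  have hoff : ∀ e : Fin m × Bool, ∀ᶠ y in 𝓝 v, endPt γ e ≠ v → y ∉ trace (endArc γ e) := by
    intro e
    by_cases he : endPt γ e = v
    · exact Filter.Eventually.of_forall fun y hy => absurd he hy
    · have hvt : v ∉ trace (endArc γ e) := by
        rintro ⟨t, ht, e1⟩
        rcases ht.1.eq_or_lt with rfl | hlt
        · exact he ((endArc_zero e).symm.trans e1)
        · obtain ⟨u, hu, hu'⟩ := endArc_mem_interior (γ := γ) e ⟨hlt, ht.2⟩
          obtain ⟨e', he'⟩ := hv
          exact h.nonCrossing.ne_endPt (j := e.1) hu e' (hu'.trans (e1.trans he'.symm))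
      filter_upwards [(isClosed_trace_of_continuousOn (hcont e)).compl_mem_nhds hvt] with y hy _
      exact hy
  filter_upwards [Filter.eventually_all.2 hmid, Filter.eventually_all.2 hoff] with y h1 h2
  constructor
  · intro hy
    rw [h.eq_iUnion] at hy
    obtain ⟨j, t, ht, rfl⟩ := mem_iUnion.1 hy
    have hcase : ∃ b, γ j t ∈ trace (endArc γ (j, b)) := by
      by_cases ht1 : t ≤ 1 / 3
      · refine ⟨false, 3 * t, ⟨by linarith [ht.1], by linarith⟩, ?_⟩
        simp only [endArc, Bool.false_eq_true, if_false]
        congr 1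
        ring
      · by_cases ht2 : 2 / 3 ≤ t
        · refine ⟨true, 3 * (1 - t), ⟨by linarith [ht.2], by linarith⟩, ?_⟩
          simp only [endArc, if_true]
          congr 1
          ring
        · exact absurd ⟨t, ⟨by linarith, by linarith⟩, rfl⟩ (h1 j)
    obtain ⟨b, hb⟩ := hcase
    refine ⟨⟨(j, b), ?_⟩, hb⟩
    by_contra hcon
    exact h2 (j, b) hcon hb
  · rintro ⟨e, he⟩
    exact h.trace_subset _ (trace_endArc_subset _ he)

/-- The number of ends at `v` is the number of branches of `N` at `v`. -/
theorem IsNet.exists_equiv (h : IsNet N X γ) {v : S2} (hv : ∃ e, endPt γ e = v) {n : ℕ}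
    {β : Fin n → ℝ → S2} (hβ : IsArcStar N v β) :
    ∃ q : {e // endPt γ e = v} ≃ Fin n, ∀ e, ∀ᶠ t in 𝓝[>] (0 : ℝ), β (q e) t ∈ γ e.1.1 '' Ioo 0 1 := by
  have hs := h.isTopStar hv
  obtain ⟨q, hq⟩ := hs.exists_equiv hβ.isTopStar
  refine ⟨q, fun e => ?_⟩
  filter_upwards [hq e, Ioo_mem_nhdsGT one_pos] with t ht ht1
  obtain ⟨s, hs', e1⟩ := ht
  rw [← e1]
  refine endArc_mem_interior _ ⟨lt_of_le_of_ne hs'.1 ?_, hs'.2⟩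
  rintro rfl
  exact hβ.isTopStar.ne (q e) ⟨ht1.1, ht1.2.le⟩ (e1.symm.trans (hs.zero e))

end Ends

/-! ### Reversing and joining the arcs of a net -/

section Reverse

/-- Reverse a curve, or not. -/
def orient (b : Bool) (γ : ℝ → S2) (t : ℝ) : S2 := γ (if b then 1 - t else t)

theorem orientParam_mem (b : Bool) {t : ℝ} (ht : t ∈ Icc (0 : ℝ) 1) :
    (if b then 1 - t else t) ∈ Icc (0 : ℝ) 1 := by
  cases b
  · simpa using ht
  · exact ⟨by simp only [if_true]; linarith [ht.2], by simp only [if_true]; linarith [ht.1]⟩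

theorem trace_orient (b : Bool) (γ : ℝ → S2) : trace (orient b γ) = trace γ := by
  refine Subset.antisymm ?_ ?_
  · rintro _ ⟨t, ht, rfl⟩
    exact ⟨_, orientParam_mem b ht, rfl⟩
  · rintro _ ⟨t, ht, rfl⟩
    refine ⟨_, orientParam_mem b ht, ?_⟩
    cases b <;> simp [orient]

theorem IsSegment.orient {γ : ℝ → S2} (h : IsSegment γ) (b : Bool) :
    IsSegment (orient b γ) := by
  cases b
  · have e : SpherePartition.orient false γ = γ := by
      funext t
      simp [SpherePartition.orient]
    rwa [e]
  · refine ⟨h.1.comp (by simp only [if_true]; fun_prop) fun t ht => orientParam_mem true ht, fun s hs t ht hst e => ?_⟩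
    have := h.2 _ (orientParam_mem true ht) _ (orientParam_mem true hs)
      (by simp only [if_true]; linarith) e.symm
    simp only [if_true] at this
    constructor
    · linarith [this.2]
    · linarith [this.1]

variable {m : ℕ} {N X : Set S2} {γ : Fin m → ℝ → S2}

theorem endPt_orient (b : Fin m → Bool) (e : Fin m × Bool) :
    endPt (fun j => orient (b j) (γ j)) e = endPt γ (e.1, xor (b e.1) e.2) := by
  obtain ⟨j, c⟩ := e
  cases h : b j <;> cases c <;> simp [endPt, orient, h]

theorem NonCrossing.orient (h : NonCrossing γ) (b : Fin m → Bool) :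
    NonCrossing fun j => orient (b j) (γ j) := by
  refine ⟨fun j => (h.1 j).orient _, fun i j hij s hs t ht e => ?_⟩
  have key : ∀ (c : Bool) (u : ℝ), ((if c then 1 - u else u) = 0 ∨ (if c then 1 - u else u) = 1) →
      u = 0 ∨ u = 1 := by
    intro c u hu
    cases c
    · simpa using hu
    · simp only [if_true] at hu
      rcases hu with hu | hu
      · exact Or.inr (by linarith)
      · exact Or.inl (by linarith)
  have := h.2 i j hij _ (orientParam_mem (b i) hs) _ (orientParam_mem (b j) ht) e
  exact ⟨key _ _ this.1, key _ _ this.2⟩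

theorem IsNet.orient (h : IsNet N X γ) (b : Fin m → Bool) :
    IsNet N X fun j => orient (b j) (γ j) := by
  refine ⟨h.nonCrossing.orient b, ?_, fun x hx => ?_⟩
  · simp only [trace_orient]
    exact h.eq_iUnion
  · obtain ⟨⟨j, c⟩, hc⟩ := h.exists_endPt x hx
    refine ⟨(j, xor (b j) c), ?_⟩
    rw [endPt_orient]
    simpa using hc

end Reverse

/-! ### Joining arcs, and nets with the fewest arcs -/

section Join

/-- The concatenation of two curves. -/
noncomputable def joinCurve (a b : ℝ → S2) (t : ℝ) : S2 :=
  if t ≤ 1 / 2 then a (2 * t) else b (2 * t - 1)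

variable {a b : ℝ → S2}

theorem joinCurve_zero : joinCurve a b 0 = a 0 := by
  rw [joinCurve, if_pos (by norm_num), mul_zero]

theorem joinCurve_one : joinCurve a b 1 = b 1 := by
  rw [joinCurve, if_neg (by norm_num)]
  norm_num

theorem joinCurve_of_ge (hab : a 1 = b 0) {t : ℝ} (ht : 1 / 2 ≤ t) :
    joinCurve a b t = b (2 * t - 1) := by
  rcases ht.eq_or_lt with rfl | hlt
  · rw [joinCurve, if_pos le_rfl]
    norm_num
    exact hab
  · rw [joinCurve, if_neg (not_le.2 hlt)]

theorem trace_joinCurve (hab : a 1 = b 0) : trace (joinCurve a b) = trace a ∪ trace b := by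
  refine Subset.antisymm ?_ (union_subset ?_ ?_)
  · rintro _ ⟨t, ht, rfl⟩
    rcases le_total t (1 / 2) with h | h
    · rw [joinCurve, if_pos h]
      exact Or.inl ⟨2 * t, ⟨by linarith [ht.1], by linarith⟩, rfl⟩
    · rw [joinCurve_of_ge hab h]
      exact Or.inr ⟨2 * t - 1, ⟨by linarith, by linarith [ht.2]⟩, rfl⟩
  · rintro _ ⟨t, ht, rfl⟩
    refine ⟨t / 2, ⟨by linarith [ht.1], by linarith [ht.2]⟩, ?_⟩
    rw [joinCurve, if_pos (by linarith [ht.2])]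
    congr 1
    ring
  · rintro _ ⟨t, ht, rfl⟩
    refine ⟨(t + 1) / 2, ⟨by linarith [ht.1], by linarith [ht.2]⟩, ?_⟩
    rw [joinCurve_of_ge hab (by linarith [ht.1])]
    congr 1
    ring

theorem continuousOn_joinCurve (hab : a 1 = b 0) (ha : ContinuousOn a (Icc 0 1))
    (hb : ContinuousOn b (Icc 0 1)) : ContinuousOn (joinCurve a b) (Icc 0 1) := by
  have h1 : ContinuousOn (joinCurve a b) (Icc 0 (1 / 2)) := by
    have : ContinuousOn (fun t => a (2 * t)) (Icc 0 (1 / 2)) :=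
      ha.comp (by fun_prop) fun t ht => ⟨by linarith [ht.1], by linarith [ht.2]⟩
    exact this.congr fun t ht => by rw [joinCurve, if_pos ht.2]
  have h2 : ContinuousOn (joinCurve a b) (Icc (1 / 2) 1) := by
    have : ContinuousOn (fun t => b (2 * t - 1)) (Icc (1 / 2) 1) :=
      hb.comp (by fun_prop) fun t ht => ⟨by linarith [ht.1], by linarith [ht.2]⟩
    exact this.congr fun t ht => joinCurve_of_ge hab ht.1
  have := h1.union_of_isClosed h2 isClosed_Icc isClosed_Icc
  rwa [Icc_union_Icc_eq_Icc (by norm_num) (by norm_num)] at this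

theorem IsSegment.joinCurve (ha : IsSegment a) (hb : IsSegment b) (hab : a 1 = b 0)
    (ha' : a 0 ≠ a 1) (hb' : b 0 ≠ b 1)
    (h : ∀ s ∈ Icc (0 : ℝ) 1, ∀ t ∈ Icc (0 : ℝ) 1, a s = b t → s = 1 ∧ t = 0 ∨ s = 0 ∧ t = 1) :
    IsSegment (joinCurve a b) := by
  refine ⟨continuousOn_joinCurve hab ha.1 hb.1, fun s hs t ht hst e => ?_⟩
  by_cases ht2 : t ≤ 1 / 2
  · rw [SpherePartition.joinCurve, SpherePartition.joinCurve, if_pos (hst.le.trans ht2),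
      if_pos ht2] at e
    obtain ⟨h1, h2⟩ := ha.2 _ ⟨by linarith [hs.1], by linarith⟩ _ ⟨by linarith [ht.1], by linarith⟩
      (by linarith) e
    rw [h1, h2] at e
    exact absurd e ha'
  · by_cases hs2 : s ≤ 1 / 2
    · rw [SpherePartition.joinCurve, SpherePartition.joinCurve, if_pos hs2, if_neg ht2] at e
      rcases h _ ⟨by linarith [hs.1], by linarith⟩ _ ⟨by linarith, by linarith [ht.2]⟩ e with h1 | h1
      · exact absurd (by linarith [h1.2]) ht2
      · exact ⟨by linarith [h1.1], by linarith [h1.2]⟩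
    · rw [SpherePartition.joinCurve, SpherePartition.joinCurve, if_neg hs2, if_neg ht2] at e
      obtain ⟨h1, h2⟩ := hb.2 _ ⟨by linarith, by linarith [ht.2]⟩ _ ⟨by linarith, by linarith [ht.2]⟩
        (by linarith) e
      rw [h1, h2] at e
      exact absurd e hb'

variable {m : ℕ} {N X : Set S2}

/-- Two arcs meeting at a point which belongs to no other arc can be joined. -/
theorem IsNet.exists_join {γ : Fin (m + 1) → ℝ → S2} (h : IsNet N X γ) {v : S2} (hv : v ∉ X)
    {j k : Fin (m + 1)} (hjk : j ≠ k) (hj : γ j 1 = v) (hk : γ k 0 = v)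
    (hend : ∀ e, endPt γ e = v → e = (j, true) ∨ e = (k, false)) :
    ∃ γ' : Fin m → ℝ → S2, IsNet N X γ' := by
  classical
  have hseg := h.nonCrossing.1
  have hab : γ j 1 = γ k 0 := hj.trans hk.symm
  have hno : ∀ l, (l ≠ j → γ l 1 ≠ v) ∧ (l ≠ k → γ l 0 ≠ v) := by
    intro l
    constructor
    · intro hl e
      rcases hend (l, true) (by simpa [endPt] using e) with h1 | h1
      · exact hl (congrArg Prod.fst h1)
      · simpa using congrArg Prod.snd h1
    · intro hl e
      rcases hend (l, false) (by simpa [endPt] using e) with h1 | h1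
      · simpa using congrArg Prod.snd h1
      · exact hl (congrArg Prod.fst h1)
  have hj0 : γ j 0 ≠ v := (hno j).2 hjk
  have hk1 : γ k 1 ≠ v := (hno k).1 hjk.symm
  set c := joinCurve (γ j) (γ k) with hc
  have hcseg : IsSegment c := by
    refine (hseg j).joinCurve (hseg k) hab (by rw [hj]; exact hj0) (by rw [hk]; exact hk1.symm) ?_
    intro s hs t ht e
    obtain ⟨h1, h2⟩ := h.nonCrossing.2 j k hjk s hs t ht e
    rcases h1 with rfl | rfl <;> rcases h2 with rfl | rfl
    · exact absurd (e.trans hk) hj0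
    · exact Or.inr ⟨rfl, rfl⟩
    · exact Or.inl ⟨rfl, rfl⟩
    · exact absurd (e.symm.trans hj) hk1
  have hcross : ∀ l, l ≠ j → l ≠ k → ∀ s ∈ Icc (0 : ℝ) 1, ∀ t ∈ Icc (0 : ℝ) 1, γ l s = c t →
      (s = 0 ∨ s = 1) ∧ (t = 0 ∨ t = 1) := by
    intro l hlj hlk s hs t ht e
    have hlv : ∀ u, (u = 0 ∨ u = 1) → γ l u ≠ v := by
      rintro u (rfl | rfl)
      · exact (hno l).2 hlk
      · exact (hno l).1 hlj
    by_cases ht2 : t ≤ 1 / 2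
    · rw [hc, joinCurve, if_pos ht2] at e
      obtain ⟨h1, h2⟩ := h.nonCrossing.2 l j hlj s hs _ ⟨by linarith [ht.1], by linarith⟩ e
      refine ⟨h1, ?_⟩
      rcases h2 with h2 | h2
      · exact Or.inl (by linarith)
      · rw [h2, hj] at e
        exact absurd e (hlv s h1)
    · rw [hc, joinCurve, if_neg ht2] at e
      obtain ⟨h1, h2⟩ := h.nonCrossing.2 l k hlk s hs _ ⟨by linarith, by linarith [ht.2]⟩ e
      refine ⟨h1, ?_⟩
      rcases h2 with h2 | h2
      · rw [h2, hk] at e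
        exact absurd e (hlv s h1)
      · exact Or.inr (by linarith)
  -- The joined curve takes the place of arc `j`, and the index `k` is deleted.
  let γ' : Fin m → ℝ → S2 := fun i => if k.succAbove i = j then c else γ (k.succAbove i)
  obtain ⟨i₀, hi₀⟩ := Fin.exists_succAbove_eq hjk
  have hγ'0 : γ' i₀ = c := if_pos hi₀
  have hγ' : ∀ i, i ≠ i₀ → γ' i = γ (k.succAbove i) ∧ k.succAbove i ≠ j := by
    intro i hi
    have : k.succAbove i ≠ j := by
      rw [← hi₀]
      exact fun e => hi (Fin.succAbove_right_injective e)
    exact ⟨if_neg this, this⟩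
  have hother : ∀ l, l ≠ j → l ≠ k → ∃ i, γ' i = γ l := by
    intro l hlj hlk
    obtain ⟨i, hi⟩ := Fin.exists_succAbove_eq hlk
    refine ⟨i, ?_⟩
    simp only [γ']
    rw [hi, if_neg hlj]
  refine ⟨γ', ⟨?_, ?_⟩, ?_, ?_⟩
  · intro i
    by_cases hi : i = i₀
    · rw [hi, hγ'0]
      exact hcseg
    · rw [(hγ' i hi).1]
      exact hseg _
  · intro i l hil s hs t ht e
    by_cases hi : i = i₀
    · have hl : l ≠ i₀ := fun h => hil (hi.trans h.symm)
      rw [hi, hγ'0, (hγ' l hl).1] at e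
      exact (hcross _ (hγ' l hl).2 (Fin.succAbove_ne _ _) t ht s hs e.symm).symm
    · rw [(hγ' i hi).1] at e
      by_cases hl : l = i₀
      · rw [hl, hγ'0] at e
        exact hcross _ (hγ' i hi).2 (Fin.succAbove_ne _ _) s hs t ht e
      · rw [(hγ' l hl).1] at e
        exact h.nonCrossing.2 _ _ (fun e => hil (Fin.succAbove_right_injective e)) s hs t ht e
  · have hctr : trace c = trace (γ j) ∪ trace (γ k) := trace_joinCurve hab
    rw [h.eq_iUnion]
    refine Subset.antisymm (iUnion_subset fun l => ?_) (iUnion_subset fun i => ?_)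
    · by_cases hlj : l = j
      · refine Subset.trans ?_ (subset_iUnion _ i₀)
        rw [hγ'0, hctr, hlj]
        exact subset_union_left
      · by_cases hlk : l = k
        · refine Subset.trans ?_ (subset_iUnion _ i₀)
          rw [hγ'0, hctr, hlk]
          exact subset_union_right
        · obtain ⟨i, hi⟩ := hother l hlj hlk
          rw [← hi]
          exact subset_iUnion (fun i => trace (γ' i)) i
    · by_cases hi : i = i₀
      · rw [hi, hγ'0, hctr]
        exact union_subset (subset_iUnion (fun i => trace (γ i)) j)
          (subset_iUnion (fun i => trace (γ i)) k)
      · rw [(hγ' i hi).1]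
        exact subset_iUnion (fun i => trace (γ i)) _
  · intro x hx
    have hxv : x ≠ v := fun e => hv (e ▸ hx)
    obtain ⟨⟨l, d⟩, hd⟩ := h.exists_endPt x hx
    by_cases hlj : l = j
    · subst hlj
      refine ⟨(i₀, false), ?_⟩
      cases d
      · simp only [endPt, hγ'0, hc, Bool.false_eq_true, if_false] at hd ⊢
        rw [joinCurve_zero, hd]
      · simp only [endPt, if_true] at hd
        exact absurd (hd.symm.trans hj) hxv
    · by_cases hlk : l = k
      · subst hlk
        refine ⟨(i₀, true), ?_⟩
        cases d
        · simp only [endPt, Bool.false_eq_true, if_false] at hd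
          exact absurd (hd.symm.trans hk) hxv
        · simp only [endPt, hγ'0, hc, if_true] at hd ⊢
          rw [joinCurve_one, hd]
      · obtain ⟨i, hi⟩ := hother l hlj hlk
        refine ⟨(i, d), ?_⟩
        simp only [endPt, hi]
        exact hd

/-- A net with the least number of arcs: the end points outside of `X` are the base points of
isolated closed arcs. -/
structure IsReducedNet {m : ℕ} (N X : Set S2) (γ : Fin m → ℝ → S2) : Prop extends IsNet N X γ where
  isolated : ∀ e, endPt γ e ∉ X → ∀ e', endPt γ e' = endPt γ e ↔ e'.1 = e.1

/-- In a net with the fewest arcs, an end outside `X` is a smooth point, where exactly two ends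
meet. If they belonged to different arcs, joining these would give a smaller net. -/
theorem exists_reducedNet (hsm : ∀ x ∈ N, x ∉ X → ∃ β : Fin 2 → ℝ → S2, IsArcStar N x β)
    (h : ∃ (m : ℕ) (γ : Fin m → ℝ → S2), IsNet N X γ) :
    ∃ (m : ℕ) (γ : Fin m → ℝ → S2), IsReducedNet N X γ := by
  classical
  obtain ⟨γ, hγ⟩ := Nat.find_spec h
  have hmin : ∀ m' < Nat.find h, ¬ ∃ γ' : Fin m' → ℝ → S2, IsNet N X γ' := fun m' hm' =>
    Nat.find_min h hm'
  generalize Nat.find h = m at γ hγ hmin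
  refine ⟨m, γ, hγ, fun e he => ?_⟩
  obtain ⟨β, hβ⟩ := hsm _ (hγ.endPt_mem e) he
  obtain ⟨q, -⟩ := hγ.exists_equiv ⟨e, rfl⟩ hβ
  obtain ⟨e', hne, hall⟩ : ∃ e' : {e' // endPt γ e' = endPt γ e}, e' ≠ ⟨e, rfl⟩ ∧
      ∀ e'', e'' = ⟨e, rfl⟩ ∨ e'' = e' := by
    have h2 : ∀ i : Fin 2, ∃ j, j ≠ i ∧ ∀ k, k = i ∨ k = j := by decide
    obtain ⟨j, hj, hk⟩ := h2 (q ⟨e, rfl⟩)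
    refine ⟨q.symm j, fun hcon => hj (by rw [← hcon]; simp), fun e'' => ?_⟩
    rcases hk (q e'') with h3 | h3
    · exact Or.inl (q.injective h3)
    · exact Or.inr (by rw [← h3]; simp)
  obtain ⟨e', he'⟩ := e'
  have hne' : e' ≠ e := fun h => hne (Subtype.ext h)
  have hall' : ∀ e'', endPt γ e'' = endPt γ e → e'' = e ∨ e'' = e' := by
    intro e'' h3
    rcases hall ⟨e'', h3⟩ with h4 | h4
    · exact Or.inl (congrArg Subtype.val h4)
    · exact Or.inr (congrArg Subtype.val h4)
  by_cases harc : e'.1 = e.1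
  · intro e''
    constructor
    · intro h3
      rcases hall' e'' h3 with rfl | rfl
      · rfl
      · exact harc
    · intro h3
      obtain ⟨j, b⟩ := e
      obtain ⟨j', b'⟩ := e'
      obtain ⟨j'', b''⟩ := e''
      simp only at harc h3
      subst harc h3
      have hb : b' ≠ b := by
        rintro rfl
        exact hne' rfl
      have hdec : ∀ b b' b'' : Bool, b' ≠ b → b'' = b ∨ b'' = b' := by decide
      rcases hdec b b' b'' hb with rfl | rfl
      · rfl
      · exact he'
  · exfalso
    obtain ⟨j, b⟩ := e
    obtain ⟨k, b'⟩ := e'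
    simp only at harc
    obtain ⟨m, rfl⟩ : ∃ m', m = m' + 1 := ⟨m - 1, by have := j.2; omega⟩
    -- orient the two arcs
    let c : Fin (m + 1) → Bool := fun l => if l = j then !b else b'
    have hcj : c j = !b := if_pos rfl
    have hck : c k = b' := if_neg harc
    have hnet := hγ.orient c
    refine hmin m (Nat.lt_succ_self m) (hnet.exists_join (v := endPt γ (j, b)) he (Ne.symm harc) ?_ ?_ ?_)
    · have := endPt_orient (γ := γ) c (j, true)
      simp only [hcj] at this
      simpa [endPt, hcj] using this
    · have := endPt_orient (γ := γ) c (k, false)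
      simp only [hck] at this
      rw [← he']
      simpa [endPt, hck] using this
    · intro e'' h3
      rw [endPt_orient] at h3
      rcases hall' _ h3 with h4 | h4
      · left
        obtain ⟨l, d⟩ := e''
        simp only [Prod.mk.injEq] at h4
        obtain ⟨rfl, h5⟩ := h4
        rw [hcj] at h5
        have hdec : ∀ b d : Bool, xor (!b) d = b → d = true := by decide
        rw [hdec b d h5]
      · right
        obtain ⟨l, d⟩ := e''
        simp only [Prod.mk.injEq] at h4
        obtain ⟨rfl, h5⟩ := h4
        rw [hck] at h5
        have hdec : ∀ b d : Bool, xor b d = b → d = false := by decide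
        rw [hdec b' d h5]

end Join

/-! ### Cycles of a net and functions with jumps along the net -/

section Jumps

variable {m : ℕ} {N X : Set S2} {γ : Fin m → ℝ → S2}

/-- The coefficient at `v` of the boundary of the `ZMod 2`-chain `ζ`. -/
noncomputable def chainBoundary (γ : Fin m → ℝ → S2) (ζ : Fin m → ZMod 2) (v : S2) : ZMod 2 :=
  open Classical in ∑ e with endPt γ e = v, ζ e.1

/-- The value of a chain at the inner points of the arcs. -/
noncomputable def chainVal (γ : Fin m → ℝ → S2) (ζ : Fin m → ZMod 2) (y : S2) : ZMod 2 :=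
  open Classical in if ∃ j, y ∈ γ j '' Ioo 0 1 ∧ ζ j ≠ 0 then 1 else 0

theorem NonCrossing.eq_of_mem_image_Ioo (h : NonCrossing γ) {i j : Fin m} {y : S2}
    (hi : y ∈ γ i '' Ioo 0 1) (hj : y ∈ γ j '' Ioo 0 1) : i = j := by
  by_contra hij
  obtain ⟨s, hs, rfl⟩ := hi
  obtain ⟨t, ht, e⟩ := hj
  rcases (h.2 i j hij s ⟨hs.1.le, hs.2.le⟩ t ⟨ht.1.le, ht.2.le⟩ e.symm).1 with h1 | h1
  · exact hs.1.ne' h1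
  · exact hs.2.ne h1

theorem NonCrossing.chainVal_eq (h : NonCrossing γ) (ζ : Fin m → ZMod 2) {j : Fin m} {y : S2}
    (hy : y ∈ γ j '' Ioo 0 1) : chainVal γ ζ y = ζ j := by
  have h2 : ∀ a : ZMod 2, a ≠ 0 → a = 1 := by decide
  unfold chainVal
  split_ifs with h1
  · obtain ⟨i, hi, hne⟩ := h1
    rw [h.eq_of_mem_image_Ioo hy hi, h2 _ hne]
  · push Not at h1
    exact (h1 j hy).symm

theorem IsNet.chainVal_of_notMem (h : IsNet N X γ) (ζ : Fin m → ZMod 2) {y : S2} (hy : y ∉ N) :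
    chainVal γ ζ y = 0 := by
  refine if_neg ?_
  rintro ⟨j, hj, -⟩
  exact hy (h.trace_subset j (image_mono Ioo_subset_Icc_self hj))

/-- `f` is constant near exactly the points where the chain vanishes. -/
def HasJumps (N : Set S2) (γ : Fin m → ℝ → S2) (ζ : Fin m → ZMod 2) (f : S2 → ZMod 2) (x : S2) :
    Prop :=
  ∀ᶠ y in 𝓝 x, y ∉ range (endPt γ) → (ConstNear N f y ↔ chainVal γ ζ y = 0)

/-- The standing assumptions on a closed set described by a net. -/
structure IsTameNet (N X : Set S2) (γ : Fin m → ℝ → S2) : Prop extends IsNet N X γ where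
  dense : Dense Nᶜ
  smooth : ∀ x ∈ N, x ∉ X → ∃ β : Fin 2 → ℝ → S2, IsArcStar N x β
  star : ∀ x ∈ X, ∃ (n : ℕ) (β : Fin n → ℝ → S2), IsArcStar N x β

theorem eventually_notMem_range_endPt (γ : Fin m → ℝ → S2) (x : S2) :
    ∀ᶠ y in 𝓝[≠] x, y ∉ range (endPt γ) := by
  have hfin : (range (endPt γ) \ {x}).Finite := (finite_range _).subset sdiff_subset
  rw [eventually_nhdsWithin_iff]
  filter_upwards [hfin.isClosed.compl_mem_nhds (x := x) (by simp)] with y hy hyx hyV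
  exact hy ⟨hyV, hyx⟩

variable (h : IsTameNet N X γ)

include h

theorem IsTameNet.isClosed : IsClosed N := by
  rw [h.eq_iUnion]
  exact isClosed_iUnion_of_finite fun i => (h.nonCrossing.1 i).isClosed_trace

theorem IsTameNet.exists_star {x : S2} (hx : x ∈ N) :
    ∃ (n : ℕ) (β : Fin n → ℝ → S2), IsArcStar N x β := by
  by_cases hxX : x ∈ X
  · exact h.star x hxX
  · exact ⟨2, h.smooth x hx hxX⟩

theorem IsTameNet.subset_range : X ⊆ range (endPt γ) := fun x hx => h.exists_endPt x hx

theorem IsTameNet.range_subset : range (endPt γ) ⊆ N := by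
  rintro _ ⟨e, rfl⟩
  exact h.endPt_mem e

theorem IsTameNet.mem_interior {x : S2} (hx : x ∈ N) (hxV : x ∉ range (endPt γ)) :
    ∃ j, x ∈ γ j '' Ioo 0 1 := by
  rw [h.eq_iUnion] at hx
  obtain ⟨j, hj⟩ := mem_iUnion.1 hx
  rw [trace_eq_union] at hj
  rcases hj with hj | rfl | rfl
  · exact ⟨j, hj⟩
  · exact absurd ⟨(j, false), by simp [endPt]⟩ hxV
  · exact absurd ⟨(j, true), by simp [endPt]⟩ hxV

theorem IsTameNet.smooth_of_notMem {x : S2} (hx : x ∈ N) (hxV : x ∉ range (endPt γ)) :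
    ∃ β : Fin 2 → ℝ → S2, IsArcStar N x β :=
  h.smooth x hx fun hX => hxV (h.subset_range hX)

theorem IsTameNet.inner_mem {j : Fin m} {t : ℝ} (ht : t ∈ Ioo (0 : ℝ) 1) :
    γ j t ∈ N ∧ γ j t ∉ range (endPt γ) := by
  refine ⟨h.trace_subset j ⟨t, Ioo_subset_Icc_self ht, rfl⟩, ?_⟩
  rintro ⟨e, he⟩
  exact h.nonCrossing.ne_endPt ht e he.symm

/-- At a vertex, branches of `N` correspond to ends of arcs, so the vanishing of the sum of the
jumps is the cycle condition. At an inner point the same value occurs on two branches and cancels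
mod 2. -/
theorem IsTameNet.exists_hasJumps {ζ : Fin m → ZMod 2} (hζ : ∀ v, chainBoundary γ ζ v = 0) (x : S2) :
    ∃ f, HasJumps N γ ζ f x := by
  classical
  by_cases hxN : x ∈ N
  swap
  · refine ⟨fun _ => 0, ?_⟩
    filter_upwards [h.isClosed.compl_mem_nhds hxN] with y hy _
    exact iff_of_true ⟨0, Filter.Eventually.of_forall fun _ _ => rfl⟩ (h.chainVal_of_notMem ζ hy)
  by_cases hxV : x ∈ range (endPt γ)
  · obtain ⟨n, β, hβ⟩ := h.exists_star hxN
    obtain ⟨q, hq⟩ := h.exists_equiv hxV hβ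
    obtain ⟨f, hf⟩ := hβ.exists_jumps (z := chainVal γ ζ) (fun y hy => h.chainVal_of_notMem ζ hy)
      (fun i => ζ (q.symm i).1.1) (fun i => by
        obtain ⟨e, rfl⟩ := q.surjective i
        filter_upwards [hq e] with t ht
        rw [h.nonCrossing.chainVal_eq ζ ht]
        simp) (by
        rw [← hζ x, chainBoundary, ← Equiv.sum_comp q, ← Finset.sum_subtype_eq_sum_filter]
        simp only [Equiv.symm_apply_apply]
        exact Finset.sum_bij (fun e _ => ⟨e.1, e.2⟩) (by simp) (by simp) (by simp) (by simp))
    refine ⟨f, ?_⟩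
    rw [eventually_nhdsWithin_iff] at hf
    filter_upwards [hf] with y hy hyV
    exact hy fun e => hyV (e ▸ hxV)
  · obtain ⟨j, t, ht, rfl⟩ := h.mem_interior hxN hxV
    obtain ⟨β, hβ⟩ := h.smooth_of_notMem hxN hxV
    have hnear := (h.nonCrossing.1 j).eventually_mem_of_smooth (h.trace_subset j) ht ⟨β, hβ⟩
    have hβj : ∀ i, ∀ᶠ s in 𝓝[>] (0 : ℝ), β i s ∈ γ j '' Ioo 0 1 := by
      intro i
      filter_upwards [(hβ.isTopStar.tendsto i).eventually hnear, hβ.isTopStar.eventually_mem i]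
        with s h1 h2 using h1 h2
    obtain ⟨f, hf⟩ := hβ.exists_jumps (z := chainVal γ ζ) (fun y hy => h.chainVal_of_notMem ζ hy)
      (fun _ => ζ j) (fun i => by
        filter_upwards [hβj i] with s hs using h.nonCrossing.chainVal_eq ζ hs)
      (by rw [Fin.sum_univ_two, CharTwo.add_self_eq_zero])
    refine ⟨f, ?_⟩
    -- The local construction says nothing at the centre itself, which here is not an end and must
    -- be covered too.
    have hx : ConstNear N f (γ j t) ↔ chainVal γ ζ (γ j t) = 0 := by
      rw [h.nonCrossing.chainVal_eq ζ ⟨t, ht, rfl⟩]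
      have hne : Filter.Tendsto (β 0) (𝓝[>] 0) (𝓝[≠] (γ j t)) := by
        refine tendsto_nhdsWithin_iff.2 ⟨hβ.isTopStar.tendsto 0, ?_⟩
        filter_upwards [Ioo_mem_nhdsGT one_pos] with s hs
        exact hβ.isTopStar.ne 0 ⟨hs.1, hs.2.le⟩
      constructor
      · intro hc
        obtain ⟨s, ⟨h1, h2⟩, h3⟩ := (((hne.eventually hf).and
          ((hβ.isTopStar.tendsto 0).eventually hc.eventually)).and (hβj 0)).exists
        rw [← h.nonCrossing.chainVal_eq ζ h3]
        exact h1.1 h2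
      · intro hz
        refine constNear_of_punctured h.dense hxN ?_
        filter_upwards [hf, nhdsWithin_le_nhds hnear] with y h1 h2
        refine h1.2 ?_
        by_cases hyN : y ∈ N
        · rw [h.nonCrossing.chainVal_eq ζ (h2 hyN), hz]
        · exact h.chainVal_of_notMem ζ hyN
    rw [eventually_nhdsWithin_iff] at hf
    filter_upwards [hf] with y hy _
    by_cases hyx : y = γ j t
    · rw [hyx]
      exact hx
    · exact hy hyx

/-- The ends are finitely many points of `N`, hence removable. -/
theorem IsTameNet.constNear_of_off_ends {f : S2 → ZMod 2} {x : S2}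
    (hf : ∀ᶠ y in 𝓝 x, y ∉ range (endPt γ) → ConstNear N f y) : ConstNear N f x := by
  by_cases hxV : x ∈ range (endPt γ)
  · refine constNear_of_punctured h.dense (h.range_subset hxV) ?_
    filter_upwards [nhdsWithin_le_nhds hf, eventually_notMem_range_endPt γ _] with y h1 h2 using h1 h2
  · exact hf.self_of_nhds hxV

/-- Two functions with the same jumps have a sum without jumps at smooth points, hence also at the
ends, which are removable. -/
theorem IsTameNet.germTorsor {ζ : Fin m → ZMod 2} (hζ : ∀ v, chainBoundary γ ζ v = 0) :
    GermTorsor N (HasJumps N γ ζ) := by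
  refine ⟨fun f g x c hf hg => ?_, fun f g x hf hg => ?_, fun x => ?_⟩
  · filter_upwards [hf, eventually_eventually_nhds.2 hg] with y h1 h2 hyV
    rw [← h1 hyV]
    constructor
    · rintro ⟨d, hd⟩
      refine ⟨d - c, ?_⟩
      filter_upwards [hd, h2] with u h3 h4 hu
      rw [← h3 hu, h4 hu, add_sub_cancel_right]
    · rintro ⟨d, hd⟩
      refine ⟨d + c, ?_⟩
      filter_upwards [hd, h2] with u h3 h4 hu
      rw [← h3 hu, h4 hu]
  · have hoff : ∀ f : S2 → ZMod 2, ∀ y, (∀ᶠ u in 𝓝 y, u ∉ range (endPt γ) →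
        (ConstNear N f u ↔ chainVal γ ζ u = 0)) → ∀ᶠ u in 𝓝 y, u ∉ N → ConstNear N f u := by
      intro f y hy
      filter_upwards [hy] with u hu huN
      exact (hu fun hV => huN (h.range_subset hV)).2 (h.chainVal_of_notMem ζ huN)
    refine h.constNear_of_off_ends ?_
    filter_upwards [eventually_eventually_nhds.2 hf, eventually_eventually_nhds.2 hg] with y h1 h2 hyV
    have h3 := h1.self_of_nhds hyV
    have h4 := h2.self_of_nhds hyV
    by_cases hyN : y ∈ N
    · obtain ⟨β, hβ⟩ := h.smooth_of_notMem hyN hyV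
      rw [hβ.constNear_add_iff h.dense (hoff f y h1) (hoff g y h2), h3, h4]
    · have hz := h.chainVal_of_notMem ζ hyN
      obtain ⟨c, hc⟩ := h3.2 hz
      obtain ⟨d, hd⟩ := h4.2 hz
      refine ⟨c + d, ?_⟩
      filter_upwards [hc, hd] with u h5 h6 hu
      rw [h5 hu, h6 hu]
  · obtain ⟨f, hf⟩ := h.exists_hasJumps hζ x
    exact ⟨f, eventually_eventually_nhds.2 hf⟩

/-- Every cycle is the set of jumps of a function which is locally constant off the net. -/
theorem IsTameNet.exists_jump_function {ζ : Fin m → ZMod 2} (hζ : ∀ v, chainBoundary γ ζ v = 0) :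
    ∃ f : S2 → ZMod 2, (∀ y, y ∉ N → ConstNear N f y) ∧
      ∀ j, ConstNear N f (γ j (1 / 2)) ↔ ζ j = 0 := by
  obtain ⟨f, hf⟩ := (h.germTorsor hζ).exists_global h.dense
  refine ⟨f, fun y hy => ?_, fun j => ?_⟩
  · exact ((hf y).self_of_nhds fun hV => hy (h.range_subset hV)).2 (h.chainVal_of_notMem ζ hy)
  · have ht : (1 / 2 : ℝ) ∈ Ioo (0 : ℝ) 1 := by norm_num
    rw [(hf _).self_of_nhds (h.inner_mem ht).2, h.nonCrossing.chainVal_eq ζ ⟨_, ht, rfl⟩]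

/-- Jumps are locally constant at smooth points and an open arc is connected; the midpoint can
therefore stand for the whole arc. -/
theorem IsTameNet.constNear_inner_iff {f : S2 → ZMod 2} (hf : ∀ y, y ∉ N → ConstNear N f y)
    {j : Fin m} {s t : ℝ} (hs : s ∈ Ioo (0 : ℝ) 1) (ht : t ∈ Ioo (0 : ℝ) 1) :
    ConstNear N f (γ j s) ↔ ConstNear N f (γ j t) := by
  refine isPreconnected_Ioo.induction₂ (P := fun s t => ConstNear N f (γ j s) ↔ ConstNear N f (γ j t))
    ?_ ?_ ?_ hs ht
  · intro u hu
    obtain ⟨hN, hV⟩ := h.inner_mem (j := j) hu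
    obtain ⟨β, hβ⟩ := h.smooth_of_notMem hN hV
    have hc : ContinuousWithinAt (γ j) (Ioo 0 1) u :=
      ((h.nonCrossing.1 j).1 u (Ioo_subset_Icc_self hu)).mono Ioo_subset_Icc_self
    filter_upwards [hc.eventually (hβ.eventually_constNear_iff h.dense (Filter.Eventually.of_forall hf)),
      self_mem_nhdsWithin] with v h1 h2
    exact (h1 (h.inner_mem h2).1).symm
  · exact fun a b c _ _ _ h1 h2 => h1.trans h2
  · exact fun a b _ _ h1 => h1.symm

/-- The jumps of a function which is locally constant off the net form a cycle. -/
theorem IsTameNet.chainBoundary_eq_zero {f : S2 → ZMod 2} (hf : ∀ y, y ∉ N → ConstNear N f y)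
    {ζ : Fin m → ZMod 2} (hζ : ∀ j, ConstNear N f (γ j (1 / 2)) ↔ ζ j = 0) (v : S2) :
    chainBoundary γ ζ v = 0 := by
  classical
  by_cases hv : v ∈ range (endPt γ)
  · obtain ⟨n, β, hβ⟩ := h.exists_star (h.range_subset hv)
    obtain ⟨q, hq⟩ := h.exists_equiv hv hβ
    have hsum := hβ.sum_jumps_eq_zero h.dense (by
      filter_upwards [eventually_notMem_range_endPt γ _] with y hyV hyN using h.smooth_of_notMem hyN hyV) hf
      (fun i => ζ (q.symm i).1.1) (fun i => by
        obtain ⟨e, rfl⟩ := q.surjective i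
        filter_upwards [hq e] with t ht
        obtain ⟨s, hs, e1⟩ := ht
        rw [← e1, h.constNear_inner_iff hf hs (by norm_num : (1 / 2 : ℝ) ∈ Ioo (0 : ℝ) 1), hζ]
        simp)
    rw [← hsum, chainBoundary, ← Equiv.sum_comp q, ← Finset.sum_subtype_eq_sum_filter]
    simp only [Equiv.symm_apply_apply]
    exact Finset.sum_bij (fun e _ => ⟨e.1, e.2⟩) (by simp) (by simp) (by simp) (by simp)
  · refine Finset.sum_eq_zero fun e he => ?_
    exact absurd ⟨e, (Finset.mem_filter.1 he).2⟩ hv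

end Jumps

/-! ### The faces of a partition -/

section Faces

variable {k : ℕ} {D : Fin k → Set S2}

/-- The function with value `c i` on `D i`. -/
noncomputable def faceFun (D : Fin k → Set S2) (c : Fin k → ZMod 2) (y : S2) : ZMod 2 :=
  open Classical in ∑ i, if y ∈ D i then c i else 0

theorem faceFun_eq (hD : Pairwise fun i j => Disjoint (D i) (D j)) (c : Fin k → ZMod 2) {y : S2}
    {i : Fin k} (hy : y ∈ D i) : faceFun D c y = c i := by
  classical
  unfold faceFun
  rw [Finset.sum_eq_single i]
  · exact if_pos hy
  · intro j _ hj
    exact if_neg fun hyj => disjoint_left.1 (hD hj) hyj hy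
  · simp

theorem boundarySet_eq : boundarySet D = ⋃ i, frontier (D i) := by
  rw [boundarySet, IsClosed.closure_eq]
  exact isClosed_iUnion_of_finite fun i => isClosed_frontier

theorem disjoint_boundarySet (hP : IsPartition D) (i : Fin k) : Disjoint (D i) (boundarySet D) := by
  rw [boundarySet_eq, disjoint_iUnion_right]
  intro j
  have hi := (hP.1 i).1
  by_cases hij : i = j
  · subst hij
    rw [IsOpen.frontier_eq hi]
    exact disjoint_sdiff_right
  · exact ((hP.2 hij).closure_right hi).mono_right frontier_subset_closure

theorem closure_iUnion_eq (hS : IsStrong D) : closure (⋃ i, D i) = univ :=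
  univ_subset_iff.1 (hS ▸ interior_subset)

theorem compl_boundarySet (hP : IsPartition D) (hS : IsStrong D) :
    (boundarySet D)ᶜ = ⋃ i, D i := by
  refine Subset.antisymm (fun y hy => ?_) (iUnion_subset fun i => ?_)
  · have h1 : y ∈ closure (⋃ i, D i) := closure_iUnion_eq hS ▸ mem_univ y
    rw [closure_iUnion_of_finite] at h1
    obtain ⟨i, hi⟩ := mem_iUnion.1 h1
    refine mem_iUnion.2 ⟨i, ?_⟩
    by_contra hcon
    apply hy
    rw [boundarySet_eq]
    refine mem_iUnion.2 ⟨i, ?_⟩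
    rw [(hP.1 i).1.frontier_eq]
    exact ⟨hi, hcon⟩
  · exact (disjoint_boundarySet hP i).subset_compl_right

theorem dense_compl_boundarySet (hP : IsPartition D) (hS : IsStrong D) :
    Dense (boundarySet D)ᶜ := by
  rw [compl_boundarySet hP hS, dense_iff_closure_eq, closure_iUnion_eq hS]

theorem exists_face_of_isPreconnected (hP : IsPartition D) (hS : IsStrong D) {S : Set S2}
    (hSp : IsPreconnected S) (hSn : S.Nonempty) (hSN : S ⊆ (boundarySet D)ᶜ) : ∃ i, S ⊆ D i := by
  rw [compl_boundarySet hP hS] at hSN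
  obtain ⟨y, hy⟩ := hSn
  obtain ⟨i, hi⟩ := mem_iUnion.1 (hSN hy)
  refine ⟨i, hSp.subset_left_of_subset_union (hP.1 i).1
    (isOpen_iUnion fun j : {j // j ≠ i} => (hP.1 j).1) ?_ ?_ ⟨y, hy, hi⟩⟩
  · rw [disjoint_iUnion_right]
    exact fun j => hP.2 (Ne.symm j.2)
  · intro u hu
    obtain ⟨j, hj⟩ := mem_iUnion.1 (hSN hu)
    by_cases hij : j = i
    · exact Or.inl (hij ▸ hj)
    · exact Or.inr (mem_iUnion.2 ⟨⟨j, hij⟩, hj⟩)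

theorem constNear_faceFun (hP : IsPartition D) (hS : IsStrong D) (c : Fin k → ZMod 2) {y : S2}
    (hy : y ∉ boundarySet D) : ConstNear (boundarySet D) (faceFun D c) y := by
  obtain ⟨i, hi⟩ := mem_iUnion.1 (compl_boundarySet hP hS ▸ hy : y ∈ ⋃ i, D i)
  refine ⟨c i, ?_⟩
  filter_upwards [(hP.1 i).1.mem_nhds hi] with u hu _ using faceFun_eq hP.2 c hu

/-- The two faces adjacent to each arc of the net, and the duality between functions on the faces
and cycles of the net. -/
structure IsFacePair {m : ℕ} (D : Fin k → Set S2) (γ : Fin m → ℝ → S2) (l r : Fin m → Fin k) :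
    Prop where
  const : ∀ c : Fin k → ZMod 2, (∀ j, c (l j) = c (r j)) → ∀ a b, c a = c b
  boundary : ∀ (c : Fin k → ZMod 2) v, chainBoundary γ (fun j => c (l j) + c (r j)) v = 0
  exists_of_cycle : ∀ ζ : Fin m → ZMod 2, (∀ v, chainBoundary γ ζ v = 0) →
    ∃ c : Fin k → ZMod 2, ∀ j, ζ j = c (l j) + c (r j)
  of_adj : ∀ a b, (neighborGraph D).Adj a b → ∃ j, l j = a ∧ r j = b ∨ l j = b ∧ r j = a
  ne_of_noCracks : NoCracks D → ∀ j, l j ≠ r j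

/-- The faces met on the two sides of the midpoint of an arc define `l` and `r`. The properties
follow by translating jumps of functions locally constant off `N` into differences of values on
faces. -/
theorem IsTameNet.exists_facePair {m : ℕ} {X : Set S2} {γ : Fin m → ℝ → S2} (hP : IsPartition D)
    (hS : IsStrong D) (h : IsTameNet (boundarySet D) X γ) :
    ∃ l r : Fin m → Fin k, IsFacePair D γ l r := by
  have hhalf : (1 / 2 : ℝ) ∈ Ioo (0 : ℝ) 1 := by norm_num
  have hsides : ∀ j, ∃ a b : Fin k, ∃ S T : Set S2, S ⊆ D a ∧ T ⊆ D b ∧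
      S ∪ T ∪ boundarySet D ∈ 𝓝 (γ j (1 / 2)) ∧ γ j (1 / 2) ∈ closure S ∧ γ j (1 / 2) ∈ closure T ∧
      ∀ᶠ y in 𝓝 (γ j (1 / 2)), y ∈ boundarySet D → y ∈ closure S ∧ y ∈ closure T := by
    intro j
    obtain ⟨hN, hV⟩ := h.inner_mem (j := j) hhalf
    obtain ⟨β, hβ⟩ := h.smooth_of_notMem hN hV
    obtain ⟨S, T, hSp, hTp, hSN, hTN, hST, hxS, hxT, hcl⟩ := hβ.exists_sides Filter.univ_mem
    obtain ⟨a, ha⟩ := exists_face_of_isPreconnected hP hS hSp (closure_nonempty_iff.1 ⟨_, hxS⟩)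
      fun y hy => (hSN hy).2
    obtain ⟨b, hb⟩ := exists_face_of_isPreconnected hP hS hTp (closure_nonempty_iff.1 ⟨_, hxT⟩)
      fun y hy => (hTN hy).2
    exact ⟨a, b, S, T, ha, hb, hST, hxS, hxT, hcl⟩
  choose l r S T hSl hTr hST hxS hxT hcl using hsides
  have hDN : ∀ i, D i ⊆ (boundarySet D)ᶜ := fun i => (disjoint_boundarySet hP i).subset_compl_right
  have hdense := h.dense
  have hjump : ∀ (f : S2 → ZMod 2) (c : Fin k → ZMod 2), (∀ i, ∀ y ∈ D i, f y = c i) → ∀ j,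
      ConstNear (boundarySet D) f (γ j (1 / 2)) ↔ c (l j) = c (r j) := by
    intro f c hfc j
    exact constNear_iff_of_sides ((hSl j).trans (hDN _)) ((hTr j).trans (hDN _)) (hST j) (hxS j)
      (hxT j) (fun y hy => hfc _ y (hSl j hy)) (fun y hy => hfc _ y (hTr j hy))
  have hface : ∀ (c : Fin k → ZMod 2) j, ConstNear (boundarySet D) (faceFun D c) (γ j (1 / 2)) ↔
      c (l j) = c (r j) := fun c => hjump _ c fun i y hy => faceFun_eq hP.2 c hy
  have hoff := fun c : Fin k → ZMod 2 => fun y hy => constNear_faceFun hP hS c (y := y) hy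
  have hne : ∀ i, (D i).Nonempty := fun i => (hP.1 i).2.1.nonempty
  have hsub : ∀ a b : ZMod 2, a = b ↔ a + b = 0 := by decide
  refine ⟨l, r, ⟨fun c hc a b => ?_, fun c v => ?_, fun ζ hζ => ?_, fun a b hab => ?_, ?_⟩⟩
  · have hall : ∀ y ∈ univ, ConstNear (boundarySet D) (faceFun D c) y := by
      intro y _
      refine h.constNear_of_off_ends (Filter.Eventually.of_forall fun u hu => ?_)
      by_cases huN : u ∈ boundarySet D
      · obtain ⟨j, t, ht, rfl⟩ := h.mem_interior huN hu
        rw [h.constNear_inner_iff (hoff c) ht hhalf, hface]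
        exact hc j
      · exact hoff c u huN
    have hconn : IsPreconnected (univ : Set S2) := by
      have := isPreconnected_sphere (E := E3) (by
        rw [← Module.finrank_eq_rank]
        simp) 0 1
      rwa [← Topology.IsInducing.subtypeVal.isPreconnected_image, image_univ, Subtype.range_coe]
    obtain ⟨y, hy⟩ := hne a
    obtain ⟨u, hu⟩ := hne b
    have := eq_of_isPreconnected hdense hconn hall (mem_univ y) (mem_univ u) (hDN a hy) (hDN b hu)
    rwa [faceFun_eq hP.2 c hy, faceFun_eq hP.2 c hu] at this
  · refine h.chainBoundary_eq_zero (hoff c) (fun j => ?_) v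
    rw [hface, hsub]
  -- A function with the prescribed jumps is constant on each domain, which is connected and misses
  -- `N`.
  · obtain ⟨f, hf, hfj⟩ := h.exists_jump_function hζ
    have hc : ∀ i, ∃ a, ∀ y ∈ D i, f y = a := fun i =>
      exists_value_of_side hdense (hP.1 i).2.1.isPreconnected (hDN i) fun y hy => hf y (hDN i hy)
    choose c hc using hc
    refine ⟨c, fun j => ?_⟩
    have h1 := (hfj j).symm.trans (hjump f c hc j)
    rw [hsub (c (l j)) (c (r j))] at h1
    have h2 : ∀ a b : ZMod 2, (a = 0 ↔ b = 0) → a = b := by decide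
    exact h2 _ _ h1
  -- If no arc separated `D a` from `D b`, the indicator of `D a` would have no jump in the
  -- connected set `C`, which contains both domains.
  · by_contra! hcon
    obtain ⟨hab, hconn⟩ := hab
    set C := interior (closure (D a ∪ D b)) with hC
    have hoth : ∀ i, i ≠ a → i ≠ b → ∀ y ∈ C, y ∉ D i := by
      intro i hia hib y hy hyi
      have h1 : Disjoint (D i) (closure (D a ∪ D b)) :=
        ((hP.2 hia).union_right (hP.2 hib)).closure_right (hP.1 i).1
      exact disjoint_left.1 h1 hyi (interior_subset hy)
    have hall : ∀ y ∈ C, ConstNear (boundarySet D) (faceFun D (Pi.single a 1)) y := by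
      intro y hyC
      refine h.constNear_of_off_ends ?_
      filter_upwards [isOpen_interior.mem_nhds hyC] with u huC hu
      by_cases huN : u ∈ boundarySet D
      swap
      · exact hoff _ u huN
      obtain ⟨j, t, ht, rfl⟩ := h.mem_interior huN hu
      rw [h.constNear_inner_iff (hoff _) ht hhalf, hface]
      -- A third face does not meet `C`, so its indicator does not jump across this arc: that face
      -- is on both sides or on neither.
      have hlr : ∀ i, i ≠ a → i ≠ b → (l j = i ↔ r j = i) := by
        intro i hia hib
        have h1 : ConstNear (boundarySet D) (faceFun D (Pi.single i 1)) (γ j t) := by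
          refine ⟨0, ?_⟩
          filter_upwards [isOpen_interior.mem_nhds huC] with w hw _
          unfold faceFun
          refine Finset.sum_eq_zero fun i' _ => ?_
          by_cases hi' : i' = i
          · rw [if_neg (hi' ▸ hoth i hia hib w hw)]
          · simp [hi']
        rw [h.constNear_inner_iff (hoff _) ht hhalf, hface] at h1
        rw [Pi.single_apply, Pi.single_apply] at h1
        by_cases h2 : l j = i <;> by_cases h3 : r j = i <;> simp [h2, h3] at h1 ⊢
      by_cases hlr' : l j = r j
      · rw [hlr']
      · exfalso
        have h1 : l j = a ∨ l j = b := by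
          by_contra! hc
          exact hlr' ((hlr _ hc.1 hc.2).1 rfl).symm
        have h2 : r j = a ∨ r j = b := by
          by_contra! hc
          exact hlr' ((hlr _ hc.1 hc.2).2 rfl)
        have h3 := hcon j
        rcases h1 with h1 | h1 <;> rcases h2 with h2 | h2
        · exact hlr' (h1.trans h2.symm)
        · exact h3.1 h1 h2
        · exact h3.2 h1 h2
        · exact hlr' (h1.trans h2.symm)
    have hDC : ∀ i, D i ⊆ D a ∪ D b → D i ⊆ C := fun i hi =>
      interior_maximal (hi.trans subset_closure) (hP.1 i).1
    obtain ⟨y, hy⟩ := hne a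
    obtain ⟨u, hu⟩ := hne b
    have := eq_of_isPreconnected hdense hconn.isPreconnected hall (hDC a subset_union_left hy)
      (hDC b subset_union_right hu) (hDN a hy) (hDN b hu)
    rw [faceFun_eq hP.2 _ hy, faceFun_eq hP.2 _ hu] at this
    simp [hab.symm] at this
  -- With one face on both sides, a neighbourhood of the midpoint lies in the closure of that face;
  -- without cracks the midpoint would belong to the face and not to `N`.
  · intro hnc j hlr
    obtain ⟨hN, hV⟩ := h.inner_mem (j := j) hhalf
    have hmem : γ j (1 / 2) ∈ interior (closure (D (l j))) := by
      rw [mem_interior_iff_mem_nhds]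
      filter_upwards [hST j, hcl j] with y h1 h2
      rcases h1 with (h1 | h1) | h1
      · exact subset_closure (hSl j h1)
      · exact subset_closure (hlr ▸ hTr j h1)
      · exact closure_mono (hSl j) (h2 h1).1
    rw [hnc (l j)] at hmem
    exact hDN _ hmem hN

end Faces

/-! ### Degrees and the rank of the boundary map -/

section Degree

variable {m : ℕ} {N : Set S2} {X : Finset S2} {γ : Fin m → ℝ → S2}

/-- The number of ends of arcs at `v`. -/
noncomputable def degree (γ : Fin m → ℝ → S2) (v : S2) : ℕ :=
  open Classical in Finset.card {e | endPt γ e = v}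

/-- The arcs of which exactly one end is `v`. -/
noncomputable def leaving (γ : Fin m → ℝ → S2) (v : S2) : Finset (Fin m) :=
  open Classical in {j | ¬(endPt γ (j, false) = v ↔ endPt γ (j, true) = v)}

/-- The loops at `v`. -/
noncomputable def loops (γ : Fin m → ℝ → S2) (v : S2) : Finset (Fin m) :=
  open Classical in {j | endPt γ (j, false) = v ∧ endPt γ (j, true) = v}

theorem mem_leaving {v : S2} {j : Fin m} :
    j ∈ leaving γ v ↔ ¬(endPt γ (j, false) = v ↔ endPt γ (j, true) = v) := by
  simp [leaving]

theorem mem_loops {v : S2} {j : Fin m} :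
    j ∈ loops γ v ↔ endPt γ (j, false) = v ∧ endPt γ (j, true) = v := by
  simp [loops]

theorem degree_eq (v : S2) : degree γ v = (leaving γ v).card + 2 * (loops γ v).card := by
  classical
  simp only [degree, leaving, loops, Finset.card_filter, Finset.mul_sum]
  rw [← Finset.sum_add_distrib, Fintype.sum_prod_type]
  refine Finset.sum_congr rfl fun j _ => ?_
  rw [Fintype.sum_bool]
  by_cases h1 : endPt γ (j, false) = v <;> by_cases h2 : endPt γ (j, true) = v <;> simp [h1, h2]

/-- A loop contributes its value twice, hence nothing mod 2. -/
theorem chainBoundary_eq_sum (ζ : Fin m → ZMod 2) (v : S2) :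
    chainBoundary γ ζ v = ∑ j ∈ leaving γ v, ζ j := by
  classical
  have h2 : ∀ a : ZMod 2, a + a = 0 := by decide
  simp only [chainBoundary, leaving, Finset.sum_filter]
  rw [Fintype.sum_prod_type]
  refine Finset.sum_congr rfl fun j _ => ?_
  rw [Fintype.sum_bool]
  by_cases h3 : endPt γ (j, false) = v <;> by_cases h4 : endPt γ (j, true) = v <;>
    simp [h3, h4, h2]

theorem chainBoundary_one (v : S2) : chainBoundary γ 1 v = degree γ v := by
  rw [chainBoundary_eq_sum, degree_eq]
  have h2 : (2 : ZMod 2) = 0 := by decide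
  simp [h2]

theorem IsReducedNet.mem_iff (h : IsReducedNet N X γ) (j : Fin m) :
    endPt γ (j, false) ∈ X ↔ endPt γ (j, true) ∈ X := by
  by_cases h1 : endPt γ (j, false) ∈ X
  · by_cases h2 : endPt γ (j, true) ∈ X
    · exact iff_of_true h1 h2
    · exact absurd ((h.isolated (j, true) h2 (j, false)).2 rfl ▸ h1) h2
  · have := (h.isolated (j, false) h1 (j, true)).2 rfl
    rw [this]

theorem IsReducedNet.chainBoundary_of_notMem (h : IsReducedNet N X γ) (ζ : Fin m → ZMod 2) {v : S2}
    (hv : v ∉ X) : chainBoundary γ ζ v = 0 := by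
  rw [chainBoundary_eq_sum]
  refine Finset.sum_eq_zero fun j hj => absurd ?_ (mem_leaving.1 hj)
  constructor
  · rintro rfl
    exact (h.isolated (j, false) hv (j, true)).2 rfl
  · rintro rfl
    exact (h.isolated (j, true) hv (j, false)).2 rfl

/-- Every arc has two ends, so its value is counted twice. This makes the cycle condition at one
vertex redundant. -/
theorem IsReducedNet.sum_chainBoundary (h : IsReducedNet N X γ) (ζ : Fin m → ZMod 2) :
    ∑ v ∈ X, chainBoundary γ ζ v = 0 := by
  classical
  have h2 : ∀ a : ZMod 2, a + a = 0 := by decide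
  rw [Finset.sum_subset (Finset.subset_union_left (s₂ := Finset.univ.image (endPt γ)))
    fun v _ hv => h.chainBoundary_of_notMem ζ hv]
  unfold chainBoundary
  rw [Finset.sum_fiberwise_of_maps_to (f := fun e : Fin m × Bool => ζ e.1)
    fun e _ => Finset.mem_union_right _ (Finset.mem_image_of_mem _ (Finset.mem_univ e)),
    Fintype.sum_prod_type]
  exact Finset.sum_eq_zero fun j _ => by rw [Fintype.sum_bool, h2]

/-- The handshake count. The arcs in `B` are closed lines, whose ends the sum over `X` does not see.
-/
theorem IsReducedNet.sum_degree (h : IsReducedNet N X γ) :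
    ∃ B : Finset (Fin m), (∀ j, j ∈ B ↔ endPt γ (j, false) ∉ X) ∧
      ∑ v ∈ X, degree γ v + 2 * B.card = 2 * m := by
  classical
  refine ⟨Finset.univ.filter fun j => endPt γ (j, false) ∉ X, fun j => by simp, ?_⟩
  have h1 : ∑ v ∈ X, degree γ v = ∑ j : Fin m, if endPt γ (j, false) ∈ X then 2 else 0 := by
    have h2 : ∑ v ∈ X, degree γ v =
        ∑ e : Fin m × Bool, if endPt γ e ∈ X then 1 else 0 := by
      simp only [degree, Finset.card_filter]
      rw [Finset.sum_comm]
      exact Finset.sum_congr rfl fun e _ => by simp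
    rw [h2, Fintype.sum_prod_type]
    refine Finset.sum_congr rfl fun j _ => ?_
    rw [Fintype.sum_bool]
    have := h.mem_iff j
    by_cases h3 : endPt γ (j, false) ∈ X
    · simp [h3, this.1 h3]
    · simp [h3, mt this.2 h3]
  rw [h1, Finset.card_filter, Finset.mul_sum, ← Finset.sum_add_distrib]
  have : ∀ j : Fin m, ((if endPt γ (j, false) ∈ X then 2 else 0) +
      2 * if endPt γ (j, false) ∉ X then 1 else 0) = 2 := by
    intro j
    by_cases h3 : endPt γ (j, false) ∈ X <;> simp [h3]
  rw [Finset.sum_congr rfl fun j _ => this j]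
  simp [mul_comm]

end Degree

/-! ### Dimension counts mod 2 -/

section Rank

variable {m k : ℕ} {N : Set S2} {X : Finset S2} {γ : Fin m → ℝ → S2} {D : Fin k → Set S2}
  {l r : Fin m → Fin k}

/-- The map from chains to the values of their boundary. -/
noncomputable def boundaryMap (γ : Fin m → ℝ → S2) (Y : Finset S2) :
    (Fin m → ZMod 2) →ₗ[ZMod 2] (Y → ZMod 2) where
  toFun ζ v := chainBoundary γ ζ v
  map_add' ζ ξ := by
    ext v
    simp [chainBoundary, Finset.sum_add_distrib]
  map_smul' a ζ := by
    ext v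
    simp [chainBoundary, Finset.mul_sum]

/-- The map from functions on the faces to the chain of their jumps. -/
def jumpMap (l r : Fin m → Fin k) : (Fin k → ZMod 2) →ₗ[ZMod 2] (Fin m → ZMod 2) where
  toFun c j := c (l j) + c (r j)
  map_add' c d := by
    ext j
    simp only [Pi.add_apply]
    ring
  map_smul' a c := by
    ext j
    simp [mul_add]

theorem jumpMap_one : jumpMap l r 1 = 0 := by
  have : (1 : ZMod 2) + 1 = 0 := by decide
  ext j
  simpa [jumpMap] using this

/-- Were `ζ` a cycle, it would be the jump of some face function `c`. Neighbors have an arc between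
them, on which `ζ` is nonzero, so `c` would be a 2-colouring of the graph of neighbors. -/
theorem IsFacePair.exists_chainBoundary_ne_zero (h : IsFacePair D γ l r) (hD : ¬ IsAdmissible D)
    {ζ : Fin m → ZMod 2} (hζ : ∀ j, ζ j = 0 → l j = r j) : ∃ v, chainBoundary γ ζ v ≠ 0 := by
  by_contra! hcon
  obtain ⟨c, hc⟩ := h.exists_of_cycle ζ hcon
  have h2 : ∀ a : ZMod 2, a + a = 0 := by decide
  refine hD ⟨SimpleGraph.Coloring.mk c fun {a b} hab heq => ?_⟩
  obtain ⟨j, hj⟩ := h.of_adj a b hab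
  have h0 : ζ j = 0 := by
    rw [hc]
    rcases hj with ⟨rfl, rfl⟩ | ⟨rfl, rfl⟩
    · rw [heq, h2]
    · rw [heq, h2]
  have h1 := hζ j h0
  rcases hj with ⟨rfl, rfl⟩ | ⟨rfl, rfl⟩
  · exact hab.ne h1
  · exact hab.ne h1.symm

/-- The jumps of the indicator of the face `l j` form a cycle, with value `1` on `j` if `r j` is
another face. -/
theorem IsFacePair.eq_of_cycle (h : IsFacePair D γ l r) {j : Fin m}
    (hj : ∀ ζ, (∀ v, chainBoundary γ ζ v = 0) → ζ j = 0) : l j = r j := by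
  have h1 := hj _ (h.boundary (Pi.single (l j) 1))
  by_contra hne
  simp [Ne.symm hne] at h1

/-- One half of Euler's formula: cycles have dimension at least `m - Y.card`, and at most `k - 1`
since they are jumps of face functions and the constant `1` has none. -/
theorem IsFacePair.le_card_add (h : IsFacePair D γ l r) (hk : 0 < k) {Y : Finset S2}
    (hY : ∀ ζ, (∀ v ∈ Y, chainBoundary γ ζ v = 0) → ∀ v, chainBoundary γ ζ v = 0) :
    m + 1 ≤ k + Y.card := by
  have h1 := (boundaryMap γ Y).finrank_range_add_finrank_ker
  have h2 := (jumpMap l r).finrank_range_add_finrank_ker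
  have h3 : Module.finrank (ZMod 2) (LinearMap.ker (boundaryMap γ Y)) ≤
      Module.finrank (ZMod 2) (LinearMap.range (jumpMap l r)) := by
    refine Submodule.finrank_mono fun ζ hζ => ?_
    obtain ⟨c, hc⟩ := h.exists_of_cycle ζ (hY ζ fun v hv => congrFun hζ ⟨v, hv⟩)
    exact ⟨c, funext fun j => (hc j).symm⟩
  have h4 : 0 < Module.finrank (ZMod 2) (LinearMap.ker (jumpMap l r)) := by
    rw [Module.finrank_pos_iff_exists_ne_zero]
    refine ⟨⟨1, jumpMap_one⟩, fun h0 => ?_⟩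
    have := congrFun (congrArg Subtype.val h0) ⟨0, hk⟩
    exact one_ne_zero this
  have h5 := Submodule.finrank_le (LinearMap.range (boundaryMap γ Y))
  simp only [Module.finrank_fintype_fun_eq_card, Fintype.card_fin, Fintype.card_coe] at h1 h2 h5
  omega

/-- Only constants have no jumps, so jumps have dimension at least `k - 1`. If `m < k`, every chain
would be a jump and hence a cycle, including the chain of all arcs. -/
theorem IsFacePair.le_of_not_isAdmissible (h : IsFacePair D γ l r) (hD : ¬ IsAdmissible D) :
    k ≤ m := by
  by_contra! hlt
  have h2 := (jumpMap l r).finrank_range_add_finrank_ker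
  have h4 : Module.finrank (ZMod 2) (LinearMap.ker (jumpMap l r)) ≤ 1 := by
    refine finrank_le_one ⟨1, jumpMap_one⟩ fun c => ?_
    refine ⟨c.1 ⟨0, by omega⟩, Subtype.ext (funext fun a => ?_)⟩
    have h3 : ∀ a b : ZMod 2, a + b = 0 → a = b := by decide
    have := h.const c.1 (fun j => h3 _ _ (congrFun c.2 j)) a ⟨0, by omega⟩
    simp [this]
  have h5 := Submodule.finrank_le (LinearMap.range (jumpMap l r))
  have h6 : LinearMap.range (jumpMap l r) = ⊤ := by
    apply Submodule.eq_top_of_finrank_eq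
    simp only [Module.finrank_fintype_fun_eq_card, Fintype.card_fin] at h2 h5 ⊢
    omega
  obtain ⟨v, hv⟩ := h.exists_chainBoundary_ne_zero hD (ζ := 1) fun j hj => absurd hj one_ne_zero
  obtain ⟨c, hc⟩ : (1 : Fin m → ZMod 2) ∈ LinearMap.range (jumpMap l r) := h6 ▸ Submodule.mem_top
  exact hv (hc ▸ h.boundary c v)

/-- It is enough to check a cycle at all the vertices but one. -/
theorem IsReducedNet.chainBoundary_eq_zero (hR : IsReducedNet N X γ) {x : S2} {ζ : Fin m → ZMod 2}
    (hζ : ∀ v ∈ X, v ≠ x → chainBoundary γ ζ v = 0) (v : S2) : chainBoundary γ ζ v = 0 := by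
  by_cases hv : v ∈ X
  · by_cases hvx : v = x
    · rw [← hR.sum_chainBoundary ζ, Finset.sum_eq_single v]
      · exact fun w hw hwv => hζ w hw (hvx ▸ hwv)
      · exact fun hv' => absurd hv hv'
    · exact hζ v hv hvx
  · exact hR.chainBoundary_of_notMem ζ hv

/-- If exactly one arc leaves `v`, then the same face is on both sides of it. -/
theorem IsFacePair.eq_of_leaving_eq (h : IsFacePair D γ l r) {v : S2} {j : Fin m}
    (hj : leaving γ v = {j}) : l j = r j := by
  refine h.eq_of_cycle fun ζ hζ => ?_
  have := hζ v
  rwa [chainBoundary_eq_sum, hj, Finset.sum_singleton] at this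

end Rank

/-! ### The classification -/

/-- The branches of two stars describing the same germ of `N` correspond to each other. -/
theorem HasValence.unique {N : Set S2} {x : S2} {n n' : ℕ} (h : HasValence N x n)
    (h' : HasValence N x n') : n = n' := by
  obtain ⟨β, hβ⟩ := h.2.2.exists_isArcStar
  obtain ⟨β', hβ'⟩ := h'.2.2.exists_isArcStar
  obtain ⟨e, -⟩ := hβ.isTopStar.exists_equiv hβ'.isTopStar
  simpa using Fintype.card_congr e

theorem IsNet.hasValence_degree {m : ℕ} {N : Set S2} {γ : Fin m → ℝ → S2}
    (h : IsNet N (criticalSet N) γ) {x : S2} (hx : x ∈ criticalSet N) :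
    HasValence N x (degree γ x) := by
  classical
  obtain ⟨n, hn⟩ := hx
  obtain ⟨β, hβ⟩ := hn.2.2.exists_isArcStar
  obtain ⟨q, -⟩ := h.exists_equiv (h.exists_endPt x ⟨n, hn⟩) hβ
  have : degree γ x = n := by
    have h1 := Fintype.card_congr q
    rw [Fintype.card_fin, Fintype.card_subtype] at h1
    rw [← h1, degree]
  rwa [this]

/-! ### Nets of a regular partition -/

section Nets

variable {m k : ℕ} {D : Fin k → Set S2}

theorem IsRegularPartition.criticalSet_subset : criticalSet (boundarySet D) ⊆ boundarySet D :=
  fun _ ⟨_, h⟩ => h.1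

theorem IsRegularPartition.exists_arcStar (h : IsRegularPartition D) :
    ∀ x ∈ boundarySet D, x ∉ criticalSet (boundarySet D) →
      ∃ β : Fin 2 → ℝ → S2, IsArcStar (boundarySet D) x β :=
  fun x hx hxX => (h.2.2.2 x hx hxX).exists_isArcStar

theorem IsRegularPartition.exists_reducedNet (h : IsRegularPartition D) :
    ∃ (m : ℕ) (γ : Fin m → ℝ → S2),
      IsReducedNet (boundarySet D) (criticalSet (boundarySet D)) γ := by
  refine SpherePartition.exists_reducedNet h.exists_arcStar ?_
  have hD : ∀ i, ∃ (n : ℕ) (γ : Fin n → ℝ → S2), (∀ i, IsSegment (γ i)) ∧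
      frontier (D i) = ⋃ i, trace (γ i) := fun i =>
    let ⟨n, γ, _, h1, h2⟩ := (h.1.1 i).2.2.2
    ⟨n, γ, h1.1, h2⟩
  choose n g hg hfr using hD
  refine exists_net h.2.2.1 IsRegularPartition.criticalSet_subset
    (g := fun a : Σ i, Fin (n i) => g a.1 a.2) (fun a => hg a.1 a.2) ?_ h.exists_arcStar
  rw [boundarySet_eq, iUnion_sigma]
  exact iUnion_congr hfr

theorem IsNet.isTameNet {γ : Fin m → ℝ → S2} (h : IsRegularPartition D) (hS : IsStrong D)
    (hN : IsNet (boundarySet D) (criticalSet (boundarySet D)) γ) :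
    IsTameNet (boundarySet D) (criticalSet (boundarySet D)) γ :=
  ⟨hN, dense_compl_boundarySet h.1 hS, h.exists_arcStar,
    fun _ ⟨n, hn⟩ => ⟨n, hn.2.2.exists_isArcStar⟩⟩

theorem NonCrossing.comp {γ : Fin m → ℝ → S2} (h : NonCrossing γ) {f : Fin k → Fin m}
    (hf : Function.Injective f) : NonCrossing fun i => γ (f i) :=
  ⟨fun _ => h.1 _, fun _ _ hij => h.2 _ _ (hf.ne hij)⟩

theorem IsNet.comp {N X : Set S2} {γ : Fin m → ℝ → S2} (h : IsNet N X γ) (σ : Equiv.Perm (Fin m)) :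
    IsNet N X fun i => γ (σ i) := by
  refine ⟨h.nonCrossing.comp σ.injective, ?_, fun x hx => ?_⟩
  · rw [h.eq_iUnion]
    exact (σ.surjective.iUnion_comp fun j => trace (γ j)).symm
  · obtain ⟨e, he⟩ := h.exists_endPt x hx
    exact ⟨(σ.symm e.1, e.2), by simpa [endPt] using he⟩

end Nets

/-! ### The cases, by number of critical points -/

section Classification

variable {m : ℕ} {X : Finset S2} {γ : Fin m → ℝ → S2} {D : Fin 4 → Set S2} {l r : Fin m → Fin 4}

theorem mem_loops_of_isLoop {j : Fin m} (hj : IsLoop (γ j)) : j ∈ loops γ (γ j 0) := by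
  rw [mem_loops]
  simpa [endPt] using hj.symm

theorem leaving_eq_singleton_of_loop {v : S2} (hv : degree γ v = 3) {j : Fin m}
    (hj : j ∈ loops γ v) : ∃ i, leaving γ v = {i} := by
  have := degree_eq (γ := γ) v
  have : 0 < (loops γ v).card := Finset.card_pos.2 ⟨j, hj⟩
  exact Finset.card_eq_one.1 (by omega)

/-- A loop uses two of the three ends, so a single arc leaves the vertex; it has the same face on
both sides, which is a crack. -/
theorem IsFacePair.not_isLoop (h : IsFacePair D γ l r) (hD : NoCracks D) {j : Fin m}
    (hv : degree γ (γ j 0) = 3) : ¬ IsLoop (γ j) := by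
  intro hj
  obtain ⟨i, hi⟩ := leaving_eq_singleton_of_loop hv (mem_loops_of_isLoop hj)
  exact h.ne_of_noCracks hD i (h.eq_of_leaving_eq hi)

theorem IsReducedNet.endPt_mem_of_sum (hR : IsReducedNet (boundarySet D) X γ)
    (hX : ∑ v ∈ X, degree γ v = 2 * m) (e : Fin m × Bool) : endPt γ e ∈ X := by
  obtain ⟨B, hB, hsum⟩ := hR.sum_degree
  have hB0 : B = ∅ := Finset.card_eq_zero.1 (by omega)
  obtain ⟨j, b⟩ := e
  have : endPt γ (j, false) ∈ X := by
    by_contra hj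
    simpa [hB0] using (hB j).2 hj
  cases b
  · exact this
  · exact (hR.mem_iff j).1 this

theorem endPt_false (j : Fin m) : endPt γ (j, false) = γ j 0 := by simp [endPt]

theorem endPt_true (j : Fin m) : endPt γ (j, true) = γ j 1 := by simp [endPt]

theorem IsReducedNet.ends_mem_range (hR : IsReducedNet (boundarySet D) X γ)
    (hX : ∑ v ∈ X, degree γ v = 2 * m) {n : ℕ} {x : Fin n → S2} (hx : (X : Set S2) = range x)
    (j : Fin m) : γ j 0 ∈ range x ∧ γ j 1 ∈ range x := by
  rw [← hx, ← endPt_false (γ := γ), ← endPt_true (γ := γ)]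
  exact ⟨hR.endPt_mem_of_sum hX _, hR.endPt_mem_of_sum hX _⟩

theorem isType3333 (hX : criticalSet (boundarySet D) = X) (hR : IsReducedNet (boundarySet D) X γ)
    (h : IsFacePair D γ l r) (hcard : X.card = 4) (hm : m = 6) (hdeg : ∀ x ∈ X, degree γ x = 3) :
    IsType3333 D := by
  subst hm
  have hX' : (X : Set S2) = range fun i => ((X.equivFinOfCardEq hcard).symm i : S2) := by
    rw [range_comp' Subtype.val, Equiv.range_eq_univ]
    simp
  have hval : ∀ x ∈ X, HasValence (boundarySet D) x 3 := fun x hx => by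
    have := (hX ▸ hR.toIsNet : IsNet _ (criticalSet (boundarySet D)) γ).hasValence_degree
      (hX ▸ hx : x ∈ criticalSet (boundarySet D))
    rwa [hdeg x hx] at this
  have hsum : ∑ v ∈ X, degree γ v = 2 * 6 := by
    rw [Finset.sum_congr rfl hdeg]
    simp [hcard]
  refine ⟨fun i => ((X.equivFinOfCardEq hcard).symm i : S2),
    Subtype.val_injective.comp (Equiv.injective _), hX.trans hX',
    fun i => hval _ (Subtype.coe_prop _), γ, hR.nonCrossing, hR.eq_iUnion,
    hR.ends_mem_range hsum hX', fun hnc j => h.not_isLoop hnc (hdeg _ ?_)⟩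
  rw [← endPt_false (γ := γ)]
  exact hR.endPt_mem_of_sum hsum _

theorem isType334 (hX : criticalSet (boundarySet D) = X) (hR : IsReducedNet (boundarySet D) X γ)
    (h : IsFacePair D γ l r) (hm : m = 5) {x : Fin 3 → S2} (hx : Function.Injective x)
    (hXx : (X : Set S2) = range x) (h0 : degree γ (x 0) = 3) (h1 : degree γ (x 1) = 3)
    (h2 : degree γ (x 2) = 4) : IsType334 D := by
  subst hm
  have hval : ∀ i, HasValence (boundarySet D) (x i) (degree γ (x i)) := fun i =>
    (hX ▸ hR.toIsNet : IsNet _ (criticalSet (boundarySet D)) γ).hasValence_degree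
      (hX ▸ hXx ▸ mem_range_self i : x i ∈ criticalSet (boundarySet D))
  have hval0 := hval 0
  have hval1 := hval 1
  have hval2 := hval 2
  rw [h0] at hval0
  rw [h1] at hval1
  rw [h2] at hval2
  have hXi : X = Finset.univ.image x := by
    rw [← Finset.coe_inj, hXx]
    simp
  have hsum : ∑ v ∈ X, degree γ v = 2 * 5 := by
    rw [hXi, Finset.sum_image hx.injOn, Fin.sum_univ_three, h0, h1, h2]
  have hend := hR.ends_mem_range hsum hXx
  have hloop : NoCracks D → ∀ j, IsLoop (γ j) → γ j 0 = x 2 := by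
    intro hnc j hj
    obtain ⟨i, hi⟩ := (hend j).1
    have hne : ∀ i, x i = γ j 0 → degree γ (x i) ≠ 3 := fun i hi hdeg =>
      h.not_isLoop hnc (hi ▸ hdeg) hj
    have := hne i hi
    fin_cases i
    · exact absurd h0 this
    · exact absurd h1 this
    · exact hi.symm
  refine ⟨x, hx, hX.trans hXx, hval0, hval1, hval2, γ, hR.nonCrossing,
    hR.eq_iUnion, hend, fun hnc => ⟨hloop hnc, fun i j hi hj => ?_⟩⟩
  by_contra hij
  have hi' := mem_loops_of_isLoop hi
  have hj' := mem_loops_of_isLoop hj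
  rw [hloop hnc i hi] at hi'
  rw [hloop hnc j hj] at hj'
  have h3 := degree_eq (γ := γ) (x 2)
  have h4 := Finset.one_lt_card.2 ⟨i, hi', j, hj', hij⟩
  have h5 : leaving γ (x 2) = ∅ := Finset.card_eq_zero.1 (by omega)
  -- Two loops use up the degree 4 of `x 2`, so every chain has zero boundary there. The condition
  -- at `x 1` follows from the others, and the single one left at `x 0` allows at most four arcs.
  have h6 := h.le_card_add (by norm_num) (Y := {x 0}) fun ζ hζ =>
    hR.chainBoundary_eq_zero (x := x 1) fun v hv hv1 => by
      rw [hXi, Finset.mem_image] at hv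
      obtain ⟨i, -, rfl⟩ := hv
      fin_cases i
      · exact hζ _ (by simp)
      · exact absurd rfl hv1
      · exact (chainBoundary_eq_sum _ _).trans (by
          change ∑ j ∈ leaving γ (x 2), ζ j = 0
          rw [h5, Finset.sum_empty])
  simp at h6

/-- With two critical points and four arcs, three arcs join the two critical points. -/
theorem IsReducedNet.exists_theta {γ : Fin 4 → ℝ → S2} {l r : Fin 4 → Fin 4} {a b : S2}
    (hXab : ∀ v, v ∈ X ↔ v = a ∨ v = b) (hR : IsReducedNet (boundarySet D) X γ)
    (h : IsFacePair D γ l r) (hadm : ¬ IsAdmissible D) (hab : a ≠ b) (ha : degree γ a = 3) :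
    ∃ γ' : Fin 4 → ℝ → S2, IsNet (boundarySet D) X γ' ∧
      (∀ j, j ≠ 3 → γ' j 0 = a ∧ γ' j 1 = b) ∧
      (γ' 3 0 = b ∧ γ' 3 1 = b ∧ degree γ b = 5 ∨ γ' 3 0 = γ' 3 1 ∧ γ' 3 0 ≠ a ∧ γ' 3 0 ≠ b ∧ degree γ b ≤ 3) := by
  classical
  have hXe : X = {a, b} := by
    ext v
    simp [hXab]
  have hdeg := degree_eq (γ := γ) a
  have hone : (leaving γ a).card ≠ 1 := by
    intro hone
    obtain ⟨i, hi⟩ := Finset.card_eq_one.1 hone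
    -- A single arc leaving `a` would have the same face on both sides. The chain of arcs with two
    -- different faces would then have no boundary at `a`, hence none at `b`, against
    -- non-admissibility.
    obtain ⟨v, hv⟩ := h.exists_chainBoundary_ne_zero hadm (ζ := fun j => if l j = r j then 0 else 1)
      fun j hj => by
        by_contra hne
        simp [hne] at hj
    refine hv (hR.chainBoundary_eq_zero (x := b) (fun w hw hwb => ?_) v)
    rw [((hXab w).1 hw).resolve_right hwb, chainBoundary_eq_sum, hi, Finset.sum_singleton,
      if_pos (h.eq_of_leaving_eq hi)]
  have hJ : (leaving γ a).card = 3 := by omega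
  have hL : loops γ a = ∅ := Finset.card_eq_zero.1 (by omega)
  obtain ⟨k, hk⟩ := Finset.card_eq_one.1
    (show (leaving γ a)ᶜ.card = 1 by rw [Finset.card_compl, hJ, Fintype.card_fin])
  have hmem : ∀ j, j ≠ k ↔ j ∈ leaving γ a := fun j => by
    rw [← not_iff_not, not_not, ← Finset.mem_singleton, ← hk, Finset.mem_compl]
  have hends : ∀ j, j ≠ k → γ j 0 = a ∧ γ j 1 = b ∨ γ j 0 = b ∧ γ j 1 = a := by
    intro j hj
    have h1 := mem_leaving.1 ((hmem j).1 hj)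
    have h2 := hR.mem_iff j
    rw [hXab, hXab] at h2
    rw [endPt_false, endPt_true] at h1 h2
    tauto
  have hka : γ k 0 ≠ a ∧ γ k 1 ≠ a := by
    have h1 : k ∉ leaving γ a := fun h1 => (hmem k).2 h1 rfl
    have h2 : k ∉ loops γ a := by simp [hL]
    rw [mem_leaving, endPt_false, endPt_true] at h1
    rw [mem_loops, endPt_false, endPt_true] at h2
    tauto
  have h2 := hR.mem_iff k
  rw [hXab, hXab, endPt_false, endPt_true] at h2
  set σ := Equiv.swap 3 k with hσ
  -- Arcs not starting at `a` are reversed. The remaining arc `k` is reversed too, harmlessly, since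
  -- it turns out to be closed.
  set o : Fin 4 → Bool := fun j => decide (γ j 0 ≠ a) with ho
  have hσ3 : σ 3 = k := Equiv.swap_apply_left _ _
  have hok : o k = true := by simp [ho, hka.1]
  have h30 : orient (o (σ 3)) (γ (σ 3)) 0 = γ k 1 := by simp [hσ3, hok, orient]
  have h31 : orient (o (σ 3)) (γ (σ 3)) 1 = γ k 0 := by simp [hσ3, hok, orient]
  obtain ⟨B, hB, hsum⟩ := hR.sum_degree
  rw [hXe, Finset.sum_pair hab, ha] at hsum
  refine ⟨fun j => orient (o (σ j)) (γ (σ j)), (hR.toIsNet.orient o).comp σ, fun j hj => ?_, ?_⟩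
  · have hjk : σ j ≠ k := fun e => hj (σ.injective (e.trans hσ3.symm))
    rcases hends _ hjk with h1 | h1
    · have : o (σ j) = false := by simp [ho, h1.1]
      simpa [orient, this] using h1
    · have : o (σ j) = true := by simp [ho, h1.1, hab.symm]
      simpa [orient, this] using h1.symm
  · simp only [h30, h31]
    by_cases hkb : γ k 0 = b
    · refine Or.inl ⟨(h2.1 (Or.inr hkb)).resolve_left hka.2, hkb, ?_⟩
      have hB0 : B = ∅ := by
        refine Finset.eq_empty_of_forall_notMem fun j hj => (hB j).1 hj ?_
        rw [endPt_false, hXab]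
        by_cases hjk : j = k
        · exact Or.inr (hjk ▸ hkb)
        · rcases hends j hjk with h1 | h1
          · exact Or.inl h1.1
          · exact Or.inr h1.1
      rw [hB0, Finset.card_empty] at hsum
      omega
    · have hkX : endPt γ (k, false) ∉ X := by
        rw [endPt_false, hXab]
        tauto
      have h3 := (hR.isolated _ hkX (k, true)).2 rfl
      rw [endPt_false, endPt_true] at h3
      have h4 : 0 < B.card := Finset.card_pos.2 ⟨k, (hB k).2 hkX⟩
      exact Or.inr ⟨h3, hka.2, h3 ▸ hkb, by omega⟩

theorem isType33_or_isType35 (hX : criticalSet (boundarySet D) = X)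
    (hR : IsReducedNet (boundarySet D) X γ) (h : IsFacePair D γ l r) (hadm : ¬ IsAdmissible D)
    (hm : m = 4) {a b : S2} (hab : a ≠ b) (hXab : X = ({a, b} : Set S2))
    (ha : degree γ a = 3) : IsType33 D ∨ IsType35 D := by
  subst hm
  have hmem : ∀ v, v ∈ X ↔ v = a ∨ v = b := fun v => by
    rw [← Finset.mem_coe, hXab]
    simp
  have hrange : (X : Set S2) = range ![a, b] := by
    rw [hXab]
    ext v
    simp [eq_comm (a := v), or_comm]
  have hinj : Function.Injective ![a, b] := by
    intro i j hij
    fin_cases i <;> fin_cases j <;> simp_all [hab.symm]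
  have hval : ∀ v ∈ X, HasValence (boundarySet D) v (degree γ v) := fun v hv =>
    (hX ▸ hR.toIsNet : IsNet _ (criticalSet (boundarySet D)) γ).hasValence_degree
      (hX ▸ hv : v ∈ criticalSet (boundarySet D))
  have hva := hval a ((hmem a).2 (Or.inl rfl))
  have hvb := hval b ((hmem b).2 (Or.inr rfl))
  rw [ha] at hva
  obtain ⟨δ, hδ, hjoin, hlast⟩ := hR.exists_theta hmem h hadm hab ha
  rcases hlast with ⟨h0, h1, h5⟩ | ⟨h01, h0a, h0b, hb⟩
  · rw [h5] at hvb
    exact Or.inr ⟨![a, b], hinj, hX.trans hrange, hva, hvb, δ, hδ.nonCrossing, hδ.eq_iUnion,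
      hjoin, h0, h1⟩
  -- The closed line leaves `b` with degree at most 3, and a critical point has valence at least 3.
  · rw [le_antisymm hb hvb.2.1] at hvb
    have hne : ∀ j : Fin 3, j.castSucc ≠ 3 := fun j => (Fin.castSucc_lt_last j).ne
    refine Or.inl ⟨![a, b], hinj, hX.trans hrange, Fin.forall_fin_two.2 ⟨hva, hvb⟩,
      fun j => δ j.castSucc, δ 3, hδ.nonCrossing.comp (Fin.castSucc_injective 3),
      ⟨hδ.nonCrossing.1 3, h01⟩, fun j => ?_, ?_, fun j => hjoin _ (hne j)⟩
    · rw [disjoint_left]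
      rintro _ ⟨s, hs, rfl⟩ ⟨t, ht, e⟩
      obtain ⟨hj0, hj1⟩ := hjoin _ (hne j)
      obtain ⟨hs', ht'⟩ := hδ.nonCrossing.2 _ _ (hne j) s hs t ht e.symm
      -- The closed line could meet another segment only at its base point, which is neither `a` nor
      -- `b`.
      have h3 : δ 3 t = δ 3 0 := by
        rcases ht' with rfl | rfl
        · rfl
        · exact h01.symm
      rcases hs' with rfl | rfl
      · exact h0a (h3.symm.trans (e.trans hj0))
      · exact h0b (h3.symm.trans (e.trans hj1))
    · rw [hδ.eq_iUnion]
      ext y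
      simp only [mem_iUnion, mem_union]
      rw [Fin.exists_fin_succ']
      rfl

theorem exists_hasType (hreg : IsRegularPartition D) (hS : IsStrong D) (hadm : ¬ IsAdmissible D) :
    ∃ t, HasType D t := by
  classical
  obtain ⟨m, γ, hR'⟩ := hreg.exists_reducedNet
  obtain ⟨l, r, h⟩ := (hR'.toIsNet.isTameNet hreg hS).exists_facePair hreg.1 hS
  obtain ⟨X, hX⟩ := hreg.2.2.1.exists_finset_coe
  have hR : IsReducedNet (boundarySet D) X γ := hX ▸ hR'
  have hdeg : ∀ v ∈ X, 3 ≤ degree γ v := fun v hv =>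
    (hR'.toIsNet.hasValence_degree (hX ▸ hv : v ∈ criticalSet (boundarySet D))).2.1
  obtain ⟨B, hB, hsum⟩ := hR.sum_degree
  have h4 := h.le_of_not_isAdmissible hadm
  obtain ⟨x₀, hx₀⟩ : X.Nonempty := by
    obtain ⟨v, hv⟩ := h.exists_chainBoundary_ne_zero hadm (ζ := 1) fun j hj =>
      absurd hj one_ne_zero
    by_contra! hne
    exact hv (hR.chainBoundary_of_notMem _ (by simp [hne]))
  have hle := h.le_card_add (by norm_num) (Y := X.erase x₀) fun ζ hζ =>
    hR.chainBoundary_eq_zero (x := x₀) fun v hv hne => hζ v (Finset.mem_erase.2 ⟨hne, hv⟩)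
  rw [Finset.card_erase_of_mem hx₀] at hle
  have hlow : X.card * 3 ≤ ∑ v ∈ X, degree γ v := Finset.card_nsmul_le_sum X _ 3 hdeg
  -- From `3 * X.card ≤ 2 * m` and `m ≤ X.card + 2` follows `X.card ≤ 4`; with `4 ≤ m` also `2 ≤
  -- X.card`.
  have hcard : X.card = 2 ∨ X.card = 3 ∨ X.card = 4 := by omega
  rcases hcard with hc | hc | hc
  · obtain ⟨a, b, hab, rfl⟩ := Finset.card_eq_two.1 hc
    rw [Finset.sum_pair hab] at hsum hlow
    have ha := hdeg a (by simp)
    have hb := hdeg b (by simp)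
    have hm : m = 4 := by omega
    have h44 : degree γ a = 3 ∨ degree γ b = 3 := by
      by_contra! hne
      -- The degrees add up to at most 8. If both are 4, the chain of all arcs is a cycle, against
      -- non-admissibility.
      have h5 : degree γ a = 4 ∧ degree γ b = 4 := by omega
      obtain ⟨v, hv⟩ := h.exists_chainBoundary_ne_zero hadm (ζ := 1) fun j hj =>
        absurd hj one_ne_zero
      have h6 : ((4 : ℕ) : ZMod 2) = 0 := by decide
      by_cases hvX : v ∈ ({a, b} : Finset S2)
      · rw [chainBoundary_one] at hv
        rcases Finset.mem_insert.1 hvX with rfl | hvb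
        · exact hv (h5.1 ▸ h6)
        · rw [Finset.mem_singleton.1 hvb] at hv
          exact hv (h5.2 ▸ h6)
      · exact hv (hR.chainBoundary_of_notMem _ hvX)
    have key : IsType33 D ∨ IsType35 D := by
      rcases h44 with h44 | h44
      · exact isType33_or_isType35 hX.symm hR h hadm hm hab (by simp) h44
      · exact isType33_or_isType35 hX.symm hR h hadm hm hab.symm (by simp [pair_comm]) h44
    rcases key with h1 | h1
    exacts [⟨.t33, h1⟩, ⟨.t35, h1⟩]
  · refine ⟨.t334, ?_⟩
    obtain ⟨a, b, c, hab, hac, hbc, rfl⟩ := Finset.card_eq_three.1 hc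
    have hs : ∑ v ∈ ({a, b, c} : Finset S2), degree γ v =
        degree γ a + degree γ b + degree γ c := by
      rw [Finset.sum_insert (by simp [hab, hac]), Finset.sum_pair hbc, add_assoc]
    rw [hs] at hsum hlow
    have ha := hdeg a (by simp)
    have hb := hdeg b (by simp)
    have hc := hdeg c (by simp)
    -- Here `9 ≤ 2 * m ≤ 10`. No closed line is left, and the degrees, with sum 10, are 3, 3 and 4
    -- in some order.
    have hm : m = 5 := by omega
    have key : ∀ u v w : S2, u ≠ v → u ≠ w → v ≠ w → (({a, b, c} : Finset S2) : Set S2) = {u, v, w} →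
        degree γ u = 3 → degree γ v = 3 → degree γ w = 4 → IsType334 D := by
      intro u v w huv huw hvw hXe hu hv hw
      refine isType334 hX.symm hR h hm (x := ![u, v, w]) ?_ ?_ hu hv hw
      · intro i j hij
        fin_cases i <;> fin_cases j <;>
          simp [huv, huw, hvw, huv.symm, huw.symm, hvw.symm] at hij ⊢
      · rw [hXe]
        ext y
        simp only [mem_range, Fin.exists_fin_succ, mem_insert_iff, mem_singleton_iff, eq_comm (a := y)]
        simp
    rcases (by omega : degree γ a = 4 ∨ degree γ b = 4 ∨ degree γ c = 4) with h5 | h5 | h5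
    · exact key b c a hbc hab.symm hac.symm (by ext; simp; tauto) (by omega) (by omega) h5
    · exact key a c b hac hab hbc.symm (by ext; simp; tauto) (by omega) (by omega) h5
    · exact key a b c hab hac hbc (by simp) (by omega) (by omega) h5
  · refine ⟨.t3333, isType3333 hX.symm hR h hc (by omega) fun x hx => ?_⟩
    have h5 : ∑ v ∈ X, degree γ v = ∑ v ∈ X, 3 := by
      rw [Finset.sum_const, hc, smul_eq_mul]
      omega
    exact ((Finset.sum_eq_sum_iff_of_le hdeg).1 h5.symm x hx).symm

theorem ncard_range_of_injective {n : ℕ} {x : Fin n → S2} (hx : Function.Injective x) :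
    (range x).ncard = n := by
  rw [← image_univ, ncard_image_of_injective _ hx, ncard_univ, Nat.card_fin]

theorem not_isType33_and_isType35 : ¬ (IsType33 D ∧ IsType35 D) := by
  rintro ⟨⟨x, -, hx, hval, -⟩, ⟨y, -, hy, -, hval', -⟩⟩
  obtain ⟨i, hi⟩ : y 1 ∈ range x := hx ▸ hy ▸ mem_range_self 1
  exact absurd ((hval i).unique (hi ▸ hval')) (by norm_num)

/-- The number of critical points separates all types except the two with two such points, which the
valence 5 tells apart. -/
theorem HasType.unique {s t : FourType} (hs : HasType D s) (ht : HasType D t) : s = t := by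
  have hn : ∀ t, HasType D t → (criticalSet (boundarySet D)).ncard =
      (match t with | .t3333 => 4 | .t334 => 3 | .t33 => 2 | .t35 => 2) := by
    rintro (_ | _ | _ | _) ⟨x, hx, e, -⟩ <;> exact e ▸ ncard_range_of_injective hx
  have h1 := (hn s hs).symm.trans (hn t ht)
  rcases s with _ | _ | _ | _ <;> rcases t with _ | _ | _ | _
  case t33.t35 => exact absurd ⟨hs, ht⟩ not_isType33_and_isType35
  case t35.t33 => exact absurd ⟨ht, hs⟩ not_isType33_and_isType35
  all_goals first | rfl | simp at h1

end Classification

end SpherePartition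

theorem proposition4p4 (D : Fin 4 → Set SpherePartition.S2)
    (hreg : SpherePartition.IsRegularPartition D)
    (hstrong : SpherePartition.IsStrong D)
    (hadm : ¬ SpherePartition.IsAdmissible D) :
    ∃! t : SpherePartition.FourType, SpherePartition.HasType D t := by
  obtain ⟨t, ht⟩ := SpherePartition.exists_hasType hreg hstrong hadm
  exact ⟨t, ht, fun s hs => SpherePartition.HasType.unique hs ht⟩
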